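/- Let $\Lambda\subset\mathbb{R}^d$ be a Delone set (infinite, uniformly discrete, relatively dense) with finite local complexity and uniform cluster frequencies relative to some van Hove sequence $(F_n)$: for every finite non-empty $P\subset\Lambda$ the number of translates of $P$ contained in $\Lambda\cap(F_n-t)$, divided by $\mathrm{Vol}(F_n)$, converges uniformly in $t\in\mathbb{R}^d$ to a constant $\mathrm{freq}(P,\Lambda)$. (Van Hove sequences consist of bounded measurable sets of positive volume with $\mathrm{Vol}(\partial^rF_n)/\mathrm{Vol}(F_n)\to0$ for all $r>0$, where $\partial^r F_n$ is the closed $r$-neighbourhood of the boundary.) Let $\Omega_\Lambda$ be the pattern space of $\Lambda$, i.e. the closure of $\{\varphi_t(\Lambda)=\Lambda-t: t\in\mathbb{R}^d\}$ in the pattern metric $\min(2^{-1/2},\bar d)$, where $\bar d(\Lambda_1,\Lambda_2)$ is the infimum of the $\varepsilon>0$ such that $B_{1/\varepsilon}\cap\varphi_x(\Lambda_1)=B_{1/\varepsilon}\cap\varphi_y(\Lambda_2)$ for some $x,y\in B_\varepsilon$. A function $f$ on $\mathbb{R}^d$ is $\Lambda$-equivariant if, for some $r>0$, $f(x)$ depends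 only on $B_r\cap\varphi_x(\Lambda)$. Let $\Delta_\Lambda^k$ be the space of smooth $\Lambda$-equivariant complex-valued $k$-forms on $\mathbb{R}^d$, and $H^k(\Omega_\Lambda;\mathbb{C})$ the cohomology of the complex $(\Delta^*_\Lambda,d)$. For $\eta\in\Delta^d_\Lambda$ let $\bar f_{\star\eta}$ be the continuous, transversally locally constant function on $\Omega_\Lambda$, smooth along orbits, with $\bar f_{\star\eta}(\varphi_t(\Lambda))=(\star\eta)(t)$ for all $t$. Then the $\mathbb{R}^d$-action on $\Omega_\Lambda$ has exactly one invariant Borel probability measure $\mu$, and there is a unique asymptotic cycle, the linear functional $$\mathfrak{C}_\Lambda:\Delta_\Lambda^d\to\mathbb{C},\qquad \mathfrak{C}_\Lambda(\eta)=\int_{\Omega_\Lambda}\bar f_{\star\eta}\,d\mu .$$ For every van Hove sequence $(G_n)$ one has $\mathfrak{C}_\Lambda(\eta)=\lim_n\mathrm{Vol}(G_n)^{-1}\int_{G_n}\eta$. The current $\mathfrak{C}_\Lambda$ is closed ($\mathfrak{C}_\Lambda(d\beta)=0$ for all $\beta\in\Delta_\Lambda^{d-1}$), and its homology class $[\mathfrak{C}_\Lambda]\in\mathrm{Hom}(H^d(\Omega_\Lambda;\mathbb{C}),\mathbb{C})$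 is nontrivial. Moreover, let $\upsilon_\Lambda=\sum_{x\in\Lambda}\delta_x$, and let $\tilde\upsilon$ denote the reflection of a measure $\upsilon$ at the origin. The autocorrelation $\gamma_\Lambda=\lim_n \mathrm{Vol}(G_n)^{-1}\,\upsilon_\Lambda|_{G_n}*\widetilde{\upsilon_\Lambda|_{G_n}}$ (vague limit) exists for every van Hove sequence $(G_n)$ and is independent of it, it is concentrated on $\Lambda-\Lambda$, and $\gamma_\Lambda(\{x-y\})=\mathrm{freq}(\{x,y\},\Lambda)$ for all $x,y\in\Lambda$. Its Fourier transform, as a tempered distribution, is a positive measure $\sigma_\Lambda$, the diffraction measure. There is a family of classes $[\lambda^x]\in H^d(\Omega_\Lambda;\mathbb{C})$, $x\in\mathbb{R}^d$, supported on $\Lambda-\Lambda$ (that is, $[\lambda^x]=0$ for $x\notin\Lambda-\Lambda$), such that for every smooth compactly supported $\chi:\mathbb{R}^d\to\mathbb{R}$ with $\int\chi=1$ and every $x$ the class $[\lambda^x]$ is represented by the form $\star\big(\sum_{y\in\Lambda,\ y+x\in\Lambda}\chi(\cdot-y)\big)$, and this family is dual to $\mathfrak{C}_\Lambda$ in the sense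 that $$[\mathfrak{C}_\Lambda]([\lambda^x])=\gamma_\Lambda(\{x\})\quad\text{for all }x\in\mathbb{R}^d .$$ Consequently the Fourier transform of the pure point measure $\sum_{x\in\Lambda-\Lambda}[\mathfrak{C}_\Lambda]([\lambda^x])\,\delta_x$ is $\sigma_\Lambda$: $\ \sum_{x\in\Lambda-\Lambda}[\mathfrak{C}_\Lambda]([\lambda^x])\,\hat\varphi(x)=\int\varphi\,d\sigma_\Lambda$ for every Schwartz function $\varphi$. -/

import Mathlib

open Set Filter Topology MeasureTheory
open scoped ContDiff Pointwise FourierTransform SchwartzMap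

namespace Delone

/-- The Euclidean space `ℝ^d`. -/
abbrev Euc (d : ℕ) : Type := EuclideanSpace ℝ (Fin d)

variable {d : ℕ}

/-! ### Delone sets, clusters and their frequencies -/

/-- The translate `φ_t(S) = S - t`, i.e. the set `S` seen from the point `t`. -/
def translate (S : Set (Euc d)) (t : Euc d) : Set (Euc d) := {x | x + t ∈ S}

/-- `Λ` is a Delone set: an infinite, countable and closed subset of `ℝ^d` which is uniformly
discrete and relatively dense. -/
structure IsDelone (Λ : Set (Euc d)) : Prop where
  infinite : Λ.Infinite
  countable : Λ.Countable
  closed : IsClosed Λ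
  uniformlyDiscrete : ∃ r : ℝ, 0 < r ∧ ∀ x ∈ Λ, ∀ y ∈ Λ, x ≠ y → r < dist x y
  relativelyDense : ∃ R : ℝ, 0 < R ∧ ∀ t : Euc d, (Metric.ball 0 R ∩ translate Λ t).Nonempty

/-- Finite local complexity: for each `R` there are, up to translation, only finitely many
patches of radius `R` centred at points of `Λ`. -/
def FiniteLocalComplexity (Λ : Set (Euc d)) : Prop :=
  ∀ R : ℝ, 0 < R → ∃ Y : Set (Euc d), Y.Finite ∧ Y ⊆ Λ ∧ ∀ x ∈ Λ, ∃ y ∈ Y,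
    Metric.ball x R ∩ Λ = (fun z => z + (x - y)) '' (Metric.ball y R ∩ Λ)

/-- A van Hove sequence: bounded measurable sets of positive volume such that for every `r > 0`
the volume of the closed `r`-neighbourhood of the boundary is asymptotically negligible. -/
structure IsVanHove (F : ℕ → Set (Euc d)) : Prop where
  bounded : ∀ n, Bornology.IsBounded (F n)
  measurable : ∀ n, MeasurableSet (F n)
  volume_pos : ∀ n, 0 < volume.real (F n)
  boundary : ∀ r : ℝ, 0 < r →
    Tendsto (fun n => volume.real (Metric.cthickening r (frontier (F n))) / volume.real (F n))
      atTop (𝓝 0)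

/-- The number `L_P(A)` of translates of the cluster `P` that are contained in `A ∩ Λ`. -/
noncomputable def clusterCount (Λ P A : Set (Euc d)) : ℕ :=
  {t : Euc d | translate P t ⊆ A ∩ Λ}.ncard

/-- `c` is the frequency of the cluster `P` in `Λ` relative to `F`: the averages
`L_P(φ_t(F n)) / Vol (F n)` converge to `c`, uniformly in `t`. -/
def HasUniformFrequency (Λ : Set (Euc d)) (F : ℕ → Set (Euc d)) (P : Set (Euc d)) (c : ℝ) : Prop :=
  TendstoUniformly
    (fun n (t : Euc d) => (clusterCount Λ P (translate (F n) t) : ℝ) / volume.real (F n))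
    (fun _ => c) atTop

/-- `Λ` has uniform cluster frequencies relative to `F`. -/
def UniformClusterFrequencies (Λ : Set (Euc d)) (F : ℕ → Set (Euc d)) : Prop :=
  ∀ P : Set (Euc d), P.Nonempty → P.Finite → P ⊆ Λ → ∃ c : ℝ, HasUniformFrequency Λ F P c

/-! ### The pattern space -/

/-- `S` and `T` agree on the ball of radius `1/ε` up to translations of size less than `ε`. -/
def LocallyClose (ε : ℝ) (S T : Set (Euc d)) : Prop :=
  ∃ x ∈ Metric.ball (0 : Euc d) ε, ∃ y ∈ Metric.ball (0 : Euc d) ε,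
    Metric.ball 0 ε⁻¹ ∩ translate S x = Metric.ball 0 ε⁻¹ ∩ translate T y

/-- The pattern metric `min (2^{-1/2}, inf {ε > 0 | S and T are ε-close})`, written as a single
infimum so that an empty set of `ε` contributes nothing. -/
noncomputable def patternDist (S T : Set (Euc d)) : ℝ :=
  sInf (insert (1 / √2) {ε : ℝ | 0 < ε ∧ LocallyClose ε S T})

lemma LocallyClose.mono {ε δ : ℝ} (hε : 0 < ε) (h : ε ≤ δ) {S T : Set (Euc d)}
    (H : LocallyClose ε S T) : LocallyClose δ S T := by
  obtain ⟨x, hx, y, hy, e⟩ := H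
  refine ⟨x, Metric.ball_subset_ball h hx, y, Metric.ball_subset_ball h hy, ?_⟩
  have hb : Metric.ball (0 : Euc d) δ⁻¹ ⊆ Metric.ball 0 ε⁻¹ :=
    Metric.ball_subset_ball (inv_anti₀ hε h)
  rw [← inter_eq_self_of_subset_left hb, inter_assoc, e, ← inter_assoc]

lemma patternDist_lt {δ : ℝ} (hδ : δ ≤ 1 / √2) {S T : Set (Euc d)} :
    patternDist S T < δ ↔ ∃ ε, 0 < ε ∧ ε < δ ∧ LocallyClose ε S T := by
  constructor
  · intro h
    obtain ⟨ε, hε, hlt⟩ := exists_lt_of_csInf_lt (insert_nonempty _ _) h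
    rcases hε with rfl | ⟨h0, hc⟩
    · exact absurd hlt (not_lt.2 hδ)
    · exact ⟨ε, h0, hlt, hc⟩
  · rintro ⟨ε, h0, hlt, hc⟩
    refine lt_of_le_of_lt (csInf_le ⟨0, ?_⟩ (Or.inr ⟨h0, hc⟩)) hlt
    rintro a (rfl | ⟨ha, -⟩)
    · positivity
    · exact ha.le

/-- The pattern space `Ω_Λ`: the closure of the set of all translates of `Λ` with respect to the
pattern metric. -/
def PatternSpace (Λ : Set (Euc d)) : Type :=
  {S : Set (Euc d) // ∀ δ > 0, ∃ t : Euc d, patternDist S (translate Λ t) < δ}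

namespace PatternSpace

variable {Λ : Set (Euc d)}

/-- The metric topology of the pattern metric. -/
instance : TopologicalSpace (PatternSpace Λ) where
  IsOpen U := ∀ S ∈ U, ∃ δ > 0, ∀ T : PatternSpace Λ, patternDist S.1 T.1 < δ → T ∈ U
  isOpen_univ := fun _ _ => ⟨1, one_pos, fun _ _ => mem_univ _⟩
  isOpen_inter := by
    rintro U V hU hV S ⟨hSU, hSV⟩
    obtain ⟨a, ha, hA⟩ := hU S hSU
    obtain ⟨b, hb, hB⟩ := hV S hSV
    exact ⟨min a b, lt_min ha hb, fun T hT =>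
      ⟨hA T (hT.trans_le (min_le_left _ _)), hB T (hT.trans_le (min_le_right _ _))⟩⟩
  isOpen_sUnion := by
    rintro 𝒰 h𝒰 S ⟨U, hU, hS⟩
    obtain ⟨δ, hδ, H⟩ := h𝒰 U hU S hS
    exact ⟨δ, hδ, fun T hT => ⟨U, hU, H T hT⟩⟩

instance : MeasurableSpace (PatternSpace Λ) := borel _

instance : BorelSpace (PatternSpace Λ) := ⟨rfl⟩

lemma translate_mem {S : Set (Euc d)}
    (hS : ∀ δ > 0, ∃ t : Euc d, patternDist S (translate Λ t) < δ) (s : Euc d) :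
    ∀ δ > 0, ∃ t : Euc d, patternDist (translate S s) (translate Λ t) < δ := by
  intro δ hδ
  set ε : ℝ := min δ (1 / √2) / 2 with hεdef
  have hε : 0 < ε := by positivity
  have hs : 0 < ε⁻¹ + ‖s‖ := by positivity
  obtain ⟨t, ht⟩ := hS (min (ε⁻¹ + ‖s‖)⁻¹ (1 / √2)) (by positivity)
  obtain ⟨η, hη, hlt, x, hx, y, hy, e⟩ := (patternDist_lt (min_le_right _ _)).1 ht
  have hη1 : η < (ε⁻¹ + ‖s‖)⁻¹ := hlt.trans_le (min_le_left _ _)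
  have hη2 : ε⁻¹ + ‖s‖ < η⁻¹ := (lt_inv_comm₀ hη hs).1 hη1
  have hηε : η < ε := by
    refine hη1.trans_le (inv_le_of_inv_le₀ hε ?_)
    linarith [norm_nonneg s]
  have hmin : min δ (1 / √2) ≤ δ := min_le_left _ _
  refine ⟨t + s, lt_of_lt_of_le ((patternDist_lt (δ := min δ (1 / √2)) (min_le_right _ _)).2
    ⟨ε, hε, by rw [hεdef]; exact half_lt_self (by positivity), x,
      Metric.ball_subset_ball hηε.le hx, y, Metric.ball_subset_ball hηε.le hy, ?_⟩) hmin⟩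
  ext z
  simp only [mem_inter_iff, and_congr_right_iff]
  intro hz
  have hz' : z + s ∈ Metric.ball (0 : Euc d) η⁻¹ := by
    rw [mem_ball_zero_iff] at hz ⊢
    linarith [norm_add_le z s]
  have := Set.ext_iff.1 e (z + s)
  simp only [mem_inter_iff, hz', true_and, translate, mem_ofPred_eq] at this ⊢
  rw [show z + x + s = z + s + x by abel, show z + y + (t + s) = z + s + y + t by abel]
  exact this

/-- The translation action of `ℝ^d` on the pattern space, `S ↦ φ_t(S)`. -/
def shift (t : Euc d) (S : PatternSpace Λ) : PatternSpace Λ :=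
  ⟨translate S.1 t, translate_mem S.2 t⟩

lemma self_mem (Λ : Set (Euc d)) :
    ∀ δ > 0, ∃ t : Euc d, patternDist Λ (translate Λ t) < δ := by
  intro δ hδ
  have hp : 0 < min δ (1 / √2) := by positivity
  refine ⟨0, lt_of_lt_of_le ((patternDist_lt (δ := min δ (1 / √2)) (min_le_right _ _)).2
    ⟨min δ (1 / √2) / 2, half_pos hp, half_lt_self hp, 0, ?_, 0, ?_, ?_⟩) (min_le_left _ _)⟩
  · simpa using half_pos hp
  · simpa using half_pos hp
  · simp [translate]

/-- `Λ` as a point of its pattern space. -/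
def base (Λ : Set (Euc d)) : PatternSpace Λ := ⟨Λ, self_mem Λ⟩

/-- `μ` is a translation-invariant Borel probability measure on the pattern space. -/
def IsInvariantProbability (μ : Measure (PatternSpace Λ)) : Prop :=
  IsProbabilityMeasure μ ∧ ∀ t : Euc d, μ.map (shift t) = μ

/-- `f` is transversally locally constant: around every `S` there is an `ε > 0` such that `f` is
constant on the set of all `T` in the pattern space that coincide with `S` on `B_{1/ε}`. -/
def TransversallyLocallyConstant (f : PatternSpace Λ → ℂ) : Prop :=
  ∀ S : PatternSpace Λ, ∃ ε > 0, ∀ T : PatternSpace Λ,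
    Metric.ball 0 ε⁻¹ ∩ T.1 = Metric.ball 0 ε⁻¹ ∩ S.1 → f T = f S

/-- `f` is the function on the pattern space defined by the smooth `Λ`-equivariant function `g`:
it is continuous, transversally locally constant, smooth along the orbits, and
`f (φ_t(Λ)) = g t`. It is unique as the orbit of `Λ` is dense. -/
structure IsExtension (g : Euc d → ℂ) (f : PatternSpace Λ → ℂ) : Prop where
  continuous : Continuous f
  locallyConstant : TransversallyLocallyConstant f
  smooth : ∀ S : PatternSpace Λ, ContDiff ℝ ∞ (fun t => f (shift t S))
  apply_orbit : ∀ t, f (shift t (base Λ)) = g t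

end PatternSpace

/-! ### `Λ`-equivariant forms and cohomology -/

/-- `f` is (strongly) `Λ`-equivariant: for some `r > 0` the value `f x` only depends on the
pattern of radius `r` of `Λ` around `x`. -/
def IsEquivariant {V : Type*} (Λ : Set (Euc d)) (f : Euc d → V) : Prop :=
  ∃ r : ℝ, 0 < r ∧ ∀ x y, Metric.ball 0 r ∩ translate Λ x = Metric.ball 0 r ∩ translate Λ y →
    f x = f y

lemma IsEquivariant.combine {V W X : Type*} {Λ : Set (Euc d)} {f : Euc d → V} {g : Euc d → W}
    (hf : IsEquivariant Λ f) (hg : IsEquivariant Λ g) (op : V → W → X) :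
    IsEquivariant Λ (fun x => op (f x) (g x)) := by
  obtain ⟨r, hr, H⟩ := hf
  obtain ⟨s, hs, K⟩ := hg
  refine ⟨max r s, lt_max_of_lt_left hr, fun x y h => ?_⟩
  have key : ∀ q ≤ max r s, Metric.ball 0 q ∩ translate Λ x = Metric.ball 0 q ∩ translate Λ y := by
    intro q hq
    rw [← inter_eq_self_of_subset_left (Metric.ball_subset_ball (x := (0 : Euc d)) hq),
      inter_assoc, h, ← inter_assoc]
  simp only [H x y (key r (le_max_left _ _)), K x y (key s (le_max_right _ _))]

/-- The space `Δ_Λ^k` of smooth `Λ`-equivariant complex-valued `k`-forms on `ℝ^d`. -/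
def Forms (Λ : Set (Euc d)) (k : ℕ) : Submodule ℂ (Euc d → Euc d [⋀^Fin k]→L[ℝ] ℂ) where
  carrier := {α | ContDiff ℝ ∞ α ∧ IsEquivariant Λ α}
  add_mem' := fun ha hb => ⟨ha.1.add hb.1, ha.2.combine hb.2 (· + ·)⟩
  zero_mem' := ⟨contDiff_const, 1, one_pos, fun _ _ _ => rfl⟩
  smul_mem' := fun c _ ha => ⟨ha.1.const_smul c, ha.2.combine ha.2 (fun v _ => c • v)⟩

noncomputable instance (Λ : Set (Euc d)) (k : ℕ) : AddCommGroup (Forms Λ k) :=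
  Submodule.addCommGroup _

lemma extDeriv_mem {Λ : Set (Euc d)} {k : ℕ} (α : Forms Λ k) : extDeriv α.1 ∈ Forms Λ (k + 1) := by
  obtain ⟨α, hs, r, hr, H⟩ := α
  refine ⟨?_, r + 1, by positivity, fun x y h => ?_⟩
  · exact (ContinuousAlternatingMap.alternatizeUncurryFinCLM ℝ (Euc d) ℂ).contDiff.comp
      (hs.fderiv_right (m := ∞) (by simp))
  · have key : (fun s => α (x + s)) =ᶠ[𝓝 0] (fun s => α (y + s)) := by
      filter_upwards [Metric.ball_mem_nhds (0 : Euc d) one_pos] with s hs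
      apply H
      ext z
      simp only [mem_inter_iff, and_congr_right_iff]
      intro hz
      have hz' : z + s ∈ Metric.ball (0 : Euc d) (r + 1) := by
        rw [mem_ball_zero_iff] at hz hs ⊢
        linarith [norm_add_le z s]
      have := Set.ext_iff.1 h (z + s)
      simp only [mem_inter_iff, hz', true_and, translate, mem_ofPred_eq] at this ⊢
      rw [show z + (x + s) = z + s + x by abel, show z + (y + s) = z + s + y by abel]
      exact this
    have e := key.fderiv_eq (𝕜 := ℝ)
    rw [fderiv_comp_add_left, fderiv_comp_add_left, add_zero, add_zero] at e
    simp only [extDeriv, e]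

/-- The exterior derivative `d : Δ_Λ^k → Δ_Λ^{k+1}`. -/
noncomputable def exteriorD (Λ : Set (Euc d)) (k : ℕ) : Forms Λ k →ₗ[ℂ] Forms Λ (k + 1) where
  toFun α := ⟨extDeriv α.1, extDeriv_mem α⟩
  map_add' α η := by
    apply Subtype.ext
    funext x
    exact extDeriv_add (α.2.1.differentiable (by simp) x) (η.2.1.differentiable (by simp) x)
  map_smul' c α := by
    apply Subtype.ext
    funext x
    have hd := α.2.1.differentiable (by simp) x
    change extDeriv (c • α.1) x = c • extDeriv α.1 x
    simp only [extDeriv]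
    rw [fderiv_const_smul hd c, ContinuousAlternatingMap.alternatizeUncurryFin_smul]

/-- The closed `Λ`-equivariant `k`-forms. -/
noncomputable def cocycles (Λ : Set (Euc d)) (k : ℕ) : Submodule ℂ (Forms Λ k) :=
  LinearMap.ker (exteriorD Λ k)

/-- The exact `Λ`-equivariant `k`-forms `d(Δ_Λ^{k-1})`, where `Δ_Λ^{-1} = 0`. -/
noncomputable def coboundaries (Λ : Set (Euc d)) : (k : ℕ) → Submodule ℂ (Forms Λ k)
  | 0 => ⊥
  | k + 1 => LinearMap.range (exteriorD Λ k)

/-- The `Λ`-equivariant cohomology `H^k(Ω_Λ; ℂ)`: closed modulo exact `Λ`-equivariant forms. -/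
abbrev Cohomology (Λ : Set (Euc d)) (k : ℕ) : Type :=
  cocycles Λ k ⧸ (coboundaries Λ k).submoduleOf (cocycles Λ k)

/-- The cohomology class of a closed `Λ`-equivariant form. -/
noncomputable def cohomologyClass {Λ : Set (Euc d)} {k : ℕ} (η : cocycles Λ k) : Cohomology Λ k :=
  Submodule.Quotient.mk η

/-- The Hodge star of a `d`-form, i.e. the function `g` such that the form is
`g dx_1 ∧ ⋯ ∧ dx_d`. -/
noncomputable def hodgeStar {Λ : Set (Euc d)} (η : Forms Λ d) (t : Euc d) : ℂ :=
  η.1 t (fun i => EuclideanSpace.single i (1 : ℝ))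

/-! ### Currents and the asymptotic cycle -/

/-- A `Λ`-equivariant `k`-current: a linear functional on `Δ_Λ^k`. -/
abbrev Current (Λ : Set (Euc d)) (k : ℕ) : Type := Forms Λ k →ₗ[ℂ] ℂ

/-- A current is closed if it vanishes on exact forms. -/
def Current.IsClosed {Λ : Set (Euc d)} {k : ℕ} (C : Current Λ k) : Prop :=
  ∀ η ∈ coboundaries Λ k, C η = 0

/-- The homology class of a closed current, as a functional on cohomology: `[C]([η]) = C(η)`. -/
noncomputable def Current.homologyClass {Λ : Set (Euc d)} {k : ℕ} (C : Current Λ k)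
    (hC : C.IsClosed) : Cohomology Λ k →ₗ[ℂ] ℂ :=
  Submodule.liftQ _ (C ∘ₗ (cocycles Λ k).subtype) (fun η hη => hC η.1 hη)

/-- `C` is an asymptotic cycle of `Λ`: `C(η)` is the integral, against a translation-invariant
Borel probability measure on `Ω_Λ`, of the function on `Ω_Λ` defined by `⋆η`. -/
def IsAsymptoticCycle (Λ : Set (Euc d)) (C : Current Λ d) : Prop :=
  ∃ μ : Measure (PatternSpace Λ), PatternSpace.IsInvariantProbability μ ∧
    ∀ η : Forms Λ d, ∃ f : PatternSpace Λ → ℂ,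
      PatternSpace.IsExtension (hodgeStar η) f ∧ C η = ∫ S, f S ∂μ

/-! ### Autocorrelation and diffraction -/

/-- The Dirac comb `∑_{x ∈ Λ} δ_x`. -/
noncomputable def diracComb (Λ : Set (Euc d)) : Measure (Euc d) :=
  Measure.sum (fun x : Λ => Measure.dirac (x : Euc d))

/-- `γ` is the autocorrelation of `Λ` relative to `F`: a locally finite measure that is the vague
limit of `Vol(F n)⁻¹ (υ|_{F n} ∗ υ~|_{F n})`, where `υ` is the Dirac comb of `Λ`, and `~` is the
reflection at the origin. -/
def IsAutocorrelation (Λ : Set (Euc d)) (F : ℕ → Set (Euc d)) (γ : Measure (Euc d)) : Prop :=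
  IsFiniteMeasureOnCompacts γ ∧
    ∀ φ : Euc d → ℝ, Continuous φ → HasCompactSupport φ →
      Tendsto (fun n => (volume.real (F n))⁻¹ *
          ∫ z, φ z ∂(((diracComb Λ).restrict (F n)) ∗
            (((diracComb Λ).restrict (F n)).map (fun x => -x))))
        atTop (𝓝 (∫ z, φ z ∂γ))

/-- `σ` is the Fourier transform of the measure `γ`, in the sense of tempered distributions. If `γ`
is the autocorrelation of `Λ`, then the positive measure `σ` is the diffraction measure of `Λ`. -/
def IsFourierTransform (γ σ : Measure (Euc d)) : Prop :=
  ∃ (_ : γ.HasTemperateGrowth) (_ : σ.HasTemperateGrowth),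
    𝓕 (γ.toTemperedDistribution : 𝓢'(Euc d, ℂ)) = σ.toTemperedDistribution

end Delone
open Delone

namespace Delone

variable {d : ℕ}

/-! ### Agreement of patterns on balls -/

/-! Everything is reduced to densities. A function `m` of bounded measurable sets has density `c`
(`HasDensity`) if for each `ε` the error of `c * Vol A` is at most `ε * Vol A` plus a constant times
the volume of a neighbourhood of the boundary of `A`. Such a density is the limit of the averages
along every van Hove sequence, uniformly over translates; it is not affected by boundary terms and
it survives sums and approximation.

The hypothesis concerns a single sequence, and `hasMean_of_tendstoUniformly` removes this
dependence: by Fubini, averaging a bounded function over `A` is, up to a boundary term, averaging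
over `A` its averages on translates of one fixed `F n`. Cluster frequencies thus become densities.
There are finitely many patches of a given radius, and subtracting the strictly larger ones turns
"contains this patch" into "has exactly this patch". Hence every weight that depends on a patch has
a density (`IsDelone.exists_hasDensity_comb`), and every function that is determined approximately
by large patches has a mean (`IsDelone.exists_hasMean`).

The pattern space is compact, so continuous functions on it are uniformly continuous and restrict on
the orbit of `Λ` to functions of that kind. The mean is a positive, translation invariant
functional, and the Riesz representation theorem yields an invariant measure. Conversely every
invariant probability measure integrates a continuous function to its mean
(`PatternSpace.integral_eq_mean`), so there is only one. The asymptotic cycle is therefore the mean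
of the Hodge star. It vanishes on exact forms because a derivative is a uniform limit of difference
quotients, whose mean is zero (`hasMean_fderiv`), and it is nontrivial because the volume form has
mean one.

Let `a z` be the density of the points `y` such that `y` and `y + z` both belong to `Λ`. The
autocorrelation is the comb with weights `a z` on `Λ - Λ`, since sums over pairs of points in a
window can be sorted by their difference. Placing a bump of integral one at each such `y` gives a
function of mean `a z`, which is the duality. The class does not depend on the bump, because two
bumps of integral one differ by the divergence of a compactly supported field (`exists_div_eq_sub`),
an explicit form of the Poincaré lemma.

For a finite window the Fourier transform of the normalised autocorrelation is the squared modulus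
of an exponential sum divided by the volume, a positive measure. These intensities are uniformly
translation bounded, so they have a vague limit along an ultrafilter, and uniform tail bounds let
the finite identity pass to the limit for Schwartz functions (`IsDelone.exists_isFourierTransform`).
-/

/-- `S` and `T` coincide on the open ball of radius `r` around the origin. -/
def Agree (r : ℝ) (S T : Set (Euc d)) : Prop := ∀ z : Euc d, ‖z‖ < r → (z ∈ S ↔ z ∈ T)

lemma agree_iff {r : ℝ} {S T : Set (Euc d)} :
    Agree r S T ↔ Metric.ball 0 r ∩ S = Metric.ball 0 r ∩ T := by
  simp only [Agree, Set.ext_iff, mem_inter_iff, mem_ball_zero_iff, and_congr_right_iff]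

lemma Agree.refl (r : ℝ) (S : Set (Euc d)) : Agree r S S := fun _ _ => Iff.rfl

lemma Agree.symm {r : ℝ} {S T : Set (Euc d)} (h : Agree r S T) : Agree r T S :=
  fun z hz => (h z hz).symm

lemma Agree.trans {r : ℝ} {S T U : Set (Euc d)} (h : Agree r S T) (h' : Agree r T U) :
    Agree r S U := fun z hz => (h z hz).trans (h' z hz)

lemma Agree.mono {r s : ℝ} (hrs : s ≤ r) {S T : Set (Euc d)} (h : Agree r S T) : Agree s S T :=
  fun z hz => h z (hz.trans_le hrs)

lemma mem_translate {S : Set (Euc d)} {t x : Euc d} : x ∈ translate S t ↔ x + t ∈ S := Iff.rfl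

lemma Agree.translate {r s : ℝ} {S T : Set (Euc d)} (h : Agree r S T) {t : Euc d}
    (ht : s + ‖t‖ ≤ r) : Agree s (translate S t) (translate T t) := fun z hz =>
  h (z + t) (by linarith [norm_add_le z t])

lemma translate_translate (S : Set (Euc d)) (s t : Euc d) :
    translate (translate S s) t = translate S (s + t) := by
  ext x
  simp only [mem_translate]
  rw [show x + t + s = x + (s + t) by abel]

@[simp] lemma translate_zero (S : Set (Euc d)) : translate S 0 = S := by
  ext x; simp [mem_translate]

/-! ### The pattern distance as a pseudometric -/

lemma locallyClose_iff {ε : ℝ} {S T : Set (Euc d)} :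
    LocallyClose ε S T ↔ ∃ x y : Euc d, ‖x‖ < ε ∧ ‖y‖ < ε ∧
      Agree ε⁻¹ (translate S x) (translate T y) := by
  simp only [LocallyClose, mem_ball_zero_iff, ← agree_iff]
  constructor
  · rintro ⟨x, hx, y, hy, h⟩; exact ⟨x, y, hx, hy, h⟩
  · rintro ⟨x, y, hx, hy, h⟩; exact ⟨x, hx, y, hy, h⟩

lemma LocallyClose.symm {ε : ℝ} {S T : Set (Euc d)} (h : LocallyClose ε S T) :
    LocallyClose ε T S := by
  rw [locallyClose_iff] at *
  obtain ⟨x, y, hx, hy, h⟩ := h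
  exact ⟨y, x, hy, hx, h.symm⟩

/-- Both agreements are translated further, by `z` and by `y`, so that they meet in the same
translate of `T`. This costs radius, and what has to be paid is `(a + b)⁻¹ + b ≤ a⁻¹`, which amounts
to `a * (a + b) ≤ 1`. The cap `1 / √2` guarantees `(a + b)² ≤ 1 / 2`, which is more than enough. -/
lemma LocallyClose.trans {a b : ℝ} (ha : 0 < a) (hb : 0 < b) (hab : a + b ≤ 1 / √2)
    {S T U : Set (Euc d)} (h : LocallyClose a S T) (h' : LocallyClose b T U) :
    LocallyClose (a + b) S U := by
  rw [locallyClose_iff] at *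
  obtain ⟨x, y, hx, hy, h⟩ := h
  obtain ⟨z, w, hz, hw, h'⟩ := h'
  have hab1 : (a + b) * (a + b) ≤ 1 / 2 := by
    have h2 : (1 / √2) * (1 / √2) = (1 / 2 : ℝ) := by
      rw [div_mul_div_comm, Real.mul_self_sqrt (by norm_num)]; norm_num
    rw [← h2]
    exact mul_le_mul hab hab (by positivity) (by positivity)
  have key : ∀ a b : ℝ, 0 < a → 0 < b → (a + b) * (a + b) ≤ 1 / 2 → (a + b)⁻¹ + b ≤ a⁻¹ := by
    intro a b ha hb h
    have hab : 0 < a + b := by positivity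
    have : a⁻¹ - (a + b)⁻¹ - b = b * (1 - a * (a + b)) / (a * (a + b)) := by
      field_simp; ring
    have h3 : 0 ≤ b * (1 - a * (a + b)) / (a * (a + b)) := by
      apply div_nonneg (mul_nonneg hb.le _) (by positivity)
      nlinarith
    linarith
  have k1 := key a b ha hb hab1
  have k2 := key b a hb ha (by rwa [add_comm b a])
  rw [add_comm b a] at k2
  refine ⟨x + z, w + y, by linarith [norm_add_le x z], by linarith [norm_add_le w y], ?_⟩
  rw [← translate_translate, ← translate_translate]
  refine (h.translate (t := z) (by linarith)).trans ?_
  rw [translate_translate, add_comm y z, ← translate_translate]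
  exact h'.translate (by linarith)

lemma patternDist_nonneg (S T : Set (Euc d)) : 0 ≤ patternDist S T := by
  apply Real.sInf_nonneg
  rintro a (rfl | ⟨ha, -⟩)
  · positivity
  · exact ha.le

lemma patternDist_le (S T : Set (Euc d)) : patternDist S T ≤ 1 / √2 := by
  refine csInf_le ⟨0, ?_⟩ (Or.inl rfl)
  rintro a (rfl | ⟨ha, -⟩)
  · positivity
  · exact ha.le

lemma patternDist_comm (S T : Set (Euc d)) : patternDist S T = patternDist T S := by
  simp only [patternDist]
  congr 2
  ext ε
  exact ⟨fun h => ⟨h.1, h.2.symm⟩, fun h => ⟨h.1, h.2.symm⟩⟩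

lemma patternDist_le_of_locallyClose {ε : ℝ} (hε : 0 < ε) {S T : Set (Euc d)}
    (h : LocallyClose ε S T) : patternDist S T ≤ ε := by
  refine csInf_le ⟨0, ?_⟩ (Or.inr ⟨hε, h⟩)
  rintro a (rfl | ⟨ha, -⟩)
  · positivity
  · exact ha.le

lemma patternDist_self (S : Set (Euc d)) : patternDist S S = 0 := by
  refine le_antisymm (le_of_forall_pos_le_add fun ε hε => ?_) (patternDist_nonneg S S)
  rw [zero_add]
  exact patternDist_le_of_locallyClose hε
    (locallyClose_iff.2 ⟨0, 0, by simpa, by simpa, Agree.refl _ _⟩)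

lemma patternDist_triangle (S T U : Set (Euc d)) :
    patternDist S U ≤ patternDist S T + patternDist T U := by
  by_contra! hlt
  set p := patternDist S T
  set q := patternDist T U
  -- With this choice `p + q + 2 * η` is the distance from `S` to `U`, so the two radii found below
  -- add up to less than `1 / √2`.
  set η := (patternDist S U - (p + q)) / 2 with hη
  have hη0 : 0 < η := by linarith
  have hle := patternDist_le S U
  have hp := patternDist_nonneg S T
  have hq := patternDist_nonneg T U
  obtain ⟨a, ha, ha', hA⟩ := (patternDist_lt (S := S) (T := T) (δ := p + η)
    (by linarith)).1 (by linarith)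
  obtain ⟨b, hb, hb', hB⟩ := (patternDist_lt (S := T) (T := U) (δ := q + η)
    (by linarith)).1 (by linarith)
  have := patternDist_le_of_locallyClose (by linarith) (hA.trans ha hb (by linarith) hB)
  linarith

/-- Patterns that agree up to a small translation on a large ball are close. -/
lemma patternDist_le_of_agree {ε : ℝ} (hε : 0 < ε) {S T : Set (Euc d)} {u : Euc d}
    (hu : ‖u‖ < ε) (h : Agree ε⁻¹ S (translate T u)) : patternDist S T ≤ ε :=
  patternDist_le_of_locallyClose hε
    (locallyClose_iff.2 ⟨0, u, by simpa, hu, by simpa using h⟩)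

/-- Undoing the shift `x` of the first pattern leaves the single shift `y - x` of the second, at the
price of less than `ε` in the radius. -/
lemma exists_agree_of_patternDist_lt {ε : ℝ} (hε : ε ≤ 1 / √2) {S T : Set (Euc d)}
    (h : patternDist S T < ε) : ∃ u : Euc d, ‖u‖ < 2 * ε ∧ Agree (ε⁻¹ - ε) S (translate T u) := by
  obtain ⟨η, hη, hlt, hc⟩ := (patternDist_lt hε).1 h
  obtain ⟨x, y, hx, hy, H⟩ := locallyClose_iff.1 hc
  refine ⟨y - x, by linarith [norm_sub_le y x], ?_⟩
  have hinv : ε⁻¹ ≤ η⁻¹ := inv_anti₀ hη hlt.le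
  have := H.translate (t := -x) (s := ε⁻¹ - ε) (by rw [norm_neg]; linarith)
  rwa [translate_translate, translate_translate, add_neg_cancel, translate_zero,
    ← sub_eq_add_neg] at this

/-- A convenient form: radius and shift can be prescribed independently. -/
lemma exists_pos_forall_agree (r δ : ℝ) (hδ : 0 < δ) :
    ∃ ε > 0, ∀ S T : Set (Euc d), patternDist S T < ε →
      ∃ u : Euc d, ‖u‖ < δ ∧ Agree r S (translate T u) := by
  set ε : ℝ := min (min (δ / 2) (1 / √2)) (|r| + 1)⁻¹ with hε
  have h1 : ε ≤ δ / 2 := (min_le_left _ _).trans (min_le_left _ _)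
  have h2 : ε ≤ 1 / √2 := (min_le_left _ _).trans (min_le_right _ _)
  have h3 : ε ≤ (|r| + 1)⁻¹ := min_le_right _ _
  have h0 : 0 < ε := by positivity
  have h4 : |r| + 1 ≤ ε⁻¹ := by rw [le_inv_comm₀ (by positivity) h0]; exact h3
  have h5 : ε ≤ 1 := h3.trans (inv_le_one_of_one_le₀ (by linarith [abs_nonneg r]))
  refine ⟨ε, h0, fun S T h => ?_⟩
  obtain ⟨u, hu, H⟩ := exists_agree_of_patternDist_lt h2 h
  exact ⟨u, by linarith, H.mono (by linarith [le_abs_self r])⟩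

/-! ### Topology and compactness of the pattern space -/

namespace PatternSpace

variable {Λ : Set (Euc d)}

/-- Every point of the pattern space looks locally like a translate of `Λ`. -/
lemma exists_agree (S : PatternSpace Λ) (r : ℝ) : ∃ t, Agree r S.1 (translate Λ t) := by
  obtain ⟨ε, hε, H⟩ := exists_pos_forall_agree (d := d) r 1 one_pos
  obtain ⟨t, ht⟩ := S.2 ε hε
  obtain ⟨u, -, h⟩ := H _ _ ht
  exact ⟨t + u, by rwa [translate_translate] at h⟩

lemma uniformlyDiscrete {r : ℝ} (hr : ∀ x ∈ Λ, ∀ y ∈ Λ, x ≠ y → r < dist x y)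
    (S : PatternSpace Λ) {x y : Euc d} (hx : x ∈ S.1) (hy : y ∈ S.1) (hxy : x ≠ y) :
    r < dist x y := by
  obtain ⟨t, ht⟩ := S.exists_agree (max ‖x‖ ‖y‖ + 1)
  have := hr _ ((ht x (by linarith [le_max_left ‖x‖ ‖y‖])).1 hx) _
    ((ht y (by linarith [le_max_right ‖x‖ ‖y‖])).1 hy) (by simpa using hxy)
  simpa using this

/-- At distance zero, `T` has points `z + u` with `u` arbitrarily small for each `z ∈ S`. Two
different small values of `u` would give two points of `T` that violate uniform discreteness, so a
nonzero `u` cannot occur. -/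
lemma eq_of_patternDist_eq_zero (hΛ : IsDelone Λ) {S T : PatternSpace Λ}
    (h : patternDist S.1 T.1 = 0) : S = T := by
  obtain ⟨r, hr, hd⟩ := hΛ.uniformlyDiscrete
  have key : ∀ S T : PatternSpace Λ, patternDist S.1 T.1 = 0 → ∀ z ∈ S.1, z ∈ T.1 := by
    intro S T h z hz
    have hex : ∀ δ > 0, ∃ u : Euc d, ‖u‖ < δ ∧ z + u ∈ T.1 := by
      intro δ hδ
      obtain ⟨ε, hε, H⟩ := exists_pos_forall_agree (d := d) (‖z‖ + 1) δ hδ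
      obtain ⟨u, hu, ha⟩ := H S.1 T.1 (by rwa [h])
      exact ⟨u, hu, (ha z (by linarith)).1 hz⟩
    obtain ⟨u, hu, hu'⟩ := hex (r / 2) (by positivity)
    by_cases h0 : u = 0
    · simpa [h0] using hu'
    exfalso
    have hupos : 0 < ‖u‖ := norm_pos_iff.2 h0
    obtain ⟨v, hv, hv'⟩ := hex (min ‖u‖ (r / 2)) (by positivity)
    have hvu : v ≠ u := fun e => by
      rw [e] at hv; exact absurd hv (not_lt.2 (min_le_left _ _))
    have := T.uniformlyDiscrete hd hv' hu' (by simpa using hvu)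
    rw [dist_add_left, dist_eq_norm] at this
    linarith [norm_sub_le v u, min_le_right ‖u‖ (r / 2)]
  apply Subtype.ext
  ext z
  exact ⟨key S T h z, key T S (by rwa [patternDist_comm]) z⟩

/-- The pattern metric. -/
noncomputable abbrev metric (hΛ : IsDelone Λ) : MetricSpace (PatternSpace Λ) :=
  MetricSpace.ofDistTopology (fun S T => patternDist S.1 T.1) (fun S => patternDist_self S.1)
    (fun S T => patternDist_comm S.1 T.1) (fun S T U => patternDist_triangle S.1 T.1 U.1)
    (fun _ => Iff.rfl) (fun _ _ h => eq_of_patternDist_eq_zero hΛ h)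

/-- The topology comes from a pseudometric for every `Λ`; separation, the only point that needs
`IsDelone`, plays no role for neighbourhoods. -/
lemma mem_nhds_iff' {S : PatternSpace Λ} {U : Set (PatternSpace Λ)} :
    U ∈ 𝓝 S ↔ ∃ δ > 0, ∀ T : PatternSpace Λ, patternDist S.1 T.1 < δ → T ∈ U := by
  let _ : PseudoMetricSpace (PatternSpace Λ) :=
    PseudoMetricSpace.ofDistTopology (fun S T => patternDist S.1 T.1)
    (fun S => patternDist_self S.1)
    (fun S T => patternDist_comm S.1 T.1) (fun S T U => patternDist_triangle S.1 T.1 U.1)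
    (fun _ => Iff.rfl)
  rw [Metric.mem_nhds_iff]
  refine exists_congr fun δ => and_congr_right fun _ => ?_
  refine forall_congr' fun T => ?_
  rw [Metric.mem_ball, dist_comm]
  exact Iff.rfl

lemma shift_shift (s t : Euc d) (S : PatternSpace Λ) : shift t (shift s S) = shift (s + t) S :=
  Subtype.ext (translate_translate S.1 s t)

/-- The translation action is jointly continuous. -/
lemma continuous_shift_uncurry :
    Continuous (fun p : Euc d × PatternSpace Λ => shift p.1 p.2) := by
  rw [continuous_iff_continuousAt]
  rintro ⟨t, S⟩ U hU
  obtain ⟨δ, hδ, H⟩ := mem_nhds_iff'.1 hU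
  -- The radius allows for a translation by `t`, and the shifts `u` and `t - s`, each shorter than
  -- `δ / 4`, stay together below `δ / 2`.
  obtain ⟨ε, hε, K⟩ := exists_pos_forall_agree (d := d) ((δ / 2)⁻¹ + ‖t‖) (δ / 4) (by positivity)
  rw [mem_map, nhds_prod_eq]
  have h1 : Metric.ball t (δ / 4) ∈ 𝓝 t := Metric.ball_mem_nhds t (by positivity)
  have h2 : {T : PatternSpace Λ | patternDist S.1 T.1 < ε} ∈ 𝓝 S :=
    mem_nhds_iff'.2 ⟨ε, hε, fun T h => h⟩
  filter_upwards [prod_mem_prod h1 h2]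
  rintro ⟨s, T⟩ ⟨hs, hT⟩
  refine H _ (lt_of_le_of_lt ?_ (half_lt_self hδ))
  obtain ⟨u, hu, ha⟩ := K S.1 T.1 hT
  rw [mem_ball_iff_norm] at hs
  refine patternDist_le_of_agree (u := u + (t - s)) (by positivity) ?_ ?_
  · rw [norm_sub_rev] at hs
    linarith [norm_add_le u (t - s)]
  · have := ha.translate (t := t) le_rfl
    change Agree _ (translate S.1 t) (translate (translate T.1 s) (u + (t - s)))
    rw [translate_translate] at this ⊢
    rwa [show s + (u + (t - s)) = u + t by abel]

lemma continuous_shift (t : Euc d) : Continuous (shift t : PatternSpace Λ → PatternSpace Λ) :=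
  continuous_shift_uncurry.comp (Continuous.prodMk_right t)

lemma continuous_orbit (S : PatternSpace Λ) : Continuous (fun t => shift t S) :=
  continuous_shift_uncurry.comp (Continuous.prodMk_left S)

/-- The orbit of `Λ` is dense in its pattern space. -/
lemma denseRange_orbit : DenseRange (fun t => shift t (base Λ)) := by
  intro S
  rw [mem_closure_iff_nhds]
  intro U hU
  obtain ⟨δ, hδ, H⟩ := mem_nhds_iff'.1 hU
  obtain ⟨t, ht⟩ := S.2 δ hδ
  exact ⟨shift t (base Λ), H _ ht, t, rfl⟩

/-- Patterns in `Ω_Λ` are relatively dense with the same radius as `Λ`. -/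
lemma relativelyDense {R : ℝ} (hR : ∀ t : Euc d, (Metric.ball 0 R ∩ translate Λ t).Nonempty)
    (S : PatternSpace Λ) : (Metric.ball 0 R ∩ S.1).Nonempty := by
  obtain ⟨t, ht⟩ := S.exists_agree R
  rw [agree_iff.1 ht]
  exact hR t

/-- Finite local complexity passes from `Λ` to the points of the pattern space. -/
lemma finite_patches (hFLC : FiniteLocalComplexity Λ) (r : ℝ) :
    {P : Set (Euc d) | ∃ S : PatternSpace Λ, ∃ y ∈ S.1,
      P = Metric.ball 0 r ∩ translate S.1 y}.Finite := by
  obtain ⟨Y, hY, -, H⟩ := hFLC (max r 1) (by positivity)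
  refine (hY.image fun y => Metric.ball 0 r ∩ translate Λ y).subset ?_
  rintro P ⟨S, y, hy, rfl⟩
  obtain ⟨t, ht⟩ := S.exists_agree (max r 1 + ‖y‖)
  have hyt : y + t ∈ Λ := (ht y (by linarith [le_max_right r 1])).1 hy
  obtain ⟨z, hz, e⟩ := H _ hyt
  refine ⟨z, hz, ?_⟩
  rw [← agree_iff]
  intro w hw
  have h1 : w + y ∈ S.1 ↔ w + y + t ∈ Λ :=
    ht (w + y) (by linarith [norm_add_le w y, le_max_left r 1])
  rw [mem_translate, mem_translate, h1]
  have h2 := Set.ext_iff.1 e (w + y + t)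
  have hb1 : w + y + t ∈ Metric.ball (y + t) (max r 1) := by
    rw [mem_ball_iff_norm, show w + y + t - (y + t) = w by abel]
    exact hw.trans_le (le_max_left _ _)
  have hb2 : w + z ∈ Metric.ball z (max r 1) := by
    rw [mem_ball_iff_norm, add_sub_cancel_right]
    exact hw.trans_le (le_max_left _ _)
  constructor
  · intro h
    exact (h2.2 ⟨w + z, ⟨hb2, h⟩, show w + z + (y + t - z) = w + y + t by abel⟩).2
  · intro h
    obtain ⟨v, hv, hv'⟩ := h2.1 ⟨hb1, h⟩
    have : v = w + z := by
      have : v + (y + t - z) = w + z + (y + t - z) := hv'.trans (by abel)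
      exact add_right_cancel this
    exact this ▸ hv.2

/-- Given an ultrafilter, a point `p S` of each pattern `S` is chosen near the origin; these points
converge to some `q` because they stay in a compact ball. Seen from `p S`, only finitely many
patches of each radius occur, so the patch is eventually constant along the ultrafilter. The
constant patches fit together to `T'`, and `T'` moved by `q` is the limit. -/
lemma compactSpace (hΛ : IsDelone Λ) (hFLC : FiniteLocalComplexity Λ) :
    CompactSpace (PatternSpace Λ) := by
  obtain ⟨R, hR, hRd⟩ := hΛ.relativelyDense
  refine ⟨isCompact_iff_ultrafilter_le_nhds.2 fun 𝒰 _ => ?_⟩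
  choose p hp using fun S : PatternSpace Λ => S.relativelyDense hRd
  obtain ⟨q, -, hq⟩ := (isCompact_closedBall (0 : Euc d) R).ultrafilter_le_nhds (𝒰.map p)
    (le_principal_iff.2 (Filter.mem_map.2 (Filter.univ_mem' fun S => by
      simpa using (mem_ball_zero_iff.1 (hp S).1).le)))
  have hq' : Tendsto p 𝒰 (𝓝 q) := hq
  set T' : Set (Euc d) := {z | ∀ᶠ S in (𝒰 : Filter (PatternSpace Λ)), z ∈ translate S.1 (p S)}
    with hT'
  have hev : ∀ r : ℝ, ∀ᶠ S in (𝒰 : Filter (PatternSpace Λ)), Agree r (translate S.1 (p S)) T' := by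
    intro r
    have hfin := finite_patches (Λ := Λ) hFLC r
    have hmem : (⋃ P ∈ {P : Set (Euc d) | ∃ S : PatternSpace Λ, ∃ y ∈ S.1,
        P = Metric.ball 0 r ∩ translate S.1 y},
        {S : PatternSpace Λ | Metric.ball 0 r ∩ translate S.1 (p S) = P}) ∈ 𝒰 := by
      refine Filter.univ_mem' fun S => mem_iUnion₂.2 ⟨_, ⟨S, p S, (hp S).2, rfl⟩, rfl⟩
    obtain ⟨P, -, hP'⟩ := (Ultrafilter.finite_biUnion_mem_iff hfin).1 hmem
    have hP : ∀ᶠ S in (𝒰 : Filter (PatternSpace Λ)), Metric.ball 0 r ∩ translate S.1 (p S) = P :=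
      hP'
    filter_upwards [hP] with S hS z hz
    refine ⟨fun h => ?_, fun h => ?_⟩
    · filter_upwards [hP] with S' hS'
      have : z ∈ Metric.ball 0 r ∩ translate S.1 (p S) := ⟨by simpa using hz, h⟩
      rw [hS, ← hS'] at this
      exact this.2
    · obtain ⟨S', hS', hz'⟩ := (hP.and h).exists
      have : z ∈ Metric.ball 0 r ∩ translate S'.1 (p S') := ⟨by simpa using hz, hz'⟩
      rw [hS', ← hS] at this
      exact this.2
  have hclose : ∀ δ > 0, ∀ᶠ S in (𝒰 : Filter (PatternSpace Λ)),
      patternDist (translate T' (-q)) S.1 < δ := by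
    intro δ hδ
    filter_upwards [hev ((δ / 2)⁻¹ + ‖q‖), hq' (Metric.ball_mem_nhds q (half_pos hδ))] with S h1 h2
    refine lt_of_le_of_lt (patternDist_le_of_agree (u := p S - q) (half_pos hδ) ?_ ?_)
      (half_lt_self hδ)
    · rw [← dist_eq_norm]; exact h2
    · have := h1.symm.translate (t := -q) (s := (δ / 2)⁻¹) (by rw [norm_neg])
      rwa [translate_translate, ← sub_eq_add_neg] at this
  refine ⟨⟨translate T' (-q), fun δ hδ => ?_⟩, mem_univ _, ?_⟩
  · obtain ⟨S, hS⟩ := (hclose (δ / 2) (half_pos hδ)).exists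
    obtain ⟨t, ht⟩ := S.2 (δ / 2) (half_pos hδ)
    exact ⟨t, by linarith [patternDist_triangle (translate T' (-q)) S.1 (translate Λ t)]⟩
  · intro U hU
    obtain ⟨δ, hδ, H⟩ := mem_nhds_iff'.1 hU
    exact mem_of_superset (hclose δ hδ) fun S hS => H S hS

end PatternSpace

/-! ### Boundary estimates -/

/-- The volume of the closed `r`-neighbourhood of the boundary of `A`. -/
noncomputable def bvol (r : ℝ) (A : Set (Euc d)) : ℝ :=
  volume.real (Metric.cthickening r (frontier A))

lemma isBounded_frontier {A : Set (Euc d)} (hA : Bornology.IsBounded A) :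
    Bornology.IsBounded (frontier A) := hA.closure.subset frontier_subset_closure

lemma isBounded_boundary {A : Set (Euc d)} (hA : Bornology.IsBounded A) (r : ℝ) :
    Bornology.IsBounded (Metric.cthickening r (frontier A)) :=
  (isBounded_frontier hA).cthickening

lemma bvol_mono {r s : ℝ} (h : r ≤ s) {A : Set (Euc d)} (hA : Bornology.IsBounded A) :
    bvol r A ≤ bvol s A :=
  measureReal_mono (Metric.cthickening_mono h _) (isBounded_boundary hA s).measure_lt_top.ne

/-- A segment joining a point of `A` to a point outside of `A` meets the boundary of `A`. -/
lemma mem_boundary {A : Set (Euc d)} {x y : Euc d} (hxy : ¬(x ∈ A ↔ y ∈ A)) {r : ℝ}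
    (hr : dist x y ≤ r) : x ∈ Metric.cthickening r (frontier A) := by
  have hne : (segment ℝ x y ∩ frontier A).Nonempty := by
    by_contra hemp
    rw [Set.not_nonempty_iff_eq_empty] at hemp
    -- A segment that misses the frontier is covered by the disjoint open sets `interior A` and
    -- `interior Aᶜ`; being connected, it lies in one of them.
    have hsub : segment ℝ x y ⊆ interior A ∪ interior Aᶜ := by
      intro z hz
      by_contra hz'
      rw [mem_union, not_or, interior_compl, mem_compl_iff, not_not] at hz'
      exact (hemp ▸ (⟨hz, hz'.2, hz'.1⟩ : z ∈ segment ℝ x y ∩ frontier A) : z ∈ (∅ : Set (Euc d)))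
    have hdisj : Disjoint (interior A) (interior Aᶜ) :=
      Set.disjoint_left.2 fun z h1 h2 => interior_subset h2 (interior_subset h1)
    have hx := left_mem_segment ℝ x y
    have hy := right_mem_segment ℝ x y
    have hconn := (convex_segment (𝕜 := ℝ) x y).isPreconnected
    rcases hsub hx with h | h
    · have := hconn.subset_left_of_subset_union isOpen_interior isOpen_interior hdisj hsub
        ⟨x, hx, h⟩
      exact hxy ⟨fun _ => interior_subset (this hy), fun _ => interior_subset h⟩
    · have := hconn.subset_right_of_subset_union isOpen_interior isOpen_interior hdisj hsub
        ⟨x, hx, h⟩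
      exact hxy ⟨fun h' => absurd h' (interior_subset h),
        fun h' => absurd h' (interior_subset (this hy))⟩
  obtain ⟨z, hz, hz'⟩ := hne
  refine Metric.mem_cthickening_of_dist_le x z r _ hz' ?_
  have := dist_add_dist_of_mem_segment hz
  linarith [dist_nonneg (x := z) (y := y)]

lemma translate_eq_preimage (A : Set (Euc d)) (t : Euc d) :
    translate A t = (Homeomorph.addRight t) ⁻¹' A := rfl

lemma isBounded_translate {A : Set (Euc d)} (hA : Bornology.IsBounded A) (t : Euc d) :
    Bornology.IsBounded (translate A t) := by
  obtain ⟨r, hr⟩ := hA.exists_norm_le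
  refine isBounded_iff_forall_norm_le.2 ⟨r + ‖t‖, fun x hx => ?_⟩
  have := hr _ hx
  have h2 := norm_sub_le (x + t) t
  rw [add_sub_cancel_right] at h2
  linarith

lemma measurableSet_translate {A : Set (Euc d)} (hA : MeasurableSet A) (t : Euc d) :
    MeasurableSet (translate A t) := (measurable_id.add_const t) hA

lemma volume_real_translate (A : Set (Euc d)) (t : Euc d) :
    volume.real (translate A t) = volume.real A := by
  simp only [measureReal_def]
  congr 1
  exact measure_preimage_add_right volume t A

lemma bvol_translate (r : ℝ) (A : Set (Euc d)) (t : Euc d) :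
    bvol r (translate A t) = bvol r A := by
  have h1 : frontier (translate A t) = translate (frontier A) t := by
    rw [translate_eq_preimage, translate_eq_preimage, Homeomorph.preimage_frontier]
  have h2 : Metric.cthickening r (translate (frontier A) t) =
      translate (Metric.cthickening r (frontier A)) t := by
    ext x
    have h3 : (fun z => z + t) '' translate (frontier A) t = frontier A := by
      rw [translate_eq_preimage]
      exact Set.image_preimage_eq _ (Homeomorph.addRight t).surjective
    have := Metric.infEDist_image (t := translate (frontier A) t) (x := x)
      (isometry_add_right t)
    rw [h3] at this
    rw [mem_translate, Metric.mem_cthickening_iff, Metric.mem_cthickening_iff, this]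
  rw [bvol, h1, h2, volume_real_translate, bvol]

/-! ### Counting points of uniformly discrete sets -/

/-- Balls of radius `ρ ≤ r / 2` about the points of `Λ` are disjoint, and as `ρ ≤ 1` those centred
in `K` lie in the 1-neighbourhood of `K`. Comparing volumes bounds their number. -/
lemma IsDelone.exists_packing {Λ : Set (Euc d)} (hΛ : IsDelone Λ) :
    ∃ C : ℝ, 0 < C ∧ ∀ K : Set (Euc d), Bornology.IsBounded K → (Λ ∩ K).Finite ∧
      ((Λ ∩ K).ncard : ℝ) ≤ C * volume.real (Metric.cthickening 1 K) := by
  obtain ⟨r, hr, hd⟩ := hΛ.uniformlyDiscrete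
  set ρ : ℝ := min (r / 2) 1 with hρdef
  have hρ : 0 < ρ := by positivity
  set V := volume.real (Metric.ball (0 : Euc d) ρ)
  have hV : 0 < V :=
    ENNReal.toReal_pos (Metric.measure_ball_pos _ _ hρ).ne'
      Metric.isBounded_ball.measure_lt_top.ne
  have key : ∀ K : Set (Euc d), Bornology.IsBounded K → ∀ s : Finset (Euc d), ↑s ⊆ Λ ∩ K →
      (s.card : ℝ) ≤ V⁻¹ * volume.real (Metric.cthickening 1 K) := by
    intro K hK s hs
    have hdisj : Set.PairwiseDisjoint (↑s) (fun x : Euc d => Metric.ball x ρ) := by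
      intro x hx y hy hxy
      apply Metric.ball_disjoint_ball
      have := hd x (hs hx).1 y (hs hy).1 hxy
      linarith [min_le_left (r / 2) 1]
    have h1 : volume.real (⋃ x ∈ s, Metric.ball x ρ) = s.card * V := by
      rw [measureReal_biUnion_finset hdisj (fun _ _ => measurableSet_ball)
        (fun _ _ => Metric.isBounded_ball.measure_lt_top.ne)]
      simp [V, measureReal_def, Measure.addHaar_ball_center]
    have h2 : volume.real (⋃ x ∈ s, Metric.ball x ρ) ≤ volume.real (Metric.cthickening 1 K) := by
      refine measureReal_mono (iUnion₂_subset fun x hx z hz => ?_)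
        hK.cthickening.measure_lt_top.ne
      refine Metric.mem_cthickening_of_dist_le z x 1 K (hs hx).2 ?_
      exact (Metric.mem_ball.1 hz).le.trans (min_le_right _ _)
    rw [← div_eq_inv_mul, le_div_iff₀ hV]
    linarith
  refine ⟨V⁻¹, inv_pos.2 hV, fun K hK => ?_⟩
  have hfin : (Λ ∩ K).Finite := by
    by_contra hinf
    obtain ⟨n, hn⟩ := exists_nat_gt (V⁻¹ * volume.real (Metric.cthickening 1 K))
    obtain ⟨s, hs, hcard⟩ := Set.Infinite.exists_subset_card_eq hinf n
    have := key K hK s hs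
    rw [hcard] at this
    linarith
  refine ⟨hfin, ?_⟩
  rw [Set.ncard_eq_toFinset_card _ hfin]
  exact key K hK _ (by simp)

lemma IsDelone.finite_inter {Λ : Set (Euc d)} (hΛ : IsDelone Λ) {K : Set (Euc d)}
    (hK : Bornology.IsBounded K) : (Λ ∩ K).Finite :=
  (hΛ.exists_packing.choose_spec.2 K hK).1

/-- The number of points in a ball of given radius is bounded. -/
lemma IsDelone.exists_ncard_ball_le {Λ : Set (Euc d)} (hΛ : IsDelone Λ) (R : ℝ) :
    ∃ N : ℝ, 0 < N ∧ ∀ x : Euc d, ((Λ ∩ Metric.closedBall x R).ncard : ℝ) ≤ N := by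
  obtain ⟨C, hC, H⟩ := hΛ.exists_packing
  refine ⟨C * volume.real (Metric.closedBall (0 : Euc d) (1 + |R|)) + 1,
    by positivity, fun x => ?_⟩
  obtain ⟨hfin, h⟩ := H (Metric.closedBall x |R|) Metric.isBounded_closedBall
  rw [cthickening_closedBall zero_le_one (abs_nonneg R), measureReal_def,
    Measure.addHaar_closedBall_center, ← measureReal_def] at h
  have h2 : (Λ ∩ Metric.closedBall x R).ncard ≤ (Λ ∩ Metric.closedBall x |R|).ncard :=
    Set.ncard_le_ncard (inter_subset_inter_right _
      (Metric.closedBall_subset_closedBall (le_abs_self R))) hfin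
  have h3 : ((Λ ∩ Metric.closedBall x R).ncard : ℝ) ≤ (Λ ∩ Metric.closedBall x |R|).ncard := by
    exact_mod_cast h2
  linarith

/-- This is how errors carried by points near the boundary become terms of the form `C * bvol r A`.
-/
lemma IsDelone.exists_ncard_boundary_le {Λ : Set (Euc d)} (hΛ : IsDelone Λ) {r : ℝ}
    (hr : 0 ≤ r) : ∃ C : ℝ, 0 < C ∧ ∀ A : Set (Euc d), Bornology.IsBounded A →
      ((Λ ∩ Metric.cthickening r (frontier A)).ncard : ℝ) ≤ C * bvol (1 + r) A := by
  obtain ⟨C, hC, H⟩ := hΛ.exists_packing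
  refine ⟨C, hC, fun A hA => (H _ (isBounded_boundary hA r)).2.trans ?_⟩
  refine mul_le_mul_of_nonneg_left ?_ hC.le
  exact measureReal_mono (Metric.cthickening_cthickening_subset zero_le_one hr _)
    (isBounded_boundary hA _).measure_lt_top.ne

/-! ### Set functions with a density -/

/-- The set function `m` has density `c`: up to boundary terms, `m A` is `c * Vol A`. -/
def HasDensity (m : Set (Euc d) → ℂ) (c : ℂ) : Prop :=
  ∀ ε > 0, ∃ C r : ℝ, 0 ≤ C ∧ 0 < r ∧ ∀ A : Set (Euc d), Bornology.IsBounded A → MeasurableSet A →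
    ‖m A - c * volume.real A‖ ≤ ε * volume.real A + C * bvol r A

/-- Two set functions agree up to boundary terms. -/
def BoundaryClose (m m' : Set (Euc d) → ℂ) : Prop :=
  ∃ C r : ℝ, 0 ≤ C ∧ 0 < r ∧ ∀ A : Set (Euc d), Bornology.IsBounded A → MeasurableSet A →
    ‖m A - m' A‖ ≤ C * bvol r A

/-- The approximant `m'` and its density `c'` may vary with `ε`, and so may the constants of the
boundary term; three errors of size `ε / 3` are added. -/
lemma HasDensity.approx {m : Set (Euc d) → ℂ} {c : ℂ}
    (h : ∀ ε > 0, ∃ m' c', HasDensity m' c' ∧ ‖c' - c‖ ≤ ε ∧ ∃ C r : ℝ, 0 ≤ C ∧ 0 < r ∧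
      ∀ A : Set (Euc d), Bornology.IsBounded A → MeasurableSet A →
        ‖m A - m' A‖ ≤ ε * volume.real A + C * bvol r A) : HasDensity m c := by
  intro ε hε
  obtain ⟨m', c', hm', hc', C, r, hC, hr, H⟩ := h (ε / 3) (by positivity)
  obtain ⟨C', r', hC', hr', H'⟩ := hm' (ε / 3) (by positivity)
  refine ⟨C + C', max r r', by positivity, by positivity, fun A hA hA' => ?_⟩
  have e : m A - c * volume.real A =
      (m A - m' A) + (m' A - c' * volume.real A) + (c' - c) * volume.real A := by ring
  have h1 := H A hA hA'
  have h2 := H' A hA hA'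
  have h3 : ‖(c' - c) * (volume.real A : ℂ)‖ ≤ ε / 3 * volume.real A := by
    rw [norm_mul, Complex.norm_real, Real.norm_of_nonneg measureReal_nonneg]
    exact mul_le_mul_of_nonneg_right hc' measureReal_nonneg
  have h4 := mul_le_mul_of_nonneg_left (bvol_mono (le_max_left r r') hA) hC
  have h5 := mul_le_mul_of_nonneg_left (bvol_mono (le_max_right r r') hA) hC'
  rw [e]
  refine (norm_add₃_le).trans ?_
  linarith

lemma HasDensity.congr_boundary {m m' : Set (Euc d) → ℂ} {c : ℂ} (h : HasDensity m' c)
    (hm : BoundaryClose m m') : HasDensity m c := by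
  obtain ⟨C, r, hC, hr, H⟩ := hm
  refine HasDensity.approx fun ε hε => ⟨m', c, h, by simpa using hε.le, C, r, hC, hr, ?_⟩
  intro A hA hA'
  have : 0 ≤ ε * volume.real A := by positivity
  linarith [H A hA hA']

lemma BoundaryClose.symm {m m' : Set (Euc d) → ℂ} (h : BoundaryClose m m') :
    BoundaryClose m' m := by
  obtain ⟨C, r, hC, hr, H⟩ := h
  exact ⟨C, r, hC, hr, fun A hA hA' => by rw [norm_sub_rev]; exact H A hA hA'⟩

lemma BoundaryClose.of_eq {m m' : Set (Euc d) → ℂ}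
    (h : ∀ A, Bornology.IsBounded A → MeasurableSet A → m A = m' A) : BoundaryClose m m' :=
  ⟨0, 1, le_rfl, one_pos, fun A hA hA' => by rw [h A hA hA']; simp⟩

lemma HasDensity.congr {m m' : Set (Euc d) → ℂ} {c : ℂ} (h : HasDensity m' c)
    (hm : ∀ A, Bornology.IsBounded A → MeasurableSet A → m A = m' A) : HasDensity m c :=
  h.congr_boundary (.of_eq hm)

lemma HasDensity.add {m m' : Set (Euc d) → ℂ} {c c' : ℂ} (h : HasDensity m c)
    (h' : HasDensity m' c') : HasDensity (fun A => m A + m' A) (c + c') := by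
  intro ε hε
  obtain ⟨C, r, hC, hr, H⟩ := h (ε / 2) (by positivity)
  obtain ⟨C', r', hC', hr', H'⟩ := h' (ε / 2) (by positivity)
  refine ⟨C + C', max r r', by positivity, by positivity, fun A hA hA' => ?_⟩
  have h4 := mul_le_mul_of_nonneg_left (bvol_mono (le_max_left r r') hA) hC
  have h5 := mul_le_mul_of_nonneg_left (bvol_mono (le_max_right r r') hA) hC'
  rw [show m A + m' A - (c + c') * volume.real A =
    (m A - c * volume.real A) + (m' A - c' * volume.real A) by ring]
  refine (norm_add_le _ _).trans ?_
  linarith [H A hA hA', H' A hA hA']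

lemma HasDensity.const_mul {m : Set (Euc d) → ℂ} {c : ℂ} (h : HasDensity m c) (a : ℂ) :
    HasDensity (fun A => a * m A) (a * c) := by
  intro ε hε
  obtain ⟨C, r, hC, hr, H⟩ := h (ε / (‖a‖ + 1)) (by positivity)
  refine ⟨‖a‖ * C, r, by positivity, hr, fun A hA hA' => ?_⟩
  rw [mul_assoc, ← mul_sub, norm_mul]
  refine (mul_le_mul_of_nonneg_left (H A hA hA') (norm_nonneg a)).trans ?_
  have h1 : ‖a‖ * (ε / (‖a‖ + 1)) ≤ ε := by
    rw [mul_div_assoc', div_le_iff₀ (by positivity)]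
    nlinarith [norm_nonneg a]
  have h2 := mul_le_mul_of_nonneg_right h1 (measureReal_nonneg (μ := volume) (s := A))
  nlinarith

lemma HasDensity.zero : HasDensity (fun _ : Set (Euc d) => 0) 0 := by
  intro ε hε
  refine ⟨0, 1, le_rfl, one_pos, fun A _ _ => ?_⟩
  simp only [zero_mul, sub_self, norm_zero, add_zero]
  positivity

lemma HasDensity.sum {ι : Type*} {s : Finset ι} {m : ι → Set (Euc d) → ℂ} {c : ι → ℂ}
    (h : ∀ i ∈ s, HasDensity (m i) (c i)) :
    HasDensity (fun A => ∑ i ∈ s, m i A) (∑ i ∈ s, c i) := by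
  classical
  induction s using Finset.induction_on with
  | empty => simpa using HasDensity.zero
  | insert i s hi ih =>
    simp only [Finset.sum_insert hi]
    exact (h i (by simp)).add (ih fun j hj => h j (by simp [hj]))

/-- The averages along the translates of a van Hove sequence converge to the density. -/
lemma HasDensity.tendstoUniformly {m : Set (Euc d) → ℂ} {c : ℂ} (h : HasDensity m c)
    {F : ℕ → Set (Euc d)} (hF : IsVanHove F) :
    TendstoUniformly (fun n (t : Euc d) => ((volume.real (F n) : ℝ) : ℂ)⁻¹ * m (translate (F n) t))
      (fun _ => c) atTop := by
  rw [Metric.tendstoUniformly_iff]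
  intro ε hε
  obtain ⟨C, r, hC, hr, H⟩ := h (ε / 2) (by positivity)
  have h1 : Tendsto (fun n => C * (bvol r (F n) / volume.real (F n))) atTop (𝓝 (C * 0)) :=
    (hF.boundary r hr).const_mul C
  rw [mul_zero] at h1
  filter_upwards [h1.eventually (gt_mem_nhds (half_pos hε))] with n hn t
  have hv := hF.volume_pos n
  have := H _ (isBounded_translate (hF.bounded n) t) (measurableSet_translate (hF.measurable n) t)
  rw [volume_real_translate, bvol_translate] at this
  have hv' : ((volume.real (F n) : ℝ) : ℂ) ≠ 0 := by exact_mod_cast hv.ne'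
  have e : c - ((volume.real (F n) : ℝ) : ℂ)⁻¹ * m (translate (F n) t) =
      -(((volume.real (F n) : ℝ) : ℂ)⁻¹ * (m (translate (F n) t) - c * volume.real (F n))) := by
    field_simp
    ring
  rw [dist_eq_norm, e, norm_neg, norm_mul, norm_inv, Complex.norm_real,
    Real.norm_of_nonneg hv.le]
  calc _ ≤ (volume.real (F n))⁻¹ * (ε / 2 * volume.real (F n) + C * bvol r (F n)) := by gcongr
    _ = ε / 2 + C * (bvol r (F n) / volume.real (F n)) := by field_simp
    _ < ε := by linarith

lemma HasDensity.tendsto {m : Set (Euc d) → ℂ} {c : ℂ} (h : HasDensity m c)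
    {F : ℕ → Set (Euc d)} (hF : IsVanHove F) :
    Tendsto (fun n => ((volume.real (F n) : ℝ) : ℂ)⁻¹ * m (F n)) atTop (𝓝 c) := by
  simpa using (h.tendstoUniformly hF).tendsto_at 0

lemma HasDensity.unique {m : Set (Euc d) → ℂ} {c c' : ℂ} (h : HasDensity m c)
    (h' : HasDensity m c') {F : ℕ → Set (Euc d)} (hF : IsVanHove F) : c = c' :=
  tendsto_nhds_unique (h.tendsto hF) (h'.tendsto hF)

/-- Uniform limits of set functions with a density have a density. -/
lemma exists_hasDensity_of_approx {F : ℕ → Set (Euc d)} (hF : IsVanHove F)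
    {m : Set (Euc d) → ℂ}
    (h : ∀ ε > 0, ∃ m' c', HasDensity m' c' ∧ ∃ C r : ℝ, 0 ≤ C ∧ 0 < r ∧
      ∀ A : Set (Euc d), Bornology.IsBounded A → MeasurableSet A →
        ‖m A - m' A‖ ≤ ε * volume.real A + C * bvol r A) : ∃ c, HasDensity m c := by
  have key : ∀ ε > 0, ∃ c' : ℂ, ∃ m', HasDensity m' c' ∧ (∃ C r : ℝ, 0 ≤ C ∧ 0 < r ∧
      ∀ A : Set (Euc d), Bornology.IsBounded A → MeasurableSet A →
        ‖m A - m' A‖ ≤ ε * volume.real A + C * bvol r A) ∧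
      ∀ᶠ n in atTop, ‖((volume.real (F n) : ℝ) : ℂ)⁻¹ * m (F n) - c'‖ ≤ 3 * ε := by
    intro ε hε
    obtain ⟨m', c', hm', C, r, hC, hr, H⟩ := h ε hε
    refine ⟨c', m', hm', ⟨C, r, hC, hr, H⟩, ?_⟩
    have h1 : Tendsto (fun n => C * (bvol r (F n) / volume.real (F n))) atTop (𝓝 (C * 0)) :=
      (hF.boundary r hr).const_mul C
    rw [mul_zero] at h1
    have h2 := Metric.tendsto_nhds.1 (hm'.tendsto hF) ε hε
    filter_upwards [h1.eventually (gt_mem_nhds hε), h2] with n hn hn2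
    have hv := hF.volume_pos n
    have h3 := H _ (hF.bounded n) (hF.measurable n)
    have e : ((volume.real (F n) : ℝ) : ℂ)⁻¹ * m (F n) - c' =
      ((volume.real (F n) : ℝ) : ℂ)⁻¹ * (m (F n) - m' (F n)) +
        (((volume.real (F n) : ℝ) : ℂ)⁻¹ * m' (F n) - c') := by ring
    rw [dist_eq_norm] at hn2
    rw [e]
    refine (norm_add_le _ _).trans ?_
    have h4 : ‖((volume.real (F n) : ℝ) : ℂ)⁻¹ * (m (F n) - m' (F n))‖ ≤ ε + ε := by
      rw [norm_mul, norm_inv, Complex.norm_real, Real.norm_of_nonneg hv.le]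
      calc _ ≤ (volume.real (F n))⁻¹ * (ε * volume.real (F n) + C * bvol r (F n)) := by gcongr
        _ = ε + C * (bvol r (F n) / volume.real (F n)) := by field_simp
        _ ≤ ε + ε := by linarith
    linarith
  have hcau : CauchySeq (fun n => ((volume.real (F n) : ℝ) : ℂ)⁻¹ * m (F n)) := by
    rw [Metric.cauchySeq_iff']
    intro ε hε
    -- The averages at `n` and at `N` are each within `3 * ε / 7` of `c'`, hence within `6 * ε / 7`
    -- of each other.
    obtain ⟨c', -, -, -, h⟩ := key (ε / 7) (by positivity)
    obtain ⟨N, hN⟩ := eventually_atTop.1 h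
    refine ⟨N, fun n hn => ?_⟩
    rw [dist_eq_norm]
    have := norm_sub_le (((volume.real (F n) : ℝ) : ℂ)⁻¹ * m (F n) - c')
      (((volume.real (F N) : ℝ) : ℂ)⁻¹ * m (F N) - c')
    rw [sub_sub_sub_cancel_right] at this
    linarith [hN n hn, hN N le_rfl]
  obtain ⟨c, hc⟩ := cauchySeq_tendsto_of_complete hcau
  refine ⟨c, HasDensity.approx fun ε hε => ?_⟩
  -- The limit `c` inherits the bound `3 * (ε / 3) = ε` on its distance from `c'`.
  obtain ⟨c', m', hm', ⟨C, r, hC, hr, H⟩, h⟩ := key (ε / 3) (by positivity)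
  refine ⟨m', c', hm', ?_, C, r, hC, hr, fun A hA hA' => ?_⟩
  · rw [norm_sub_rev]
    have := le_of_tendsto (hc.sub_const c').norm h
    linarith
  · have : ε / 3 * volume.real A ≤ ε * volume.real A :=
      mul_le_mul_of_nonneg_right (by linarith) measureReal_nonneg
    linarith [H A hA hA']

/-! ### Weighted combs and kernels -/

/-- The total weight `∑_{y ∈ Λ ∩ A} a y`. -/
noncomputable def comb (Λ : Set (Euc d)) (a : Euc d → ℂ) (A : Set (Euc d)) : ℂ :=
  ∑ᶠ y ∈ Λ ∩ A, a y

-- The index set `T` may exceed `Λ ∩ A`. This permits a termwise comparison with integrals over `A`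
-- to which points outside `A` contribute.
open Classical in
lemma comb_eq_sum {Λ : Set (Euc d)} (a : Euc d → ℂ) {A : Set (Euc d)} {T : Finset (Euc d)}
    (h1 : ↑T ⊆ Λ) (h2 : Λ ∩ A ⊆ T) : comb Λ a A = ∑ y ∈ T, if y ∈ A then a y else 0 := by
  have e : Λ ∩ A = ↑(T.filter (· ∈ A)) := by
    ext y
    simp only [mem_inter_iff, Finset.coe_filter, mem_ofPred_eq]
    exact ⟨fun h => ⟨h2 h, h.2⟩, fun h => ⟨h1 h.1, h.2⟩⟩
  rw [comb, e, finsum_mem_coe_finset, Finset.sum_filter]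

lemma IsDelone.comb_eq_sum {Λ : Set (Euc d)} (hΛ : IsDelone Λ) (a : Euc d → ℂ) {A : Set (Euc d)}
    (hA : Bornology.IsBounded A) : comb Λ a A = ∑ y ∈ (hΛ.finite_inter hA).toFinset, a y :=
  finsum_mem_eq_finite_toFinset_sum a _

open Classical in
lemma IsDelone.comb_boole {Λ : Set (Euc d)} (hΛ : IsDelone Λ) (p : Euc d → Prop)
    {A : Set (Euc d)} (hA : Bornology.IsBounded A) :
    comb Λ (fun y => if p y then 1 else 0) A = (((Λ ∩ A) ∩ {y | p y}).ncard : ℂ) := by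
  rw [hΛ.comb_eq_sum _ hA, Finset.sum_boole, Set.ncard_eq_toFinset_card _
    ((hΛ.finite_inter hA).inter_of_left _)]
  congr 2
  ext y
  simp

lemma IsDelone.norm_comb_le {Λ : Set (Euc d)} (hΛ : IsDelone Λ) {a : Euc d → ℂ} {M : ℝ}
    (ha : ∀ y ∈ Λ, ‖a y‖ ≤ M) {A : Set (Euc d)} (hA : Bornology.IsBounded A) :
    ‖comb Λ a A‖ ≤ M * (Λ ∩ A).ncard := by
  rw [hΛ.comb_eq_sum a hA, Set.ncard_eq_toFinset_card _ (hΛ.finite_inter hA), mul_comm,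
    ← nsmul_eq_mul]
  refine (norm_sum_le _ _).trans (Finset.sum_le_card_nsmul _ _ _ fun y hy => ha y ?_)
  exact ((Set.Finite.mem_toFinset _).1 hy).1

/-- The function `x ↦ ∑_{y ∈ Λ} k y (x - y)`. -/
noncomputable def kernelSum (Λ : Set (Euc d)) (k : Euc d → Euc d → ℂ) (x : Euc d) : ℂ :=
  ∑' y : Λ, k y (x - y)

/-- A family of measurable functions, bounded by `M` and supported in the ball of radius `R`. -/
structure IsKernel (k : Euc d → Euc d → ℂ) (R M : ℝ) : Prop where
  measurable : ∀ y, Measurable (k y)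
  supp : ∀ y s, R < ‖s‖ → k y s = 0
  bound : ∀ y s, ‖k y s‖ ≤ M

/-- Since `T` only has to contain the points within `R` of `x`, one `T` can serve for all `x` in a
bounded region. -/
lemma kernelSum_eq_sum {Λ : Set (Euc d)} {k : Euc d → Euc d → ℂ} {R : ℝ}
    (hk : ∀ y s, R < ‖s‖ → k y s = 0) {x : Euc d} {T : Finset (Euc d)} (h1 : ↑T ⊆ Λ)
    (h2 : Λ ∩ Metric.closedBall x R ⊆ T) : kernelSum Λ k x = ∑ y ∈ T, k y (x - y) := by
  rw [kernelSum, tsum_subtype Λ (fun y => k y (x - y)), tsum_eq_sum (s := T)]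
  · exact Finset.sum_congr rfl fun y hy => Set.indicator_of_mem (h1 hy) _
  · intro y hy
    by_cases hy' : y ∈ Λ
    · rw [Set.indicator_of_mem hy']
      apply hk
      by_contra! hle
      refine hy (h2 ⟨hy', ?_⟩)
      rwa [mem_closedBall_iff_norm, norm_sub_rev]
    · exact Set.indicator_of_notMem hy' _

/-- At each `x` the sums over the points in balls of growing radius are eventually constant, so the
function is a pointwise limit of finite sums. -/
lemma IsKernel.measurable_kernelSum {Λ : Set (Euc d)} (hΛ : IsDelone Λ)
    {k : Euc d → Euc d → ℂ} {R M : ℝ} (hk : IsKernel k R M) : Measurable (kernelSum Λ k) := by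
  refine measurable_of_tendsto_metrizable (f := fun (n : ℕ) x =>
    ∑ y ∈ (hΛ.finite_inter (Metric.isBounded_closedBall (x := (0 : Euc d)) (r := n))).toFinset,
      k y (x - y)) (fun n => ?_) ?_
  · exact Finset.measurable_sum _ fun y _ => (hk.measurable y).comp (measurable_id.sub_const y)
  · rw [tendsto_pi_nhds]
    intro x
    obtain ⟨N, hN⟩ := exists_nat_ge (‖x‖ + R)
    refine tendsto_const_nhds.congr' ?_
    filter_upwards [eventually_ge_atTop N] with n hn
    refine kernelSum_eq_sum hk.supp (fun y hy => (by simpa using hy : y ∈ Λ ∧ _).1) ?_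
    rintro y ⟨hy, hy'⟩
    simp only [Finite.coe_toFinset, mem_inter_iff, hy, mem_closedBall_iff_norm, sub_zero, true_and]
    rw [mem_closedBall_iff_norm] at hy'
    have h1 : ‖y‖ ≤ ‖x‖ + ‖y - x‖ := by simpa using norm_add_le x (y - x)
    have h2 : (N : ℝ) ≤ n := by exact_mod_cast hn
    linarith

lemma IsKernel.norm_kernelSum_le {Λ : Set (Euc d)} (hΛ : IsDelone Λ)
    {k : Euc d → Euc d → ℂ} {R M : ℝ} (hk : IsKernel k R M) :
    ∃ B, ∀ x, ‖kernelSum Λ k x‖ ≤ B := by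
  obtain ⟨N, hN, H⟩ := hΛ.exists_ncard_ball_le R
  have hM : 0 ≤ M := (norm_nonneg _).trans (hk.bound 0 0)
  refine ⟨N * M, fun x => ?_⟩
  have hfin := hΛ.finite_inter (Metric.isBounded_closedBall (x := x) (r := R))
  rw [kernelSum_eq_sum hk.supp (T := hfin.toFinset)
    (fun y hy => (by simpa using hy : y ∈ Λ ∧ _).1) (by simp)]
  refine (norm_sum_le _ _).trans ((Finset.sum_le_card_nsmul _ _ M fun y _ => hk.bound _ _).trans ?_)
  rw [nsmul_eq_mul, ← Set.ncard_eq_toFinset_card _ hfin]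
  exact mul_le_mul_of_nonneg_right (H x) hM

lemma norm_integral_le_of_bound {f : Euc d → ℂ} {K : Set (Euc d)} {M : ℝ}
    (hK : Bornology.IsBounded K) (h0 : ∀ x ∉ K, f x = 0) (hM : ∀ x ∈ K, ‖f x‖ ≤ M) :
    ‖∫ x, f x‖ ≤ M * volume.real K := by
  rw [← setIntegral_eq_integral_of_forall_compl_eq_zero h0]
  exact norm_setIntegral_le_of_norm_le_const hK.measure_lt_top hM

lemma integrableOn_of_bound {f : Euc d → ℂ} (hf : Measurable f) {M : ℝ} (hM : ∀ x, ‖f x‖ ≤ M)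
    {A : Set (Euc d)} (hA : Bornology.IsBounded A) : IntegrableOn f A :=
  Measure.integrableOn_of_bounded hA.measure_lt_top.ne hf.aestronglyMeasurable
    (ae_of_all _ hM)

lemma IsKernel.integrable {k : Euc d → Euc d → ℂ} {R M : ℝ} (hk : IsKernel k R M) (y : Euc d) :
    Integrable (k y) := by
  rw [← integrableOn_iff_integrable_of_support_subset (s := Metric.closedBall 0 R)]
  · exact integrableOn_of_bound (hk.measurable y) (hk.bound y) Metric.isBounded_closedBall
  · intro s hs
    by_contra h
    exact hs (hk.supp y s (by simpa using h))

/-- Up to boundary terms, integrating `∑_{y ∈ Λ} k y (x - y)` over `A` amounts to summing the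
total masses of the kernels over the points of `Λ` in `A`. -/
lemma IsKernel.boundaryClose {Λ : Set (Euc d)} (hΛ : IsDelone Λ)
    {k : Euc d → Euc d → ℂ} {R M : ℝ} (hR : 0 ≤ R) (hk : IsKernel k R M) :
    BoundaryClose (fun A => ∫ x in A, kernelSum Λ k x) (comb Λ (fun y => ∫ s, k y s)) := by
  classical
  have hM : 0 ≤ M := (norm_nonneg _).trans (hk.bound 0 0)
  obtain ⟨C, hC, H⟩ := hΛ.exists_ncard_boundary_le hR
  set V := volume.real (Metric.closedBall (0 : Euc d) R)
  refine ⟨M * V * C, 1 + R, by positivity, by positivity, fun A hA hA' => ?_⟩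
  have hTb : Bornology.IsBounded (Metric.cthickening R A) := hA.cthickening
  set T := (hΛ.finite_inter hTb).toFinset with hT
  have hTΛ : ↑T ⊆ Λ := fun y hy => (by simpa [hT] using hy : y ∈ Λ ∧ _).1
  have hTA : Λ ∩ A ⊆ T := by
    rw [hT, Finite.coe_toFinset]
    exact inter_subset_inter_right _ (Metric.self_subset_cthickening A)
  have hint : ∀ y, Integrable (fun x => k y (x - y)) := fun y => (hk.integrable y).comp_sub_right y
  have e1 : ∫ x in A, kernelSum Λ k x = ∑ y ∈ T, ∫ x in A, k y (x - y) := by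
    rw [← integral_finsetSum _ fun y _ => (hint y).integrableOn]
    refine setIntegral_congr_fun hA' fun x hx => kernelSum_eq_sum hk.supp hTΛ ?_
    rw [hT, Finite.coe_toFinset]
    exact inter_subset_inter_right _ fun z hz => Metric.mem_cthickening_of_dist_le z x R A hx hz
  have e2 : comb Λ (fun y => ∫ s, k y s) A =
      ∑ y ∈ T, if y ∈ A then ∫ x, k y (x - y) else 0 := by
    rw [Delone.comb_eq_sum _ hTΛ hTA]
    exact Finset.sum_congr rfl fun y _ => by rw [integral_sub_right_eq_self (k y)]
  -- If `y` is farther than `R` from the frontier, the support of the translated kernel lies on the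
  -- same side of it as `y` and there is no error. For the remaining `y` the error is at most the
  -- bound `M` times the volume of a ball of radius `R`.
  have e3 : ∀ y ∈ T, ‖(∫ x in A, k y (x - y)) - (if y ∈ A then ∫ x, k y (x - y) else 0)‖ ≤
      if y ∈ Metric.cthickening R (frontier A) then M * V else 0 := by
    intro y _
    have h1 : (∫ x in A, k y (x - y)) - (if y ∈ A then ∫ x, k y (x - y) else 0) =
        ∫ x, (A.indicator (fun x => k y (x - y)) x - if y ∈ A then k y (x - y) else 0) := by
      rw [integral_sub ((hint y).indicator hA'), integral_indicator hA']
      · split_ifs <;> simp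
      · split_ifs
        exacts [hint y, integrable_zero _ _ _]
    rw [h1]
    by_cases hy : y ∈ Metric.cthickening R (frontier A)
    · rw [if_pos hy]
      have hVy : V = volume.real (Metric.closedBall y R) := by
        simp only [V, measureReal_def, Measure.addHaar_closedBall_center]
      rw [hVy]
      refine norm_integral_le_of_bound Metric.isBounded_closedBall (fun x hx => ?_) fun x _ => ?_
      · rw [mem_closedBall_iff_norm, not_le] at hx
        simp [indicator, hk.supp y _ hx]
      · by_cases hx : x ∈ A <;> by_cases hy : y ∈ A <;> simp [hx, hy, hk.bound, hM]
    · rw [if_neg hy]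
      refine le_of_eq ?_
      rw [norm_eq_zero, ← integral_zero (Euc d) ℂ]
      congr 1
      funext x
      by_cases hx : R < ‖x - y‖
      · simp [indicator, hk.supp y _ hx]
      · have : y ∈ A ↔ x ∈ A := by
          by_contra hxy
          exact hy (mem_boundary hxy (by rw [dist_comm, dist_eq_norm]; exact not_lt.1 hx))
        by_cases hx : x ∈ A <;> simp [this, hx]
  beta_reduce
  rw [e1, e2, ← Finset.sum_sub_distrib]
  refine (norm_sum_le _ _).trans ((Finset.sum_le_sum e3).trans ?_)
  rw [← Finset.sum_filter, Finset.sum_const, nsmul_eq_mul]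
  have hcard : ((T.filter (· ∈ Metric.cthickening R (frontier A))).card : ℝ) ≤
      C * bvol (1 + R) A := by
    refine le_trans ?_ (H A hA)
    have hfin := hΛ.finite_inter (isBounded_boundary hA R)
    rw [Set.ncard_eq_toFinset_card _ hfin]
    exact_mod_cast Finset.card_le_card fun y hy => by
      rw [Finset.mem_filter] at hy
      exact (Set.Finite.mem_toFinset _).2 ⟨hTΛ hy.1, hy.2⟩
  calc _ ≤ C * bvol (1 + R) A * (M * V) := by gcongr
    _ = _ := by ring

/-! ### Means of functions -/

/-- `c` is the mean of the function `g`. -/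
def HasMean (g : Euc d → ℂ) (c : ℂ) : Prop := HasDensity (fun A => ∫ x in A, g x) c

lemma setIntegral_comp_add_right (g : Euc d → ℂ) {D : Set (Euc d)} (hD : MeasurableSet D)
    (s : Euc d) :
    ∫ x in D, g (x + s) = ∫ x in translate D (-s), g x := by
  rw [← integral_indicator hD, ← integral_indicator (measurableSet_translate hD _),
    ← integral_add_right_eq_self ((translate D (-s)).indicator g) s]
  congr 1
  funext x
  have e : x + s ∈ translate D (-s) ↔ x ∈ D := by rw [mem_translate, add_neg_cancel_right]
  by_cases hx : x ∈ D
  · rw [indicator_of_mem hx, indicator_of_mem (e.2 hx)]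
  · rw [indicator_of_notMem hx, indicator_of_notMem (fun h => hx (e.1 h))]

/-- Shifting a bounded function changes its integral over `A` by a boundary term only. -/
lemma norm_setIntegral_sub_shift_le {g : Euc d → ℂ} (hg : Measurable g) {M : ℝ}
    (hM : ∀ x, ‖g x‖ ≤ M) {s : Euc d} {ρ : ℝ} (hs : ‖s‖ ≤ ρ) {A : Set (Euc d)}
    (hA : Bornology.IsBounded A) (hA' : MeasurableSet A) :
    ‖(∫ x in A, g x) - ∫ x in A, g (x + s)‖ ≤ M * bvol ρ A := by
  have hM0 : 0 ≤ M := (norm_nonneg _).trans (hM 0)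
  have hA2 := measurableSet_translate hA' (-s)
  rw [setIntegral_comp_add_right g hA' s, ← integral_indicator hA', ← integral_indicator hA2, ← integral_sub
    ((integrableOn_of_bound hg hM hA).integrable_indicator hA')
    ((integrableOn_of_bound hg hM (isBounded_translate hA _)).integrable_indicator hA2)]
  refine norm_integral_le_of_bound (isBounded_boundary hA ρ) (fun x hx => ?_) (fun x _ => ?_)
  · have : x ∈ A ↔ x + -s ∈ A := by
      by_contra hxs
      refine hx (mem_boundary hxs ?_)
      rw [dist_eq_norm, show x - (x + -s) = s by abel]
      exact hs
    by_cases hxA : x ∈ A <;> simp [indicator, mem_translate, ← this, hxA]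
  · by_cases h1 : x ∈ A <;> by_cases h2 : x + -s ∈ A <;>
      simp [indicator, mem_translate, h1, h2, hM, hM0]

/-- A bounded function whose averages along the translates of a sequence of bounded sets converge
uniformly has a mean. -/
lemma hasMean_of_tendstoUniformly {F : ℕ → Set (Euc d)} (hF : IsVanHove F) {g : Euc d → ℂ}
    (hg : Measurable g) {M : ℝ} (hM : ∀ x, ‖g x‖ ≤ M) {c : ℂ}
    (h : TendstoUniformly (fun n (t : Euc d) =>
      ((volume.real (F n) : ℝ) : ℂ)⁻¹ * ∫ x in translate (F n) t, g x) (fun _ => c) atTop) :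
    HasMean g c := by
  intro ε hε
  obtain ⟨n, hn⟩ := (Metric.tendstoUniformly_iff.1 h ε hε).exists
  have hM0 : 0 ≤ M := (norm_nonneg _).trans (hM 0)
  set B := F n
  have hB := hF.bounded n
  have hB' := hF.measurable n
  have hv := hF.volume_pos n
  obtain ⟨ρ, hρ, hBρ⟩ := hB.exists_pos_norm_le
  have hv' : ((volume.real B : ℝ) : ℂ) ≠ 0 := by exact_mod_cast hv.ne'
  refine ⟨M, ρ, hM0, hρ, fun A hA hA' => ?_⟩
  -- One index `n` suffices. The double integral of `g (x + s)` over `A × B` is computed in both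
  -- orders: integrating over `B` first gives nearly `c * Vol B` for each `x`, by `h1`, while
  -- integrating over `A` first gives nearly the integral of `g` over `A` for each `s`, by `h3`.
  have h1 : ∀ x, ‖(∫ s in B, g (x + s)) - c * volume.real B‖ ≤ ε * volume.real B := by
    intro x
    -- `translate B (-x)` is `B` moved by `+x`.
    have h2 := (hn (-x)).le
    simp only [add_comm x]
    rw [setIntegral_comp_add_right g hB' x]
    rw [dist_eq_norm, norm_sub_rev] at h2
    have e : (∫ x in translate B (-x), g x) - c * volume.real B = ((volume.real B : ℝ) : ℂ) *
        (((volume.real B : ℝ) : ℂ)⁻¹ * (∫ x in translate B (-x), g x) - c) := by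
      field_simp
    rw [e, norm_mul, Complex.norm_real, Real.norm_of_nonneg hv.le, mul_comm]
    exact mul_le_mul_of_nonneg_right h2 hv.le
  have h3 : ∀ s ∈ B, ‖(∫ x in A, g x) - ∫ x in A, g (x + s)‖ ≤ M * bvol ρ A := fun s hs =>
    norm_setIntegral_sub_shift_le hg hM (hBρ s hs) hA hA'
  have hA1 : IsFiniteMeasure (volume.restrict A) := ⟨by simpa using hA.measure_lt_top⟩
  have hB1 : IsFiniteMeasure (volume.restrict B) := ⟨by simpa using hB.measure_lt_top⟩
  have hprod : Integrable (Function.uncurry fun x s => g (x + s))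
      ((volume.restrict A).prod (volume.restrict B)) :=
    Integrable.of_bound (hg.comp (measurable_fst.add measurable_snd)).aestronglyMeasurable M
      (ae_of_all _ fun p => hM _)
  have hswap := integral_integral_swap hprod
  have h4 : ‖(∫ x in A, ∫ s in B, g (x + s)) - c * volume.real B * volume.real A‖ ≤
      ε * volume.real B * volume.real A := by
    have : c * volume.real B * volume.real A = ∫ x in A, c * volume.real B := by
      rw [setIntegral_const, Complex.real_smul]; ring
    have hi : IntegrableOn (fun x => ∫ s in B, g (x + s)) A := hprod.integral_prod_left
    rw [this, ← integral_sub hi (integrable_const _)]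
    exact norm_setIntegral_le_of_norm_le_const hA.measure_lt_top fun x _ => h1 x
  have h5 : ‖volume.real B * (∫ x in A, g x) - ∫ s in B, ∫ x in A, g (x + s)‖ ≤
      M * bvol ρ A * volume.real B := by
    have : volume.real B * (∫ x in A, g x) = ∫ s in B, ∫ x in A, g x := by
      rw [setIntegral_const, Complex.real_smul]
    have hi : IntegrableOn (fun s => ∫ x in A, g (x + s)) B := hprod.integral_prod_right
    rw [this, ← integral_sub (integrable_const _) hi]
    exact norm_setIntegral_le_of_norm_le_const hB.measure_lt_top h3
  rw [hswap] at h4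
  have h6 := norm_add_le _ _ |>.trans (add_le_add h5 h4)
  have e : volume.real B * (∫ x in A, g x) - (∫ s in B, ∫ x in A, g (x + s)) +
      ((∫ s in B, ∫ x in A, g (x + s)) - c * volume.real B * volume.real A) =
      volume.real B * ((∫ x in A, g x) - c * volume.real A) := by ring
  rw [e, norm_mul, Complex.norm_real, Real.norm_of_nonneg hv.le] at h6
  refine le_of_mul_le_mul_left (h6.trans (le_of_eq ?_)) hv
  ring

/-! ### Frequencies of patches -/

/-- The difference of the two set functions has density zero. -/
lemma BoundaryClose.tendstoUniformly {m m' : Set (Euc d) → ℂ} (h : BoundaryClose m m')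
    {F : ℕ → Set (Euc d)} (hF : IsVanHove F) {c : ℂ}
    (h' : TendstoUniformly (fun n (t : Euc d) =>
      ((volume.real (F n) : ℝ) : ℂ)⁻¹ * m' (translate (F n) t)) (fun _ => c) atTop) :
    TendstoUniformly (fun n (t : Euc d) =>
      ((volume.real (F n) : ℝ) : ℂ)⁻¹ * m (translate (F n) t)) (fun _ => c) atTop := by
  have h0 : HasDensity (fun A => m A - m' A) 0 := by
    refine HasDensity.congr_boundary HasDensity.zero ?_
    obtain ⟨C, r, hC, hr, H⟩ := h
    exact ⟨C, r, hC, hr, fun A hA hA' => by simpa using H A hA hA'⟩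
  have := h'.add (h0.tendstoUniformly hF)
  convert this using 1
  · funext n t
    simp only [Pi.add_apply]
    ring
  · funext t
    simp

open Classical in
/-- The weight that marks the points of `Λ` at which a translate of the cluster `Q` sits, with
`y₀ ∈ Q` corresponding to the marked point. -/
noncomputable def clusterWeight (Λ Q : Set (Euc d)) (y₀ : Euc d) (y : Euc d) : ℂ :=
  if ∀ q ∈ Q, q - y₀ + y ∈ Λ then 1 else 0

/-- Up to boundary terms, the cluster count is the total weight of the marked points. -/
lemma IsDelone.boundaryClose_clusterCount {Λ : Set (Euc d)} (hΛ : IsDelone Λ) {Q : Set (Euc d)}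
    (hQ : Q.Finite) {y₀ : Euc d} (hy₀ : y₀ ∈ Q) :
    BoundaryClose (fun A => (clusterCount Λ Q A : ℂ)) (comb Λ (clusterWeight Λ Q y₀)) := by
  obtain ⟨ρ, hρ, hQρ⟩ : ∃ ρ : ℝ, 0 < ρ ∧ ∀ q ∈ Q, ‖q - y₀‖ ≤ ρ := by
    obtain ⟨ρ, hρ, h⟩ := (hQ.image (fun q => q - y₀)).isBounded.exists_pos_norm_le
    exact ⟨ρ, hρ, fun q hq => h _ ⟨q, hq, rfl⟩⟩
  obtain ⟨C, hC, H⟩ := hΛ.exists_ncard_boundary_le hρ.le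
  refine ⟨C, 1 + ρ, hC.le, by positivity, fun A hA hA' => ?_⟩
  set X : Set (Euc d) := {y | ∀ q ∈ Q, q - y₀ + y ∈ A ∩ Λ} with hX
  set Y : Set (Euc d) := (Λ ∩ A) ∩ {y | ∀ q ∈ Q, q - y₀ + y ∈ Λ} with hY
  have hYfin : Y.Finite := (hΛ.finite_inter hA).inter_of_left _
  have hXY : X ⊆ Y := by
    intro y hy
    have h0 := hy y₀ hy₀
    rw [sub_self, zero_add] at h0
    exact ⟨⟨h0.2, h0.1⟩, fun q hq => (hy q hq).2⟩
  -- The translate of `Q` seen from `t` has its marked point at `y₀ - t`, and `t ↦ y₀ - t` is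
  -- injective.
  have e1 : clusterCount Λ Q A = X.ncard := by
    rw [clusterCount, ← Set.ncard_image_of_injective _ (sub_right_injective (b := y₀))]
    congr 1
    ext y
    simp only [mem_image, mem_ofPred_eq, hX]
    constructor
    · rintro ⟨t, ht, rfl⟩ q hq
      refine ht (?_ : q - y₀ + (y₀ - t) + t ∈ Q)
      rwa [show q - y₀ + (y₀ - t) + t = q by abel]
    · intro hy
      refine ⟨y₀ - y, fun z hz => ?_, by abel⟩
      have := hy _ hz
      rwa [show z + (y₀ - y) - y₀ + y = z by abel] at this
  have e2 : comb Λ (clusterWeight Λ Q y₀) A = Y.ncard := hΛ.comb_boole _ hA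
  have hdiff : Y \ X ⊆ Λ ∩ Metric.cthickening ρ (frontier A) := by
    rintro y ⟨hy, hyX⟩
    refine ⟨hy.1.1, ?_⟩
    simp only [hX, mem_ofPred_eq, not_forall] at hyX
    obtain ⟨q, hq, hqA⟩ := hyX
    have hqA' : q - y₀ + y ∉ A := fun h => hqA ⟨h, hy.2 q hq⟩
    refine mem_boundary (y := q - y₀ + y) (fun h => hqA' (h.1 hy.1.2)) ?_
    rw [dist_comm, dist_eq_norm, add_sub_cancel_right]
    exact hQρ q hq
  have e3 : (Y.ncard : ℝ) - X.ncard = (Y \ X).ncard := by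
    rw [← Set.ncard_sdiff_add_ncard_of_subset hXY hYfin]
    push_cast
    ring
  beta_reduce
  rw [e1, e2, norm_sub_rev]
  have e4 : (Y.ncard : ℂ) - X.ncard = (((Y \ X).ncard : ℝ) : ℂ) := by
    rw [← e3]; push_cast; ring
  rw [e4, Complex.norm_real, Real.norm_of_nonneg (by positivity)]
  refine le_trans ?_ (H A hA)
  exact_mod_cast Set.ncard_le_ncard hdiff (hΛ.finite_inter (isBounded_boundary hA ρ))

/-- The normalised indicator function of the unit ball. -/
noncomputable def unitBump (s : Euc d) : ℂ :=
  (Metric.closedBall (0 : Euc d) 1).indicator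
    (fun _ => ((volume.real (Metric.closedBall (0 : Euc d) 1) : ℝ) : ℂ)⁻¹) s

lemma isKernel_unitBump {a : Euc d → ℂ} {M : ℝ} (hM : 0 ≤ M) (ha : ∀ y, ‖a y‖ ≤ M) :
    IsKernel (fun y s => a y * unitBump s) 1
      (M * (volume.real (Metric.closedBall (0 : Euc d) 1))⁻¹) where
  measurable y := (measurable_const.indicator measurableSet_closedBall).const_mul _
  supp y s hs := by
    simp only [unitBump]
    rw [indicator_of_notMem (by simpa using hs), mul_zero]
  bound y s := by
    rw [norm_mul]
    refine mul_le_mul (ha y) ?_ (norm_nonneg _) hM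
    refine (norm_indicator_le_norm_self _ _).trans ?_
    rw [norm_inv, Complex.norm_real, Real.norm_of_nonneg measureReal_nonneg]

lemma integral_unitBump : ∫ s : Euc d, unitBump s = 1 := by
  have h : (volume.real (Metric.closedBall (0 : Euc d) 1)) ≠ 0 :=
    (ENNReal.toReal_pos (Metric.measure_closedBall_pos _ _ one_pos).ne'
      Metric.isBounded_closedBall.measure_lt_top.ne).ne'
  have h' : ((volume.real (Metric.closedBall (0 : Euc d) 1) : ℝ) : ℂ) ≠ 0 := by exact_mod_cast h
  simp only [unitBump]
  rw [integral_indicator measurableSet_closedBall, setIntegral_const, Complex.real_smul,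
    mul_inv_cancel₀ h']

/-- If the averages of a bounded weight converge uniformly along the translates of one van Hove
sequence, then the weight has a density. -/
lemma IsDelone.hasDensity_comb_of_tendstoUniformly {Λ : Set (Euc d)} (hΛ : IsDelone Λ)
    {F : ℕ → Set (Euc d)} (hF : IsVanHove F) {a : Euc d → ℂ} {M : ℝ} (ha : ∀ y, ‖a y‖ ≤ M)
    {c : ℂ} (h : TendstoUniformly (fun n (t : Euc d) =>
      ((volume.real (F n) : ℝ) : ℂ)⁻¹ * comb Λ a (translate (F n) t)) (fun _ => c) atTop) :
    HasDensity (comb Λ a) c := by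
  -- Spreading the weight of each point over a unit ball costs boundary terms only and produces a
  -- bounded measurable function, so that the averaging argument for functions applies to weighted
  -- points.
  have hk := isKernel_unitBump ((norm_nonneg _).trans (ha 0)) ha
  have hb := hk.boundaryClose hΛ zero_le_one
  have e : (fun y => ∫ s : Euc d, a y * unitBump s) = a := by
    funext y
    rw [integral_const_mul, integral_unitBump, mul_one]
  rw [e] at hb
  obtain ⟨B, hB⟩ := hk.norm_kernelSum_le hΛ
  exact (hasMean_of_tendstoUniformly hF (hk.measurable_kernelSum hΛ) hB
    (hb.tendstoUniformly hF h)).congr_boundary hb.symm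

lemma norm_clusterWeight_le (Λ Q : Set (Euc d)) (y₀ y : Euc d) :
    ‖clusterWeight Λ Q y₀ y‖ ≤ 1 := by
  unfold clusterWeight
  split_ifs <;> simp

lemma tendstoUniformly_ofReal {ι α : Type*} {l : Filter ι} {f : ι → α → ℝ} {c : ℝ} :
    TendstoUniformly f (fun _ => c) l ↔
      TendstoUniformly (fun n t => (f n t : ℂ)) (fun _ => (c : ℂ)) l := by
  simp only [Metric.tendstoUniformly_iff, Complex.dist_eq, ← Complex.ofReal_sub,
    Complex.norm_real, Real.dist_eq, Real.norm_eq_abs]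

/-- The frequency of a cluster is the density of the points at which it sits. -/
lemma IsDelone.hasUniformFrequency_iff {Λ : Set (Euc d)} (hΛ : IsDelone Λ)
    {F : ℕ → Set (Euc d)} (hF : IsVanHove F) {Q : Set (Euc d)} (hQ : Q.Finite) {y₀ : Euc d}
    (hy₀ : y₀ ∈ Q) {c : ℝ} :
    HasUniformFrequency Λ F Q c ↔ HasDensity (comb Λ (clusterWeight Λ Q y₀)) c := by
  have hb := hΛ.boundaryClose_clusterCount hQ hy₀
  have e : (fun n (t : Euc d) => (((clusterCount Λ Q (translate (F n) t) : ℝ) /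
      volume.real (F n) : ℝ) : ℂ)) = fun n t =>
      ((volume.real (F n) : ℝ) : ℂ)⁻¹ * (clusterCount Λ Q (translate (F n) t) : ℂ) := by
    funext n t
    push_cast
    rw [div_eq_inv_mul]
  rw [HasUniformFrequency, tendstoUniformly_ofReal, e]
  constructor
  · intro h
    exact hΛ.hasDensity_comb_of_tendstoUniformly hF (norm_clusterWeight_le Λ Q y₀)
      (hb.symm.tendstoUniformly hF h)
  · intro h
    exact hb.tendstoUniformly hF (h.tendstoUniformly hF)

/-- The weight `a` depends at points of `Λ` on a patch of fixed radius only. -/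
def PatchLocal (Λ : Set (Euc d)) (a : Euc d → ℂ) : Prop :=
  ∃ r : ℝ, ∀ y ∈ Λ, ∀ y' ∈ Λ, Agree r (translate Λ y) (translate Λ y') → a y = a y'

/-- The patches of radius `r` of `Λ`. -/
def patches (Λ : Set (Euc d)) (r : ℝ) : Set (Set (Euc d)) :=
  {P | ∃ y ∈ Λ, P = Metric.ball 0 r ∩ translate Λ y}

lemma finite_patches {Λ : Set (Euc d)} (hFLC : FiniteLocalComplexity Λ) (r : ℝ) :
    (patches Λ r).Finite :=
  (PatternSpace.finite_patches hFLC r).subset fun _ ⟨y, hy, e⟩ =>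
    ⟨PatternSpace.base Λ, y, hy, e⟩

lemma IsDelone.comb_sum {Λ : Set (Euc d)} (hΛ : IsDelone Λ) {ι : Type*} (s : Finset ι)
    (a : ι → Euc d → ℂ) {A : Set (Euc d)} (hA : Bornology.IsBounded A) :
    comb Λ (fun y => ∑ i ∈ s, a i y) A = ∑ i ∈ s, comb Λ (a i) A := by
  simp only [hΛ.comb_eq_sum _ hA]
  exact Finset.sum_comm

lemma comb_congr {Λ : Set (Euc d)} {a b : Euc d → ℂ} (h : ∀ y ∈ Λ, a y = b y)
    (A : Set (Euc d)) : comb Λ a A = comb Λ b A :=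
  finsum_mem_congr rfl fun y hy => h y hy.1

lemma IsDelone.comb_const_mul {Λ : Set (Euc d)} (hΛ : IsDelone Λ) (c : ℂ) (a : Euc d → ℂ)
    {A : Set (Euc d)} (hA : Bornology.IsBounded A) :
    comb Λ (fun y => c * a y) A = c * comb Λ a A := by
  simp only [hΛ.comb_eq_sum _ hA, Finset.mul_sum]

open Classical in
/-- The points of `Λ` with a given patch have a density. -/
lemma IsDelone.exists_hasDensity_patch {Λ : Set (Euc d)} (hΛ : IsDelone Λ)
    (hFLC : FiniteLocalComplexity Λ) {F : ℕ → Set (Euc d)} (hF : IsVanHove F)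
    (hUCF : UniformClusterFrequencies Λ F) {r : ℝ} (hr : 0 < r) (P : patches Λ r) :
    ∃ c, HasDensity (comb Λ (fun y => if Metric.ball 0 r ∩ translate Λ y = P then 1 else 0)) c := by
  have hfin := finite_patches hFLC r
  have : Finite (patches Λ r) := hfin
  have : Fintype (patches Λ r) := Fintype.ofFinite _
  -- The cluster belonging to `P` sits at all points whose patch contains `P`. Removing the points
  -- with a strictly larger patch, whose densities are known by descending induction in the finite
  -- set of patches, leaves those with patch exactly `P`.
  induction P using WellFoundedGT.induction with
  | ind P ih =>
    obtain ⟨P, y₀, hy₀, rfl⟩ := P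
    set Q : Set (Euc d) := Λ ∩ Metric.ball y₀ r with hQ
    have hQfin : Q.Finite := hΛ.finite_inter Metric.isBounded_ball
    have hy₀Q : y₀ ∈ Q := ⟨hy₀, Metric.mem_ball_self hr⟩
    obtain ⟨c, hc⟩ := hUCF Q ⟨y₀, hy₀Q⟩ hQfin inter_subset_left
    rw [hΛ.hasUniformFrequency_iff hF hQfin hy₀Q] at hc
    choose! f hf using ih
    set P₀ : patches Λ r := ⟨Metric.ball 0 r ∩ translate Λ y₀, ⟨y₀, hy₀, rfl⟩⟩ with hP₀
    set U : Finset (patches Λ r) := Finset.univ.filter (P₀ < ·) with hU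
    have hsum := HasDensity.sum (s := U) (c := f) (fun P hP => hf P (by simpa [hU] using hP))
    refine ⟨_, (hc.add (hsum.const_mul (-1))).congr fun A hA _ => ?_⟩
    beta_reduce
    rw [← hΛ.comb_sum _ _ hA, ← hΛ.comb_const_mul _ _ hA]
    have hadd : ∀ a b : Euc d → ℂ, comb Λ a A + comb Λ b A = comb Λ (fun y => a y + b y) A := by
      intro a b
      simp only [hΛ.comb_eq_sum _ hA, Finset.sum_add_distrib]
    rw [hadd]
    refine comb_congr (fun y hy => ?_) A
    set Py : patches Λ r := ⟨Metric.ball 0 r ∩ translate Λ y, ⟨y, hy, rfl⟩⟩ with hPy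
    have h1 : (∀ q ∈ Q, q - y₀ + y ∈ Λ) ↔ P₀ ≤ Py := by
      rw [← Subtype.coe_le_coe]
      constructor
      · rintro h z ⟨hz, hz'⟩
        refine ⟨hz, ?_⟩
        have := h (z + y₀) ⟨hz', by simpa [mem_ball_iff_norm] using hz⟩
        rwa [add_sub_cancel_right] at this
      · rintro h q ⟨hq, hq'⟩
        exact (h (⟨by rwa [mem_ball_iff_norm, sub_zero, ← mem_ball_iff_norm], by simpa [mem_translate] using hq⟩ :
          q - y₀ ∈ Metric.ball 0 r ∩ translate Λ y₀)).2
    have h2 : ∀ P : patches Λ r, (Metric.ball 0 r ∩ translate Λ y = P) ↔ P = Py := by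
      intro P
      rw [Subtype.ext_iff, hPy, eq_comm]
    have h3 : (∑ P ∈ U, if Metric.ball 0 r ∩ translate Λ y = (P : Set (Euc d))
        then (1 : ℂ) else 0) = if P₀ < Py then 1 else 0 := by
      simp only [h2, Finset.sum_ite_eq', hU, Finset.mem_filter, Finset.mem_univ, true_and]
    have h4 := h2 P₀
    rw [hP₀] at h4
    rw [h3, clusterWeight, if_congr h1 rfl rfl, if_congr h4 rfl rfl]
    rcases eq_or_ne P₀ Py with e | e
    · rw [if_pos e, if_pos e.le, if_neg (by rw [e]; exact lt_irrefl _)]; ring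
    · rw [if_neg e]
      by_cases hle : P₀ ≤ Py
      · rw [if_pos hle, if_pos (lt_of_le_of_ne hle e)]; ring
      · rw [if_neg hle, if_neg fun h => hle h.le]; ring

/-- Patch-local weights have a density. -/
lemma IsDelone.exists_hasDensity_comb {Λ : Set (Euc d)} (hΛ : IsDelone Λ)
    (hFLC : FiniteLocalComplexity Λ) {F : ℕ → Set (Euc d)} (hF : IsVanHove F)
    (hUCF : UniformClusterFrequencies Λ F) {a : Euc d → ℂ} (ha : PatchLocal Λ a) :
    ∃ c, HasDensity (comb Λ a) c := by
  classical
  obtain ⟨r, ha⟩ := ha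
  set s := max r 1
  have : Fintype (patches Λ s) := (finite_patches hFLC s).fintype
  choose f hf using hΛ.exists_hasDensity_patch hFLC hF hUCF (r := s) (by positivity)
  choose p hp hp' using fun P : patches Λ s => P.2
  -- On `Λ` the weight is a finite linear combination of indicators of patches, the coefficient
  -- being its value at a chosen point `p P` with patch `P`.
  have hsum := HasDensity.sum (s := Finset.univ) (fun P _ => (hf P).const_mul (a (p P)))
  refine ⟨_, hsum.congr fun A hA _ => ?_⟩
  simp only [← hΛ.comb_const_mul _ _ hA]
  rw [← hΛ.comb_sum _ _ hA]
  refine comb_congr (fun y hy => ?_) A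
  set Py : patches Λ s := ⟨Metric.ball 0 s ∩ translate Λ y, ⟨y, hy, rfl⟩⟩ with hPy
  have h2 : ∀ P : patches Λ s, (Metric.ball 0 s ∩ translate Λ y = P) ↔ P = Py := by
    intro P
    rw [Subtype.ext_iff, hPy, eq_comm]
  simp only [h2, mul_ite, mul_one, mul_zero, Finset.sum_ite_eq', Finset.mem_univ, if_true]
  exact ha y hy _ (hp Py) ((agree_iff.2 (hp' Py)).mono (le_max_left _ _))

/-! ### Means of weakly equivariant functions -/

/-- A bounded measurable function whose value at `x` is determined, with any prescribed precision,
by a sufficiently large patch of `Λ` around `x`. -/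
structure WeaklyEquivariant (Λ : Set (Euc d)) (g : Euc d → ℂ) : Prop where
  measurable : Measurable g
  bounded : ∃ M : ℝ, ∀ x, ‖g x‖ ≤ M
  approx : ∀ ε > 0, ∃ r : ℝ, ∀ x y, Agree r (translate Λ x) (translate Λ y) → ‖g x - g y‖ ≤ ε

/-- Weakly equivariant functions have a mean. -/
lemma IsDelone.exists_hasMean {Λ : Set (Euc d)} (hΛ : IsDelone Λ)
    (hFLC : FiniteLocalComplexity Λ) {F : ℕ → Set (Euc d)} (hF : IsVanHove F)
    (hUCF : UniformClusterFrequencies Λ F) {g : Euc d → ℂ} (hg : WeaklyEquivariant Λ g) :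
    ∃ c, HasMean g c := by
  classical
  obtain ⟨R, hR, hRd⟩ := hΛ.relativelyDense
  obtain ⟨Nmax, hNmax, hNle⟩ := hΛ.exists_ncard_ball_le R
  obtain ⟨M, hM⟩ := hg.bounded
  have hM0 : 0 ≤ M := (norm_nonneg _).trans (hM 0)
  -- the number of points near `x`
  set b : Euc d → ℂ := (Metric.ball (0 : Euc d) R).indicator 1 with hb
  have hbm : Measurable b := measurable_one.indicator measurableSet_ball
  have hb0 : ∀ s, R < ‖s‖ → b s = 0 := fun s hs =>
    indicator_of_notMem (by simpa using hs.le) _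
  have hb1 : ∀ s, ‖b s‖ ≤ 1 := fun s => (norm_indicator_le_norm_self _ _).trans (by simp)
  have hbk : IsKernel (fun _ : Euc d => b) R 1 := ⟨fun _ => hbm, fun _ => hb0, fun _ => hb1⟩
  set N : Euc d → ℂ := kernelSum Λ (fun _ => b) with hN
  have hfinx : ∀ x : Euc d, (Λ ∩ Metric.closedBall x R).Finite := fun x =>
    hΛ.finite_inter Metric.isBounded_closedBall
  have hsub : ∀ x, ↑(hfinx x).toFinset ⊆ Λ := fun x y hy => (by simpa using hy : y ∈ Λ ∧ _).1
  have hNsum : ∀ x, N x = ∑ y ∈ (hfinx x).toFinset, b (x - y) := fun x =>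
    kernelSum_eq_sum (fun _ => hb0) (hsub x) (by simp)
  have hbval : ∀ x y : Euc d, b (x - y) = if y ∈ Metric.ball x R then 1 else 0 := by
    intro x y
    simp only [hb, indicator, mem_ball_iff_norm, sub_zero, Pi.one_apply, norm_sub_rev x y]
  have hNcard : ∀ x, N x = ((Λ ∩ Metric.ball x R).ncard : ℂ) := by
    intro x
    have hfin := hΛ.finite_inter (Metric.isBounded_ball (x := x) (r := R))
    rw [hNsum, Set.ncard_eq_toFinset_card _ hfin]
    simp only [hbval, Finset.sum_boole]
    congr 2
    ext y
    simp only [Finset.mem_filter, Finite.mem_toFinset, mem_inter_iff]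
    exact ⟨fun h => ⟨h.1.1, h.2⟩, fun h => ⟨⟨h.1, Metric.ball_subset_closedBall h.2⟩, h.2⟩⟩
  have hN1 : ∀ x, 1 ≤ ‖N x‖ := by
    intro x
    rw [hNcard, Complex.norm_natCast]
    have hne : (Λ ∩ Metric.ball x R).Nonempty := by
      obtain ⟨z, hz, hz'⟩ := hRd x
      exact ⟨z + x, hz', by simpa [mem_ball_iff_norm] using hz⟩
    have := (Set.ncard_pos (hΛ.finite_inter Metric.isBounded_ball)).2 hne
    exact_mod_cast this
  have hN0 : ∀ x, N x ≠ 0 := fun x h => by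
    have := hN1 x
    rw [h, norm_zero] at this
    linarith
  have hNeq : ∀ x y, Agree R (translate Λ x) (translate Λ y) → N x = N y := by
    have e : ∀ x, N x = ((Metric.ball 0 R ∩ translate Λ x).ncard : ℂ) := by
      intro x
      rw [hNcard, ← Set.ncard_image_of_injective (Metric.ball 0 R ∩ translate Λ x)
        (add_left_injective x)]
      congr 2
      ext z
      simp only [mem_inter_iff, mem_image, mem_translate, mem_ball_iff_norm, sub_zero]
      constructor
      · rintro ⟨h1, h2⟩
        exact ⟨z - x, ⟨h2, by simpa using h1⟩, by simp⟩
      · rintro ⟨w, ⟨h1, h2⟩, rfl⟩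
        exact ⟨h2, by simpa using h1⟩
    intro x y h
    rw [e, e, agree_iff.1 h]
  -- As `N x` counts the points of `Λ` within `R` of `x`, and there is at least one, `g x` is shared
  -- equally among these points: `g x` is the sum of `b (x - y) * g2 x` over `y`.
  set g2 : Euc d → ℂ := fun x => g x / N x with hg2
  have hg2m : Measurable g2 := hg.measurable.div (hbk.measurable_kernelSum hΛ)
  have hg2M : ∀ x, ‖g2 x‖ ≤ M := fun x => by
    rw [hg2, norm_div]
    exact (div_le_self (norm_nonneg _) (hN1 x)).trans (hM x)
  refine exists_hasDensity_of_approx hF fun ε hε => ?_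
  -- At most `Nmax` points contribute at each `x`, each with an error of `ε / Nmax`.
  obtain ⟨r, hr⟩ := hg.approx (ε / Nmax) (by positivity)
  set r' := max r R
  -- a representative of each patch
  set rep : Euc d → Euc d := fun y =>
    if h : ∃ y' ∈ Λ, Metric.ball 0 (r' + R) ∩ translate Λ y' =
      Metric.ball 0 (r' + R) ∩ translate Λ y then h.choose else 0 with hrep
  have hrep1 : ∀ y ∈ Λ, Agree (r' + R) (translate Λ (rep y)) (translate Λ y) := by
    intro y hy
    have h : ∃ y' ∈ Λ, Metric.ball 0 (r' + R) ∩ translate Λ y' =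
      Metric.ball 0 (r' + R) ∩ translate Λ y := ⟨y, hy, rfl⟩
    rw [agree_iff, hrep]
    simp only [dif_pos h]
    exact h.choose_spec.2
  -- The choice in `rep` involves `y` only through its patch as a set, so equal patches yield the
  -- same representative.
  have hrep2 : ∀ y y', Agree (r' + R) (translate Λ y) (translate Λ y') → rep y = rep y' := by
    intro y y' h
    rw [agree_iff] at h
    simp only [hrep, h]
  -- Near `y` the function `g2` is replaced by its values near the representative of the patch of
  -- `y`. The total mass of the kernel then depends on that patch alone and has a density, while the
  -- radius `r' + R` keeps the error small throughout the support of `b`.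
  set k : Euc d → Euc d → ℂ := fun y s => b s * g2 (rep y + s) with hk
  have hkk : IsKernel k R M := by
    refine ⟨fun y => hbm.mul (hg2m.comp (measurable_const_add _)), fun y s hs => ?_, fun y s => ?_⟩
    · simp only [hk, hb0 s hs, zero_mul]
    · rw [hk, norm_mul]
      calc _ ≤ 1 * M := mul_le_mul (hb1 _) (hg2M _) (norm_nonneg _) zero_le_one
        _ = M := one_mul M
  have hloc : PatchLocal Λ (fun y => ∫ s, k y s) :=
    ⟨r' + R, fun y _ y' _ h => by simp only [hk, hrep2 y y' h]⟩
  obtain ⟨c, hc⟩ := hΛ.exists_hasDensity_comb hFLC hF hUCF hloc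
  refine ⟨fun A => ∫ x in A, kernelSum Λ k x, c, hc.congr_boundary (hkk.boundaryClose hΛ hR.le),
    0, 1, le_rfl, one_pos, fun A hA hA' => ?_⟩
  obtain ⟨B, hB⟩ := hkk.norm_kernelSum_le hΛ
  rw [zero_mul, add_zero, ← integral_sub (integrableOn_of_bound hg.measurable hM hA)
    (integrableOn_of_bound (hkk.measurable_kernelSum hΛ) hB hA)]
  refine norm_setIntegral_le_of_norm_le_const hA.measure_lt_top fun x _ => ?_
  have e1 : g x = ∑ y ∈ (hfinx x).toFinset, b (x - y) * g2 x := by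
    rw [← Finset.sum_mul, ← hNsum, hg2, mul_div_cancel₀ _ (hN0 x)]
  rw [e1, kernelSum_eq_sum hkk.supp (hsub x) (by simp), ← Finset.sum_sub_distrib]
  have e2 : ∀ y ∈ (hfinx x).toFinset, ‖b (x - y) * g2 x - k y (x - y)‖ ≤ ε / Nmax := by
    intro y hy
    have hyΛ : y ∈ Λ := hsub x hy
    rw [hk, ← mul_sub, norm_mul]
    by_cases hxy : R ≤ ‖x - y‖
    · rw [hb, indicator_of_notMem (by simpa using hxy), norm_zero, zero_mul]
      positivity
    have h1 : Agree r' (translate Λ x) (translate Λ (rep y + (x - y))) := by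
      have := (hrep1 y hyΛ).symm.translate (t := x - y) (s := r') (by linarith)
      rwa [translate_translate, translate_translate, add_sub_cancel] at this
    have h2 : ‖g2 x - g2 (rep y + (x - y))‖ ≤ ε / Nmax := by
      simp only [hg2]
      rw [← hNeq _ _ (h1.mono (le_max_right _ _)), ← sub_div, norm_div]
      exact (div_le_self (norm_nonneg _) (hN1 x)).trans (hr _ _ (h1.mono (le_max_left _ _)))
    calc _ ≤ 1 * (ε / Nmax) := mul_le_mul (hb1 _) h2 (norm_nonneg _) zero_le_one
      _ = _ := one_mul _
  refine (norm_sum_le _ _).trans ((Finset.sum_le_card_nsmul _ _ _ e2).trans ?_)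
  rw [nsmul_eq_mul, ← Set.ncard_eq_toFinset_card _ (hfinx x)]
  calc _ ≤ Nmax * (ε / Nmax) := mul_le_mul_of_nonneg_right (hNle x) (by positivity)
    _ = ε := by field_simp

/-! ### The invariant measure -/

lemma HasMean.add {g h : Euc d → ℂ} {c c' : ℂ} (hg : HasMean g c) (hh : HasMean h c')
    (hgi : ∀ A, Bornology.IsBounded A → IntegrableOn g A)
    (hhi : ∀ A, Bornology.IsBounded A → IntegrableOn h A) :
    HasMean (fun x => g x + h x) (c + c') :=
  (HasDensity.add hg hh).congr fun A hA _ => integral_add (hgi A hA) (hhi A hA)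

lemma HasMean.const_mul {g : Euc d → ℂ} {c : ℂ} (hg : HasMean g c) (a : ℂ) :
    HasMean (fun x => a * g x) (a * c) :=
  (HasDensity.const_mul hg a).congr fun _ _ _ => integral_const_mul _ _

/-- The mean is translation invariant. -/
lemma HasMean.comp_add_right {g : Euc d → ℂ} {c : ℂ} (hg : HasMean g c) (hgm : Measurable g)
    {M : ℝ} (hM : ∀ x, ‖g x‖ ≤ M) (s : Euc d) : HasMean (fun x => g (x + s)) c := by
  refine HasDensity.congr_boundary hg (BoundaryClose.symm
    ⟨M, ‖s‖ + 1, (norm_nonneg _).trans (hM 0), by positivity, fun A hA hA' => ?_⟩)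
  exact norm_setIntegral_sub_shift_le hgm hM (by linarith) hA hA'

lemma HasMean.const (a : ℂ) : HasMean (fun _ : Euc d => a) a := by
  intro ε hε
  refine ⟨0, 1, le_rfl, one_pos, fun A _ _ => ?_⟩
  beta_reduce
  rw [setIntegral_const, Complex.real_smul, mul_comm, sub_self, norm_zero, zero_mul, add_zero]
  positivity

lemma HasMean.re_nonneg {g : Euc d → ℂ} {c : ℂ} (hg : HasMean g c) {F : ℕ → Set (Euc d)}
    (hF : IsVanHove F) (h0 : ∀ x, ∃ a : ℝ, 0 ≤ a ∧ g x = a) : 0 ≤ c.re := by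
  choose a ha hga using h0
  have ht := (Complex.continuous_re.tendsto c).comp (HasDensity.tendsto hg hF)
  refine ge_of_tendsto' ht fun n => ?_
  simp only [Function.comp_apply, hga]
  rw [integral_complex_ofReal, ← Complex.ofReal_inv, ← Complex.ofReal_mul, Complex.ofReal_re]
  exact mul_nonneg (inv_nonneg.2 (hF.volume_pos n).le) (integral_nonneg ha)

namespace PatternSpace

variable {Λ : Set (Euc d)}

lemma t2Space (hΛ : IsDelone Λ) : T2Space (PatternSpace Λ) := by
  let _ := metric hΛ
  infer_instance

lemma metrizableSpace (hΛ : IsDelone Λ) : TopologicalSpace.MetrizableSpace (PatternSpace Λ) := by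
  let _ := metric hΛ
  infer_instance

/-- Continuous functions on the pattern space restrict to weakly equivariant functions. -/
lemma weaklyEquivariant (hΛ : IsDelone Λ) (hFLC : FiniteLocalComplexity Λ)
    {f : PatternSpace Λ → ℂ} (hf : Continuous f) :
    WeaklyEquivariant Λ (fun t => f (shift t (base Λ))) := by
  let _ := metric hΛ
  have := compactSpace hΛ hFLC
  refine ⟨(hf.comp (continuous_orbit _)).measurable, ?_, fun ε hε => ?_⟩
  · obtain ⟨M, hM⟩ := (isCompact_range hf).isBounded.exists_norm_le
    exact ⟨M, fun x => hM _ ⟨_, rfl⟩⟩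
  -- Two translates of `Λ` that agree up to radius `(δ / 2)⁻¹` are at pattern distance at most `δ /
  -- 2`, so uniform continuity provides the required radius.
  · have huc := CompactSpace.uniformContinuous_of_continuous hf
    obtain ⟨δ, hδ, H⟩ := Metric.uniformContinuous_iff.1 huc ε hε
    refine ⟨(δ / 2)⁻¹, fun x y h => ?_⟩
    rw [← dist_eq_norm]
    refine (H ?_).le
    refine lt_of_le_of_lt (?_ : patternDist _ _ ≤ δ / 2) (half_lt_self hδ)
    exact patternDist_le_of_agree (u := 0) (by positivity) (by simpa using hδ)
      (by rw [translate_zero]; exact h)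

/-- The integral of a continuous function against an invariant probability measure is the mean of
its restriction to the orbit of `Λ`. -/
lemma integral_eq_mean (hΛ : IsDelone Λ) (hFLC : FiniteLocalComplexity Λ)
    {F : ℕ → Set (Euc d)} (hF : IsVanHove F) {ν : Measure (PatternSpace Λ)}
    (hν : IsInvariantProbability ν) {f : PatternSpace Λ → ℂ} (hf : Continuous f) {c : ℂ}
    (hc : HasMean (fun t => f (shift t (base Λ))) c) : ∫ S, f S ∂ν = c := by
  let _ := metric hΛ
  have := compactSpace hΛ hFLC
  have := hν.1
  obtain ⟨M, hM⟩ := (isCompact_range hf).isBounded.exists_norm_le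
  have hM' : ∀ S, ‖f S‖ ≤ M := fun S => hM _ ⟨_, rfl⟩
  have huc : Continuous (fun p : PatternSpace Λ × Euc d => f (shift p.2 p.1)) :=
    hf.comp (continuous_shift_uncurry.comp continuous_swap)
  rw [← sub_eq_zero, ← norm_le_zero_iff]
  refine le_of_forall_pos_le_add fun ε hε => ?_
  rw [zero_add]
  obtain ⟨n, hn⟩ := (Metric.tendstoUniformly_iff.1
    (HasDensity.tendstoUniformly hc hF) ε hε).exists
  have hv := hF.volume_pos n
  have hB : IsFiniteMeasure (volume.restrict (F n)) :=
    ⟨by simpa using (hF.bounded n).measure_lt_top⟩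
  have hv' : ((volume.real (F n) : ℝ) : ℂ) ≠ 0 := by exact_mod_cast hv.ne'
  -- `I S` is the integral over a piece of the orbit of `S`. After division by the volume it is
  -- within `ε` of `c` on the orbit of `Λ`, by uniformity in the translate, and hence everywhere by
  -- continuity and density. By Fubini and invariance its integral against `ν` is the volume times
  -- the integral of `f`.
  set I : PatternSpace Λ → ℂ := fun S => ∫ x in F n, f (shift x S) with hI
  have hIc : Continuous I := by
    refine continuous_of_dominated (bound := fun _ => M) (fun S => ?_) (fun S => ?_)
      (integrable_const M) ?_
    · exact (hf.comp (continuous_orbit S)).aestronglyMeasurable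
    · exact ae_of_all _ fun x => hM' _
    · exact ae_of_all _ fun x => hf.comp (continuous_shift x)
  have hbound : ∀ S, ‖((volume.real (F n) : ℝ) : ℂ)⁻¹ * I S - c‖ ≤ ε := by
    have hclosed : IsClosed {S | ‖((volume.real (F n) : ℝ) : ℂ)⁻¹ * I S - c‖ ≤ ε} :=
      isClosed_le (by fun_prop) continuous_const
    refine fun S => (denseRange_orbit (Λ := Λ)).induction_on (p := fun S =>
      ‖((volume.real (F n) : ℝ) : ℂ)⁻¹ * I S - c‖ ≤ ε) S hclosed fun t => ?_
    have h1 := (hn (-t)).le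
    rw [dist_eq_norm, norm_sub_rev] at h1
    have e : I (shift t (base Λ)) = ∫ x in translate (F n) (-t), f (shift x (base Λ)) := by
      rw [← setIntegral_comp_add_right _ (hF.measurable n) t, hI]
      simp only [shift_shift, add_comm t]
    rwa [e]
  have hprod : Integrable (Function.uncurry fun (S : PatternSpace Λ) (x : Euc d) => f (shift x S))
      (ν.prod (volume.restrict (F n))) :=
    Integrable.of_bound huc.measurable.aestronglyMeasurable M (ae_of_all _ fun p => hM' _)
  have e1 : ∫ S, I S ∂ν = volume.real (F n) * ∫ S, f S ∂ν := by
    rw [hI, integral_integral_swap hprod]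
    have : ∀ x : Euc d, ∫ S, f (shift x S) ∂ν = ∫ S, f S ∂ν := by
      intro x
      conv_rhs => rw [← hν.2 x]
      exact (integral_map (continuous_shift x).measurable.aemeasurable
        hf.aestronglyMeasurable).symm
    simp only [this]
    rw [setIntegral_const, Complex.real_smul]
  have hIint : Integrable I ν := hprod.integral_prod_left
  have e2 : (∫ S, f S ∂ν) - c = ∫ S, (((volume.real (F n) : ℝ) : ℂ)⁻¹ * I S - c) ∂ν := by
    rw [integral_sub (hIint.const_mul _) (integrable_const _), integral_const_mul, e1,
      inv_mul_cancel_left₀ hv']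
    simp
  rw [e2]
  simpa using norm_integral_le_of_norm_le_const (μ := ν) (ae_of_all _ hbound)

/-- Existence of an invariant probability measure. -/
lemma exists_isInvariantProbability (hΛ : IsDelone Λ) (hFLC : FiniteLocalComplexity Λ)
    {F : ℕ → Set (Euc d)} (hF : IsVanHove F)
    (hmean : ∀ g, WeaklyEquivariant Λ g → ∃ c, HasMean g c) :
    ∃ μ : Measure (PatternSpace Λ), IsInvariantProbability μ := by
  have hcpt := compactSpace hΛ hFLC
  have ht2 := t2Space hΛ
  have hmetr := metrizableSpace hΛ
  have hcont : ∀ f : C(PatternSpace Λ, ℝ), Continuous (fun S => (f S : ℂ)) := fun f =>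
    Complex.continuous_ofReal.comp f.continuous
  have hweak := fun f : C(PatternSpace Λ, ℝ) => weaklyEquivariant hΛ hFLC (hcont f)
  choose m hm using fun f : C(PatternSpace Λ, ℝ) => hmean _ (hweak f)
  have hint : ∀ f : C(PatternSpace Λ, ℝ), ∀ A : Set (Euc d), Bornology.IsBounded A →
      IntegrableOn (fun t => (f (shift t (base Λ)) : ℂ)) A := fun f A hA =>
    integrableOn_of_bound (hweak f).measurable (hweak f).bounded.choose_spec hA
  have hadd : ∀ f g, m (f + g) = m f + m g := by
    intro f g
    refine HasDensity.unique (hm (f + g)) ?_ hF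
    have := (hm f).add (hm g) (hint f) (hint g)
    simpa [HasMean] using this
  have hsmul : ∀ (a : ℝ) f, m (a • f) = a * m f := by
    intro a f
    refine HasDensity.unique (hm (a • f)) ?_ hF
    have := (hm f).const_mul a
    simpa [HasMean] using this
  have hone : m 1 = 1 := by
    refine HasDensity.unique (hm 1) ?_ hF
    simpa [HasMean] using HasMean.const (d := d) 1
  -- The mean is linear by uniqueness of densities, and it is positive. On a compact space all
  -- continuous functions are compactly supported, so Riesz representation applies; total mass one
  -- is the mean of the constant one.
  let L : CompactlySupportedContinuousMap (PatternSpace Λ) ℝ →ₚ[ℝ] ℝ := PositiveLinearMap.mk₀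
    { toFun := fun f => (m f.toContinuousMap).re
      map_add' := fun f g => by
        rw [← Complex.add_re, ← hadd]; rfl
      map_smul' := fun a f => by
        simp only [RingHom.id_apply, smul_eq_mul]
        rw [← Complex.re_ofReal_mul, ← hsmul]; rfl }
    (fun f hf => (hm f.toContinuousMap).re_nonneg hF fun x => ⟨_, hf (shift x (base Λ)), rfl⟩)
  set μ := RealRMK.rieszMeasure L with hμ
  have hμint : ∀ f : C(PatternSpace Λ, ℝ), ∫ S, f S ∂μ = (m f).re := fun f =>
    RealRMK.integral_rieszMeasure L (CompactlySupportedContinuousMap.continuousMapEquiv f)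
  have hfin : IsFiniteMeasure μ := ⟨isCompact_univ.measure_lt_top⟩
  have hprob : IsProbabilityMeasure μ := by
    refine ⟨?_⟩
    have := hμint 1
    rw [hone] at this
    simp only [ContinuousMap.one_apply, integral_const, smul_eq_mul, mul_one,
      Complex.one_re] at this
    rw [measureReal_def, ENNReal.toReal_eq_one_iff] at this
    exact this
  refine ⟨μ, hprob, fun t => ?_⟩
  have hmeas := (continuous_shift (Λ := Λ) t).measurable
  have : IsProbabilityMeasure (μ.map (shift t)) :=
    Measure.isProbabilityMeasure_map hmeas.aemeasurable
  refine ext_of_forall_integral_eq_of_IsFiniteMeasure fun f => ?_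
  rw [integral_map hmeas.aemeasurable f.continuous.aestronglyMeasurable]
  have h1 := hμint f.toContinuousMap
  have h2 := hμint (f.toContinuousMap.comp ⟨shift t, continuous_shift t⟩)
  refine h2.trans (Eq.trans ?_ h1.symm)
  congr 1
  -- Invariance of the measure is translation invariance of the mean.
  refine HasDensity.unique (hm _) ?_ hF
  obtain ⟨M, hM⟩ := (hweak f.toContinuousMap).bounded
  have := (hm f.toContinuousMap).comp_add_right (hweak f.toContinuousMap).measurable hM t
  simpa [HasMean, shift_shift] using this

/-- Unique ergodicity. -/
lemma existsUnique_isInvariantProbability (hΛ : IsDelone Λ) (hFLC : FiniteLocalComplexity Λ)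
    {F : ℕ → Set (Euc d)} (hF : IsVanHove F)
    (hmean : ∀ g, WeaklyEquivariant Λ g → ∃ c, HasMean g c) :
    ∃! μ : Measure (PatternSpace Λ), IsInvariantProbability μ := by
  obtain ⟨μ, hμ⟩ := exists_isInvariantProbability hΛ hFLC hF hmean
  refine ⟨μ, hμ, fun ν hν => ?_⟩
  have hmetr := metrizableSpace hΛ
  have := hμ.1
  have := hν.1
  refine ext_of_forall_integral_eq_of_IsFiniteMeasure fun f => ?_
  have hc : Continuous (fun S => (f S : ℂ)) := Complex.continuous_ofReal.comp f.continuous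
  obtain ⟨c, hc'⟩ := hmean _ (weaklyEquivariant hΛ hFLC hc)
  have h1 := integral_eq_mean hΛ hFLC hF hμ hc hc'
  have h2 := integral_eq_mean hΛ hFLC hF hν hc hc'
  rw [← h1, integral_complex_ofReal, integral_complex_ofReal] at h2
  exact_mod_cast h2

end PatternSpace

/-! ### Smooth equivariant functions -/

lemma IsEquivariant.exists_agree {V : Type*} {Λ : Set (Euc d)} {f : Euc d → V}
    (hf : IsEquivariant Λ f) :
    ∃ r : ℝ, 0 < r ∧ ∀ x y, Agree r (translate Λ x) (translate Λ y) → f x = f y := by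
  obtain ⟨r, hr, H⟩ := hf
  exact ⟨r, hr, fun x y h => H x y (agree_iff.1 h)⟩

lemma isEquivariant_of_agree {V : Type*} {Λ : Set (Euc d)} {f : Euc d → V} {r : ℝ}
    (h : ∀ x y, Agree r (translate Λ x) (translate Λ y) → f x = f y) : IsEquivariant Λ f :=
  ⟨max r 1, by positivity, fun x y e => h x y ((agree_iff.2 e).mono (le_max_left _ _))⟩

/-- A smooth equivariant function extends to the pattern space. -/
lemma IsEquivariant.exists_isExtension {Λ : Set (Euc d)} {g : Euc d → ℂ}
    (hg : IsEquivariant Λ g) (hs : ContDiff ℝ ∞ g) :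
    ∃ f : PatternSpace Λ → ℂ, PatternSpace.IsExtension g f := by
  obtain ⟨r, hr, H⟩ := hg.exists_agree
  -- The extension takes at `S` the value of `g` at any `t` at which `Λ` looks like `S` up to radius
  -- `r`; `key` says that the choice of `t` does not matter.
  choose p hp using fun S : PatternSpace Λ => S.exists_agree r
  have key : ∀ (S : PatternSpace Λ) t, Agree r S.1 (translate Λ t) → g (p S) = g t :=
    fun S t h => H _ _ ((hp S).symm.trans h)
  refine ⟨fun S => g (p S), ?_, ?_, ?_, ?_⟩
  · rw [continuous_iff_continuousAt]
    intro S U hU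
    obtain ⟨t, ht⟩ := S.exists_agree (r + 1)
    replace hU : U ∈ 𝓝 (g (p S)) := hU
    rw [key S t (ht.mono (by linarith))] at hU
    have hct : Tendsto (fun u => g (t - u)) (𝓝 0) (𝓝 (g t)) := by
      have : Continuous (fun u => g (t - u)) := hs.continuous.comp (by fun_prop)
      simpa using this.tendsto 0
    obtain ⟨δ, hδ, hδU⟩ := Metric.mem_nhds_iff.1 (hct hU)
    obtain ⟨ε, hε, K⟩ := exists_pos_forall_agree (d := d) (r + 1) (min δ 1) (by positivity)
    rw [mem_map]
    refine PatternSpace.mem_nhds_iff'.2 ⟨ε, hε, fun T hT => ?_⟩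
    obtain ⟨u, hu, ha⟩ := K S.1 T.1 hT
    -- A pattern `T` close to `S` looks like `Λ` seen from `t - u` with `u` small, so continuity at
    -- `S` follows from continuity of `g` at `t`.
    have h1 : Agree r T.1 (translate Λ (t - u)) := by
      have := (ha.symm.trans ht).translate (t := -u) (s := r)
        (by rw [norm_neg]; linarith [min_le_right δ 1])
      rwa [translate_translate, translate_translate, add_neg_cancel, translate_zero,
        ← sub_eq_add_neg] at this
    rw [mem_preimage, key T _ h1]
    exact hδU (by simpa using hu.trans_le (min_le_left _ _))
  · intro S
    refine ⟨r⁻¹, inv_pos.2 hr, fun T hT => ?_⟩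
    rw [inv_inv, ← agree_iff] at hT
    exact key T _ (hT.trans (hp S))
  · intro S
    rw [contDiff_iff_contDiffAt]
    intro s₀
    obtain ⟨t, ht⟩ := S.exists_agree (r + (‖s₀‖ + 1))
    have hsm : ContDiffAt ℝ ∞ (fun s => g (t + s)) s₀ :=
      (hs.comp (contDiff_const.add contDiff_id)).contDiffAt
    refine hsm.congr_of_eventuallyEq ?_
    filter_upwards [Metric.ball_mem_nhds s₀ one_pos] with s hs
    refine key _ _ ?_
    rw [mem_ball_iff_norm] at hs
    have h1 : ‖s‖ ≤ ‖s₀‖ + ‖s - s₀‖ := by simpa using norm_add_le s₀ (s - s₀)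
    have := ht.translate (t := s) (s := r) (by linarith)
    rwa [translate_translate] at this
  · intro t
    exact key _ _ (Agree.refl _ _)

/-- The detour through the extension gives boundedness, by compactness of the pattern space. -/
lemma IsEquivariant.weaklyEquivariant {Λ : Set (Euc d)} (hΛ : IsDelone Λ)
    (hFLC : FiniteLocalComplexity Λ) {g : Euc d → ℂ}
    (hg : IsEquivariant Λ g) (hs : ContDiff ℝ ∞ g) : WeaklyEquivariant Λ g := by
  obtain ⟨f, hf⟩ := hg.exists_isExtension hs
  have := PatternSpace.weaklyEquivariant hΛ hFLC hf.continuous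
  simpa only [hf.apply_orbit] using this

/-- A patch of radius `r + 1` determines `g` on a unit ball around its centre, hence also the
derivative there. -/
lemma IsEquivariant.fderiv {Λ : Set (Euc d)} {g : Euc d → ℂ} (hg : IsEquivariant Λ g) :
    IsEquivariant Λ (fderiv ℝ g) := by
  obtain ⟨r, hr, H⟩ := hg.exists_agree
  refine isEquivariant_of_agree (r := r + 1) fun x y h => ?_
  have key : (fun s => g (x + s)) =ᶠ[𝓝 0] (fun s => g (y + s)) := by
    filter_upwards [Metric.ball_mem_nhds (0 : Euc d) one_pos] with s hs
    apply H
    rw [mem_ball_zero_iff] at hs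
    have := h.translate (t := s) (s := r) (by linarith)
    rwa [translate_translate, translate_translate] at this
  have e := key.fderiv_eq (𝕜 := ℝ)
  rwa [fderiv_comp_add_left, fderiv_comp_add_left, add_zero, add_zero] at e

lemma IsEquivariant.comp {V W : Type*} {Λ : Set (Euc d)} {g : Euc d → V}
    (hg : IsEquivariant Λ g) (φ : V → W) : IsEquivariant Λ (fun x => φ (g x)) := by
  obtain ⟨r, hr, H⟩ := hg
  exact ⟨r, hr, fun x y h => congrArg φ (H x y h)⟩

lemma ContDiff.fderiv_apply_const {g : Euc d → ℂ} (hs : ContDiff ℝ ∞ g) (v : Euc d) :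
    ContDiff ℝ ∞ (fun x => fderiv ℝ g x v) :=
  (hs.fderiv_right (m := ∞) (by simp)).clm_apply contDiff_const

/-- Taylor's formula of order one in a fixed direction. -/
lemma norm_sub_sub_fderiv_le {h : Euc d → ℂ} (hs : ContDiff ℝ ∞ h) {v : Euc d} {M : ℝ}
    (hM : ∀ y, ‖fderiv ℝ (fun x => fderiv ℝ h x v) y v‖ ≤ M) (x : Euc d) {s : ℝ} (hs0 : 0 ≤ s) :
    ‖h (x + s • v) - h x - s * fderiv ℝ h x v‖ ≤ M * s ^ 2 := by
  have hM0 : 0 ≤ M := (norm_nonneg _).trans (hM 0)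
  have hline : ∀ (q : Euc d → ℂ), ContDiff ℝ ∞ q → ∀ u : ℝ,
      HasDerivAt (fun u : ℝ => q (x + u • v)) (fderiv ℝ q (x + u • v) v) u := by
    intro q hq u
    have h1 : HasDerivAt (fun u : ℝ => x + u • v) v u := by
      simpa using ((hasDerivAt_id u).smul_const v).const_add x
    exact ((hq.differentiable (by simp) _).hasFDerivAt).comp_hasDerivAt u h1
  have hp := ContDiff.fderiv_apply_const hs v
  -- The mean value inequality is used twice, first for the directional derivative and then for the
  -- remainder. This gives the constant `M` in place of `M / 2`.
  have h1 : ∀ u ∈ Icc (0 : ℝ) s, ‖fderiv ℝ h (x + u • v) v - fderiv ℝ h x v‖ ≤ M * s := by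
    intro u hu
    have := (convex_univ (𝕜 := ℝ) (E := ℝ)).norm_image_sub_le_of_norm_hasDerivWithin_le
      (fun w _ => (hline _ hp w).hasDerivWithinAt) (fun w _ => hM _) (mem_univ 0) (mem_univ u)
    simp only [zero_smul, add_zero, sub_zero] at this
    refine this.trans (mul_le_mul_of_nonneg_left ?_ hM0)
    rw [Real.norm_of_nonneg hu.1]
    exact hu.2
  have h2 : ∀ u ∈ Icc (0 : ℝ) s,
      HasDerivWithinAt (fun u : ℝ => h (x + u • v) - u * fderiv ℝ h x v)
        (fderiv ℝ h (x + u • v) v - fderiv ℝ h x v) (Icc 0 s) u := by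
    intro u _
    have : HasDerivAt (fun u : ℝ => h (x + u • v) - u * fderiv ℝ h x v)
        (fderiv ℝ h (x + u • v) v - Complex.ofRealCLM 1 * fderiv ℝ h x v) u :=
      (hline h hs u).sub ((Complex.ofRealCLM.hasDerivAt (x := u)).mul_const (fderiv ℝ h x v))
    simpa using this.hasDerivWithinAt
  have h3 := (convex_Icc (0 : ℝ) s).norm_image_sub_le_of_norm_hasDerivWithin_le h2 h1
    (left_mem_Icc.2 hs0) (right_mem_Icc.2 hs0)
  simp only [zero_smul, add_zero, sub_zero, Complex.ofReal_zero, zero_mul] at h3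
  rw [Real.norm_of_nonneg hs0] at h3
  rw [show h (x + s • v) - h x - s * fderiv ℝ h x v =
    h (x + s • v) - s * fderiv ℝ h x v - h x by ring]
  exact h3.trans (le_of_eq (by ring))

/-- Directional derivatives of smooth equivariant functions have mean zero. -/
lemma hasMean_fderiv {Λ : Set (Euc d)} (hΛ : IsDelone Λ)
    (hFLC : FiniteLocalComplexity Λ) {h : Euc d → ℂ}
    (hh : IsEquivariant Λ h) (hs : ContDiff ℝ ∞ h) (v : Euc d) :
    HasMean (fun x => fderiv ℝ h x v) 0 := by
  have hp := ContDiff.fderiv_apply_const hs v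
  have hpe : IsEquivariant Λ (fun x => fderiv ℝ h x v) := hh.fderiv.comp (fun L => L v)
  obtain ⟨M, hM⟩ := ((hpe.fderiv.comp (fun L => L v)).weaklyEquivariant hΛ hFLC
    (ContDiff.fderiv_apply_const hp v)).bounded
  obtain ⟨B, hB⟩ := (hh.weaklyEquivariant hΛ hFLC hs).bounded
  have hhm : Measurable h := hs.continuous.measurable
  refine HasDensity.approx fun ε hε => ?_
  have hM0 : 0 ≤ M := (norm_nonneg _).trans (hM 0)
  -- By Taylor the difference quotient with step `s` differs from the derivative by at most `M * s ≤
  -- ε`, uniformly. Its own mean is zero, since a shift changes integrals by boundary terms only.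
  set s : ℝ := ε / (M + 1) with hsdef
  have hs0 : 0 < s := by positivity
  have hsne : (s : ℂ) ≠ 0 := by exact_mod_cast hs0.ne'
  set q : Euc d → ℂ := fun x => (s : ℂ)⁻¹ * (h (x + s • v) - h x) with hq
  have hi1 : ∀ A, Bornology.IsBounded A → IntegrableOn (fun x => h (x + s • v)) A :=
    fun A hA => integrableOn_of_bound (hhm.comp (measurable_add_const _)) (fun _ => hB _) hA
  have hi2 : ∀ A, Bornology.IsBounded A → IntegrableOn h A :=
    fun A hA => integrableOn_of_bound hhm hB hA
  refine ⟨fun A => ∫ x in A, q x, 0, ?_, by simpa using hε.le, 0, 1, le_rfl, one_pos,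
    fun A hA hA' => ?_⟩
  · have : HasDensity (fun A => (s : ℂ)⁻¹ * ((∫ x in A, h (x + s • v)) - ∫ x in A, h x)) 0 := by
      have h0 : HasDensity (fun A => (∫ x in A, h (x + s • v)) - ∫ x in A, h x) 0 := by
        refine HasDensity.congr_boundary HasDensity.zero
          ⟨B, ‖s • v‖ + 1, (norm_nonneg _).trans (hB 0), by positivity, fun A hA hA' => ?_⟩
        rw [sub_zero, norm_sub_rev]
        exact norm_setIntegral_sub_shift_le hhm hB (by linarith) hA hA'
      simpa using h0.const_mul (s : ℂ)⁻¹
    refine this.congr fun A hA _ => ?_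
    rw [← integral_sub (hi1 A hA) (hi2 A hA), ← integral_const_mul]
  · rw [zero_mul, add_zero, ← integral_sub]
    · refine norm_setIntegral_le_of_norm_le_const hA.measure_lt_top fun x _ => ?_
      have h1 := norm_sub_sub_fderiv_le hs hM x hs0.le
      have e : fderiv ℝ h x v - q x = -((s : ℂ)⁻¹ * (h (x + s • v) - h x - s * fderiv ℝ h x v)) := by
        rw [hq]
        field_simp
        ring
      rw [e, norm_neg, norm_mul, norm_inv, Complex.norm_real, Real.norm_of_nonneg hs0.le]
      calc _ ≤ s⁻¹ * (M * s ^ 2) := by gcongr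
        _ = M * s := by field_simp
        _ ≤ ε := by
          rw [hsdef, mul_div_assoc', div_le_iff₀ (by positivity)]
          nlinarith
    · obtain ⟨B', hB'⟩ := (hpe.weaklyEquivariant hΛ hFLC hp).bounded
      exact integrableOn_of_bound hp.continuous.measurable hB' hA
    · exact ((hi1 A hA).sub (hi2 A hA)).const_mul _

/-! ### Top-degree forms -/

/-- The volume form `dx₁ ∧ ⋯ ∧ dx_d`, with complex values. -/
noncomputable def volForm (d : ℕ) : Euc d [⋀^Fin d]→L[ℝ] ℂ :=
  Complex.ofRealCLM.compContinuousAlternatingMap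
    { toContinuousMultilinearMap :=
        { toMultilinearMap := (EuclideanSpace.basisFun (Fin d) ℝ).toBasis.det.toMultilinearMap
          cont := by
            change Continuous (fun v => (EuclideanSpace.basisFun (Fin d) ℝ).toBasis.det v)
            simp only [Module.Basis.det_apply]
            refine Continuous.matrix_det (continuous_matrix fun i j => ?_)
            simp only [Module.Basis.toMatrix_apply, OrthonormalBasis.coe_toBasis_repr_apply,
              EuclideanSpace.basisFun_repr]
            fun_prop }
      map_eq_zero_of_eq' :=
        (EuclideanSpace.basisFun (Fin d) ℝ).toBasis.det.map_eq_zero_of_eq' }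

/-- The standard frame. -/
noncomputable def frame (d : ℕ) (i : Fin d) : Euc d := EuclideanSpace.single i (1 : ℝ)

lemma frame_eq : frame d = (EuclideanSpace.basisFun (Fin d) ℝ).toBasis := by
  funext i
  simp [frame]

lemma volForm_frame : volForm d (frame d) = 1 := by
  have : (EuclideanSpace.basisFun (Fin d) ℝ).toBasis.det (frame d) = 1 := by
    rw [frame_eq]; exact Module.Basis.det_self _
  change ((((EuclideanSpace.basisFun (Fin d) ℝ).toBasis.det (frame d) : ℝ)) : ℂ) = 1
  rw [this, Complex.ofReal_one]

/-- An alternating form is determined by its values on injective families of basis vectors. For `d`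
vectors out of `d` these are permutations of the frame, and both forms pick up the same sign. -/
lemma alternating_ext {α β : Euc d [⋀^Fin d]→L[ℝ] ℂ} (h : α (frame d) = β (frame d)) :
    α = β := by
  apply ContinuousAlternatingMap.toAlternatingMap_injective
  refine (EuclideanSpace.basisFun (Fin d) ℝ).toBasis.ext_alternating fun v hv => ?_
  have hbij : Function.Bijective v := Finite.injective_iff_bijective.1 hv
  have e : (fun i => (EuclideanSpace.basisFun (Fin d) ℝ).toBasis (v i)) =
      frame d ∘ Equiv.ofBijective v hbij := by
    rw [frame_eq]; rfl
  rw [e, AlternatingMap.map_perm, AlternatingMap.map_perm]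
  congr 1

lemma alternating_eq_zero (α : Euc d [⋀^Fin (d + 1)]→L[ℝ] ℂ) : α = 0 := by
  ext v
  refine α.toAlternatingMap.map_linearDependent v fun hv => ?_
  have := hv.fintype_card_le_finrank
  simp at this

/-- The top-degree form with given Hodge star. -/
noncomputable def ofStar {Λ : Set (Euc d)} (g : Euc d → ℂ) (hg : IsEquivariant Λ g)
    (hs : ContDiff ℝ ∞ g) : Forms Λ d :=
  ⟨fun x => g x • volForm d, hs.smul contDiff_const, hg.comp (fun c => c • volForm d)⟩

lemma hodgeStar_ofStar {Λ : Set (Euc d)} (g : Euc d → ℂ) (hg : IsEquivariant Λ g)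
    (hs : ContDiff ℝ ∞ g) : hodgeStar (ofStar g hg hs) = g := by
  funext x
  change g x • volForm d (frame d) = g x
  rw [volForm_frame, smul_eq_mul, mul_one]

lemma forms_ext {Λ : Set (Euc d)} {η θ : Forms Λ d} (h : hodgeStar η = hodgeStar θ) : η = θ := by
  apply Subtype.ext
  funext x
  exact alternating_ext (congrFun h x)

lemma isEquivariant_hodgeStar {Λ : Set (Euc d)} (η : Forms Λ d) :
    IsEquivariant Λ (hodgeStar η) :=
  IsEquivariant.comp η.2.2 (fun α => α (frame d))

lemma contDiff_hodgeStar {Λ : Set (Euc d)} (η : Forms Λ d) : ContDiff ℝ ∞ (hodgeStar η) :=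
  (ContinuousAlternatingMap.apply ℝ (Euc d) ℂ (frame d)).contDiff.comp η.2.1

lemma cocycles_eq_top (Λ : Set (Euc d)) : cocycles Λ d = ⊤ := by
  refine eq_top_iff.2 fun η _ => LinearMap.mem_ker.2 (Subtype.ext (funext fun x => ?_))
  exact alternating_eq_zero _

lemma hodgeStar_exteriorD {k : ℕ} {Λ : Set (Euc (k + 1))} (β : Forms Λ k) (x : Euc (k + 1)) :
    hodgeStar (exteriorD Λ k β) x =
      ∑ i, (-1) ^ i.val • fderiv ℝ (fun y => β.1 y (i.removeNth (frame (k + 1)))) x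
        (frame (k + 1) i) :=
  extDeriv_apply (β.2.1.differentiable (by simp) x) (frame (k + 1))

/-- The Hodge star of an exact form has mean zero. -/
lemma hasMean_hodgeStar_exact {Λ : Set (Euc d)} (hΛ : IsDelone Λ)
    (hFLC : FiniteLocalComplexity Λ) {η : Forms Λ d} (hη : η ∈ coboundaries Λ d) :
    HasMean (hodgeStar η) 0 := by
  cases d with
  | zero =>
    have : η = 0 := hη
    rw [this]
    exact HasMean.const 0
  | succ k =>
    obtain ⟨β, rfl⟩ := hη
    have hc : ∀ i : Fin (k + 1),
        ContDiff ℝ ∞ (fun y => β.1 y (i.removeNth (frame (k + 1)))) := fun i =>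
      (ContinuousAlternatingMap.apply ℝ (Euc (k + 1)) ℂ
        (i.removeNth (frame (k + 1)))).contDiff.comp β.2.1
    have he : ∀ i : Fin (k + 1),
        IsEquivariant Λ (fun y => β.1 y (i.removeNth (frame (k + 1)))) := fun i =>
      IsEquivariant.comp β.2.2 (fun α => α (i.removeNth (frame (k + 1))))
    have hm := fun i : Fin (k + 1) => (hasMean_fderiv hΛ hFLC (he i) (hc i)
      (frame (k + 1) i)).const_mul ((-1) ^ i.val)
    have hsum := HasDensity.sum (s := Finset.univ) fun i _ => hm i
    simp only [mul_zero, Finset.sum_const_zero] at hsum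
    refine HasDensity.congr hsum fun A hA _ => ?_
    rw [← integral_finsetSum]
    · simp only [hodgeStar_exteriorD, ← Int.cast_smul_eq_zsmul ℂ, smul_eq_mul, Int.cast_pow,
        Int.cast_neg, Int.cast_one]
    · intro i _
      refine Integrable.const_mul ?_ _
      obtain ⟨B, hB⟩ := (((he i).fderiv.comp (fun L => L (frame (k + 1) i))).weaklyEquivariant
        hΛ hFLC (ContDiff.fderiv_apply_const (hc i) _)).bounded
      exact integrableOn_of_bound (ContDiff.fderiv_apply_const (hc i) _).continuous.measurable hB hA

/-- The form whose Hodge star is the divergence of a smooth equivariant vector field is exact. -/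
lemma ofStar_div_mem_coboundaries {Λ : Set (Euc d)} (hd : d ≠ 0) (V : Fin d → Euc d → ℂ)
    (hV : ∀ i, IsEquivariant Λ (V i)) (hVs : ∀ i, ContDiff ℝ ∞ (V i)) {η : Forms Λ d}
    (hη : ∀ x, hodgeStar η x = ∑ i, fderiv ℝ (V i) x (frame d i)) : η ∈ coboundaries Λ d := by
  obtain ⟨k, rfl⟩ := Nat.exists_eq_succ_of_ne_zero hd
  -- The primitive is the contraction of the volume form with the field, so `τ i` is the contraction
  -- with the `i`-th basis vector. On the frame without its `j`-th vector it equals `(-1) ^ j` if `i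
  -- = j` and zero otherwise, and these signs cancel those of the exterior derivative.
  set τ : Fin (k + 1) → Euc (k + 1) [⋀^Fin k]→L[ℝ] ℂ := fun i =>
    (volForm (k + 1)).curryLeft (frame (k + 1) i) with hτ
  have hτval : ∀ i j : Fin (k + 1), τ i (j.removeNth (frame (k + 1))) =
      if i = j then (-1) ^ (j : ℕ) else 0 := by
    intro i j
    have h1 := (volForm (k + 1)).toAlternatingMap.map_insertNth j (frame (k + 1) i)
      (j.removeNth (frame (k + 1)))
    have h2 : τ i (j.removeNth (frame (k + 1))) = (-1) ^ (j : ℕ) •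
        (volForm (k + 1)).toAlternatingMap
          (j.insertNth (frame (k + 1) i) (j.removeNth (frame (k + 1)))) := by
      rw [h1, smul_smul, ← pow_add, Even.neg_one_pow ⟨_, rfl⟩, one_smul]
      rfl
    rw [h2]
    split_ifs with h
    · subst h
      rw [Fin.insertNth_self_removeNth]
      change _ • volForm (k + 1) (frame (k + 1)) = _
      rw [volForm_frame]
      simp [← Int.cast_smul_eq_zsmul ℂ]
    · obtain ⟨l, hl⟩ := Fin.exists_succAbove_eq h
      rw [AlternatingMap.map_eq_zero_of_eq _ _ (i := j) (j := i), smul_zero]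
      · rw [Fin.insertNth_apply_same, ← hl, Fin.insertNth_apply_succAbove]
        rfl
      · exact fun e => h e.symm
  have hmem : (fun x => ∑ i, V i x • τ i) ∈ Forms Λ k := by
    have : (fun x => ∑ i, V i x • τ i) = ∑ i, fun x => V i x • τ i := by
      funext x; simp
    rw [this]
    exact Submodule.sum_mem _ fun i _ =>
      ⟨(hVs i).smul contDiff_const, (hV i).comp (fun c => c • τ i)⟩
  refine ⟨⟨_, hmem⟩, forms_ext ?_⟩
  funext x
  rw [hodgeStar_exteriorD, hη]
  refine Finset.sum_congr rfl fun j _ => ?_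
  have e : (fun y => (∑ i, V i y • τ i) (j.removeNth (frame (k + 1)))) =
      fun y => (-1) ^ (j : ℕ) * V j y := by
    funext y
    simp only [ContinuousAlternatingMap.sum_apply, ContinuousAlternatingMap.smul_apply, hτval,
      smul_eq_mul, mul_ite, mul_zero, Finset.sum_ite_eq', Finset.mem_univ, if_true]
    exact mul_comm _ _
  change _ • fderiv ℝ (fun y => (∑ i, V i y • τ i) (j.removeNth (frame (k + 1)))) x _ = _
  rw [e, fderiv_const_mul ((hVs j).differentiable (by simp) x)]
  simp only [← Int.cast_smul_eq_zsmul ℂ, smul_eq_mul, Int.cast_pow,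
    Int.cast_neg, Int.cast_one, smul_apply]
  rw [← mul_assoc, ← pow_add, Even.neg_one_pow ⟨_, rfl⟩, one_mul]

/-! ### The compactly supported Poincaré lemma in top degree -/

section Poincare

variable {X : Type*} [MeasurableSpace X] {ν : Measure X} {h : X → ℝ} {L : X → Euc d}

lemma HasCompactSupport.exists_bound_support {F : Type*} [NormedAddCommGroup F] {χ : Euc d → F}
    (hχ : HasCompactSupport χ) : ∃ R : ℝ, 0 < R ∧ ∀ s, R < ‖s‖ → χ s = 0 := by
  obtain ⟨R, hR, H⟩ := hχ.isCompact.isBounded.exists_pos_norm_le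
  refine ⟨R, hR, fun s hs => ?_⟩
  by_contra hne
  exact absurd (H s (subset_tsupport _ hne)) (not_le.2 hs)

lemma integrable_translates {F : Type*} [NormedAddCommGroup F] [NormedSpace ℝ F]
    (hh : Integrable h ν) (hL : Measurable L) {χ : Euc d → F} (hc : Continuous χ)
    (hχ : HasCompactSupport χ) (x : Euc d) : Integrable (fun p => h p • χ (x - L p)) ν := by
  obtain ⟨B, hB⟩ := hχ.exists_bound_of_continuous hc
  refine (hh.norm.mul_const B).mono' ?_ (ae_of_all _ fun p => ?_)
  · exact hh.aestronglyMeasurable.smul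
      (hc.comp_aestronglyMeasurable (measurable_const.sub hL).aestronglyMeasurable)
  · rw [norm_smul]
    exact mul_le_mul_of_nonneg_left (hB _) (norm_nonneg _)

lemma hasFDerivAt_integral_translates {F : Type*} [NormedAddCommGroup F] [NormedSpace ℝ F]
    (hh : Integrable h ν) (hL : Measurable L) {χ : Euc d → F} (hs : ContDiff ℝ 1 χ)
    (hχ : HasCompactSupport χ) (x : Euc d) :
    HasFDerivAt (fun x => ∫ p, h p • χ (x - L p) ∂ν)
      (∫ p, h p • fderiv ℝ χ (x - L p) ∂ν) x := by
  have hc' : Continuous (fderiv ℝ χ) := hs.continuous_fderiv (by simp)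
  obtain ⟨B, hB⟩ := (hχ.fderiv ℝ).exists_bound_of_continuous hc'
  refine hasFDerivAt_integral_of_dominated_of_fderiv_le (s := univ)
    (F' := fun x p => h p • fderiv ℝ χ (x - L p))
    (bound := fun p => ‖h p‖ * B) univ_mem (Eventually.of_forall fun x =>
      (integrable_translates hh hL hs.continuous hχ x).aestronglyMeasurable)
    (integrable_translates hh hL hs.continuous hχ x)
    (integrable_translates hh hL hc' (hχ.fderiv ℝ) x).aestronglyMeasurable
    (ae_of_all _ fun p x _ => ?_) (hh.norm.mul_const B) (ae_of_all _ fun p x _ => ?_)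
  · rw [norm_smul]
    exact mul_le_mul_of_nonneg_left (hB _) (norm_nonneg _)
  · have h1 : HasFDerivAt χ (fderiv ℝ χ (x - L p)) (x - L p) :=
      (hs.differentiable (by simp) _).hasFDerivAt
    have h2 : HasFDerivAt (fun x => χ (x - L p))
        ((fderiv ℝ χ (x - L p)).comp (ContinuousLinearMap.id ℝ (Euc d))) x :=
      h1.comp x ((hasFDerivAt_id x).sub_const (L p))
    rw [ContinuousLinearMap.comp_id] at h2
    exact h2.const_smul (h p)

/-- The derivative is an integral of the same kind with `fderiv ℝ χ` in place of `χ`. Its values are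
linear maps, which is why the induction runs over all target spaces at once. -/
lemma contDiff_integral_translates (hh : Integrable h ν) (hL : Measurable L) (n : ℕ) :
    ∀ {F : Type} [NormedAddCommGroup F] [NormedSpace ℝ F] {χ : Euc d → F},
      ContDiff ℝ n χ → HasCompactSupport χ →
        ContDiff ℝ n (fun x => ∫ p, h p • χ (x - L p) ∂ν) := by
  induction n with
  | zero =>
    intro F _ _ χ hs hχ
    rw [Nat.cast_zero, contDiff_zero] at hs ⊢
    obtain ⟨B, hB⟩ := hχ.exists_bound_of_continuous hs
    refine continuous_of_dominated (bound := fun p => ‖h p‖ * B)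
      (fun x => (integrable_translates hh hL hs hχ x).aestronglyMeasurable)
      (fun x => ae_of_all _ fun p => ?_) (hh.norm.mul_const B) (ae_of_all _ fun p => ?_)
    · rw [norm_smul]
      exact mul_le_mul_of_nonneg_left (hB _) (norm_nonneg _)
    · exact (hs.comp (continuous_id.sub continuous_const)).const_smul (h p)
  | succ n ih =>
    intro F _ _ χ hs hχ
    have h1 : ContDiff ℝ 1 χ := hs.of_le (by exact_mod_cast Nat.succ_le_succ n.zero_le)
    have hd := hasFDerivAt_integral_translates hh hL h1 hχ
    have hs' := hs
    rw [Nat.cast_succ, contDiff_succ_iff_fderiv] at hs' ⊢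
    refine ⟨fun x => (hd x).differentiableAt, fun hn => absurd hn (by simp), ?_⟩
    have e : fderiv ℝ (fun x => ∫ p, h p • χ (x - L p) ∂ν) =
        fun x => ∫ p, h p • fderiv ℝ χ (x - L p) ∂ν := funext fun x => (hd x).fderiv
    rw [e]
    exact ih hs'.2.2 (hχ.fderiv ℝ)

end Poincare

/-- The measure on `ℝ^d × ℝ` over which translations along segments are averaged. -/
noncomputable def segmentMeasure (d : ℕ) : Measure (Euc d × ℝ) :=
  (volume : Measure (Euc d)).prod (volume.restrict (Icc (0 : ℝ) 1))

/-- The components of a vector field with divergence `(∫ ρ) χ - ρ ∗ χ`. -/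
noncomputable def homotopyField (ρ : Euc d → ℝ) (χ : Euc d → ℂ) (i : Fin d) (x : Euc d) : ℂ :=
  ∫ p : Euc d × ℝ, (ρ p.1 * p.1 i) • χ (x - p.2 • p.1) ∂(segmentMeasure d)

lemma integrable_segment {f : Euc d → ℝ} (hf : Continuous f) (hc : HasCompactSupport f) :
    Integrable (fun p : Euc d × ℝ => f p.1) (segmentMeasure d) :=
  (hf.integrable_of_hasCompactSupport hc).comp_fst _

lemma measurable_segment : Measurable (fun p : Euc d × ℝ => p.2 • p.1) :=
  (continuous_snd.smul continuous_fst).measurable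

section

variable {ρ : Euc d → ℝ} {χ : Euc d → ℂ}

lemma integrable_homotopy_weight (hρ : Continuous ρ) (hρc : HasCompactSupport ρ) (i : Fin d) :
    Integrable (fun p : Euc d × ℝ => ρ p.1 * p.1 i) (segmentMeasure d) :=
  integrable_segment (f := fun v => ρ v * v i) (by fun_prop) hρc.mul_right

lemma contDiff_homotopyField (hρ : Continuous ρ) (hρc : HasCompactSupport ρ)
    (hχ : ContDiff ℝ ∞ χ) (hχc : HasCompactSupport χ) (i : Fin d) :
    ContDiff ℝ ∞ (homotopyField ρ χ i) := by
  rw [contDiff_infty]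
  intro n
  exact contDiff_integral_translates (integrable_homotopy_weight hρ hρc i) measurable_segment n
    (contDiff_infty.1 hχ n) hχc

/-- Almost every parameter `p.2` lies in `[0, 1]`, so the shift `p.2 • p.1` is no longer than `p.1`
and the radii of the two supports add up. -/
lemma hasCompactSupport_homotopyField (hρc : HasCompactSupport ρ) (hχc : HasCompactSupport χ)
    (i : Fin d) : HasCompactSupport (homotopyField ρ χ i) := by
  obtain ⟨R, hR, HR⟩ := HasCompactSupport.exists_bound_support hρc
  obtain ⟨K, hK, HK⟩ := HasCompactSupport.exists_bound_support hχc
  refine HasCompactSupport.intro (isCompact_closedBall (0 : Euc d) (R + K)) fun x hx => ?_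
  rw [mem_closedBall_zero_iff, not_le] at hx
  have hae : ∀ᵐ p ∂(segmentMeasure d), p.2 ∈ Icc (0 : ℝ) 1 :=
    Measure.quasiMeasurePreserving_snd.ae (ae_restrict_mem measurableSet_Icc)
  refine integral_eq_zero_of_ae ?_
  filter_upwards [hae] with p hp
  by_cases hp1 : R < ‖p.1‖
  · simp [HR _ hp1]
  · rw [HK, smul_zero]
    · rfl
    have h1 : ‖p.2 • p.1‖ ≤ R := by
      rw [norm_smul, Real.norm_of_nonneg hp.1]
      nlinarith [norm_nonneg p.1, hp.2]
    have := norm_sub_norm_le x (p.2 • p.1)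
    linarith

/-- By the fundamental theorem of calculus along the segment from `x` to `x - v`, the integral of
`fderiv ℝ χ (x - s • v) v` over `s ∈ [0, 1]` is `χ x - χ (x - v)`. Weighting by `ρ v` and
integrating over `v` gives the formula, as the components `v i` turn the sum over `i` into the
derivative in direction `v`. -/
lemma div_homotopyField (hρ : Continuous ρ) (hρc : HasCompactSupport ρ)
    (hχ : ContDiff ℝ ∞ χ) (hχc : HasCompactSupport χ) (x : Euc d) :
    ∑ i, fderiv ℝ (homotopyField ρ χ i) x (frame d i) =
      (∫ v, ρ v : ℝ) • χ x - ∫ v, ρ v • χ (x - v) := by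
  have hχ1 : ContDiff ℝ 1 χ := hχ.of_le (by simp)
  have hc' : Continuous (fderiv ℝ χ) := hχ1.continuous_fderiv (by simp)
  have hi := fun i => integrable_translates (integrable_homotopy_weight hρ hρc i)
    measurable_segment hc' (hχc.fderiv ℝ) x
  have e1 : ∀ i, fderiv ℝ (homotopyField ρ χ i) x (frame d i) =
      ∫ p : Euc d × ℝ, (ρ p.1 * p.1 i) • fderiv ℝ χ (x - p.2 • p.1) (frame d i)
        ∂(segmentMeasure d) := by
    intro i
    have := (hasFDerivAt_integral_translates (integrable_homotopy_weight hρ hρc i)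
      measurable_segment hχ1 hχc x).fderiv
    unfold homotopyField
    rw [this, ContinuousLinearMap.integral_apply (hi i)]
    rfl
  have e2 : ∀ (p : Euc d × ℝ), ∑ i, (ρ p.1 * p.1 i) • fderiv ℝ χ (x - p.2 • p.1) (frame d i) =
      ρ p.1 • fderiv ℝ χ (x - p.2 • p.1) p.1 := by
    intro p
    have hp : p.1 = ∑ i, p.1 i • frame d i := by
      have := (EuclideanSpace.basisFun (Fin d) ℝ).sum_repr p.1
      simp only [EuclideanSpace.basisFun_repr, EuclideanSpace.basisFun_apply] at this
      exact this.symm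
    conv_rhs => rw [hp]
    rw [map_sum, Finset.smul_sum]
    refine Finset.sum_congr rfl fun i _ => ?_
    rw [map_smul, smul_smul]
    rw [← hp]
  have hint2 : Integrable (fun p : Euc d × ℝ => ρ p.1 • fderiv ℝ χ (x - p.2 • p.1) p.1)
      (segmentMeasure d) := by
    simp only [← e2]
    exact integrable_finsetSum _ fun i _ =>
      (ContinuousLinearMap.apply ℝ ℂ (frame d i)).integrable_comp (hi i)
  have hfin : IsFiniteMeasure (volume.restrict (Icc (0 : ℝ) 1)) :=
    ⟨by simp⟩
  have e3 : ∀ v : Euc d, ∫ s in Icc (0 : ℝ) 1, ρ v • fderiv ℝ χ (x - s • v) v =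
      ρ v • (χ x - χ (x - v)) := by
    intro v
    rw [integral_smul, integral_Icc_eq_integral_Ioc, ← intervalIntegral.integral_of_le zero_le_one]
    congr 1
    have hder : ∀ s ∈ uIcc (0 : ℝ) 1, HasDerivAt (fun s : ℝ => -χ (x - s • v))
        (fderiv ℝ χ (x - s • v) v) s := by
      intro s _
      have h1 : HasDerivAt (fun s : ℝ => x - s • v) (-v) s := by
        simpa using ((hasDerivAt_id s).smul_const v).const_sub x
      have h2 : HasDerivAt (fun s : ℝ => -χ (x - s • v)) (-(fderiv ℝ χ (x - s • v) (-v))) s :=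
        (((hχ1.differentiable (by simp) (x - s • v)).hasFDerivAt).comp_hasDerivAt s h1).neg
      simpa using h2
    rw [intervalIntegral.integral_eq_sub_of_hasDerivAt hder]
    · simp only [one_smul, zero_smul, sub_zero]
      ring
    · refine Continuous.intervalIntegrable ?_ _ _
      exact (hc'.comp (by fun_prop)).clm_apply continuous_const
  simp only [e1]
  rw [← integral_finsetSum]
  · simp only [e2]
    rw [segmentMeasure, integral_prod _ hint2]
    simp only [e3, smul_sub]
    rw [integral_sub, integral_smul_const]
    · exact (hρ.integrable_of_hasCompactSupport (μ := volume) hρc).smul_const _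
    · have := integrable_translates (L := id)
        (hρ.integrable_of_hasCompactSupport (μ := volume) hρc)
        measurable_id hχ.continuous hχc x
      exact this
  · exact fun i _ => (ContinuousLinearMap.apply ℝ ℂ (frame d i)).integrable_comp (hi i)

end

/-- Two bump functions with integral one differ by the divergence of a smooth, compactly supported
vector field. -/
lemma exists_div_eq_sub {χ ρ : Euc d → ℝ} (hχ : ContDiff ℝ ∞ χ) (hχc : HasCompactSupport χ)
    (hχ1 : ∫ x, χ x = 1) (hρ : ContDiff ℝ ∞ ρ) (hρc : HasCompactSupport ρ) (hρ1 : ∫ x, ρ x = 1) :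
    ∃ V : Fin d → Euc d → ℂ, (∀ i, ContDiff ℝ ∞ (V i)) ∧ (∀ i, HasCompactSupport (V i)) ∧
      ∀ x, ∑ i, fderiv ℝ (V i) x (frame d i) = χ x - ρ x := by
  have hχ' : ContDiff ℝ ∞ (fun x => (χ x : ℂ)) := Complex.ofRealCLM.contDiff.comp hχ
  have hρ' : ContDiff ℝ ∞ (fun x => (ρ x : ℂ)) := Complex.ofRealCLM.contDiff.comp hρ
  have hχc' : HasCompactSupport (fun x => (χ x : ℂ)) := hχc.comp_left Complex.ofReal_zero
  have hρc' : HasCompactSupport (fun x => (ρ x : ℂ)) := hρc.comp_left Complex.ofReal_zero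
  have hs1 := contDiff_homotopyField hρ.continuous hρc hχ' hχc'
  have hs2 := contDiff_homotopyField hχ.continuous hχc hρ' hρc'
  -- The first field has divergence `χ - ρ ∗ χ` and the second `ρ - χ ∗ ρ`. Convolution is
  -- commutative, so in the difference the convolutions cancel.
  refine ⟨fun i => homotopyField ρ (fun x => (χ x : ℂ)) i - homotopyField χ (fun x => (ρ x : ℂ)) i,
    fun i => (hs1 i).sub (hs2 i), fun i =>
      (hasCompactSupport_homotopyField hρc hχc' i).sub
        (hasCompactSupport_homotopyField hχc hρc' i), fun x => ?_⟩
  have e : ∀ i, fderiv ℝ (homotopyField ρ (fun x => (χ x : ℂ)) i -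
      homotopyField χ (fun x => (ρ x : ℂ)) i) x (frame d i) =
      fderiv ℝ (homotopyField ρ (fun x => (χ x : ℂ)) i) x (frame d i) -
        fderiv ℝ (homotopyField χ (fun x => (ρ x : ℂ)) i) x (frame d i) := fun i => by
    rw [fderiv_sub ((hs1 i).differentiable (by simp) x) ((hs2 i).differentiable (by simp) x)]
    rfl
  simp only [e]
  rw [Finset.sum_sub_distrib, div_homotopyField hρ.continuous hρc hχ' hχc',
    div_homotopyField hχ.continuous hχc hρ' hρc', hχ1, hρ1, one_smul, one_smul]
  have hconv : ∫ v, ρ v • (χ (x - v) : ℂ) = ∫ v, χ v • (ρ (x - v) : ℂ) := by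
    rw [← integral_sub_left_eq_self (fun v => ρ v • (χ (x - v) : ℂ)) volume x]
    congr 1
    funext v
    rw [sub_sub_cancel, Complex.real_smul, Complex.real_smul, mul_comm]
  rw [hconv]
  ring

/-! ### Regularised combs -/

/-- A finite index set that works on a whole ball reduces smoothness to that of finite sums. -/
lemma kernelSum_eqOn_ball {Λ : Set (Euc d)} (hΛ : IsDelone Λ) {k : Euc d → Euc d → ℂ} {R : ℝ}
    (hk : ∀ y s, R < ‖s‖ → k y s = 0) (x₀ : Euc d) :
    ∃ T : Finset (Euc d), ↑T ⊆ Λ ∧ ∀ x ∈ Metric.ball x₀ 1,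
      kernelSum Λ k x = ∑ y ∈ T, k y (x - y) := by
  have hfin := hΛ.finite_inter (Metric.isBounded_closedBall (x := x₀) (r := R + 1))
  refine ⟨hfin.toFinset, fun y hy => (by simpa using hy : y ∈ Λ ∧ _).1, fun x hx => ?_⟩
  refine kernelSum_eq_sum hk (fun y hy => (by simpa using hy : y ∈ Λ ∧ _).1) ?_
  rw [Finite.coe_toFinset]
  refine inter_subset_inter_right _ (Metric.closedBall_subset_closedBall' ?_)
  linarith [Metric.mem_ball.1 hx]

lemma contDiff_kernelSum {Λ : Set (Euc d)} (hΛ : IsDelone Λ) {k : Euc d → Euc d → ℂ} {R : ℝ}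
    (hk : ∀ y s, R < ‖s‖ → k y s = 0) (hs : ∀ y, ContDiff ℝ ∞ (k y)) :
    ContDiff ℝ ∞ (kernelSum Λ k) := by
  rw [contDiff_iff_contDiffAt]
  intro x₀
  obtain ⟨T, -, hT⟩ := kernelSum_eqOn_ball hΛ hk x₀
  have h1 : ContDiff ℝ ∞ (fun x => ∑ y ∈ T, k y (x - y)) :=
    ContDiff.sum fun y _ => (hs y).comp (contDiff_id.sub contDiff_const)
  exact h1.contDiffAt.congr_of_eventuallyEq
    (Filter.mem_of_superset (Metric.ball_mem_nhds x₀ one_pos) hT)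

lemma fderiv_kernelSum {Λ : Set (Euc d)} (hΛ : IsDelone Λ) {k : Euc d → Euc d → ℂ} {R : ℝ}
    (hk : ∀ y s, R < ‖s‖ → k y s = 0) (hs : ∀ y, ContDiff ℝ ∞ (k y)) (x v : Euc d) :
    fderiv ℝ (kernelSum Λ k) x v = kernelSum Λ (fun y s => fderiv ℝ (k y) s v) x := by
  have hk' : ∀ y s, R < ‖s‖ → fderiv ℝ (k y) s v = 0 := by
    intro y s hsR
    have : k y =ᶠ[𝓝 s] fun _ => 0 := by
      filter_upwards [(isOpen_lt continuous_const continuous_norm).mem_nhds hsR] with z hz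
      exact hk y z hz
    rw [this.fderiv_eq]
    simp
  have hfin := hΛ.finite_inter (Metric.isBounded_closedBall (x := x) (r := R + 1))
  have hsub : ↑hfin.toFinset ⊆ Λ := fun y hy => (by simpa using hy : y ∈ Λ ∧ _).1
  have hev : kernelSum Λ k =ᶠ[𝓝 x] fun x => ∑ y ∈ hfin.toFinset, k y (x - y) := by
    filter_upwards [Metric.ball_mem_nhds x one_pos] with z hz
    refine kernelSum_eq_sum hk hsub ?_
    rw [Finite.coe_toFinset]
    refine inter_subset_inter_right _ (Metric.closedBall_subset_closedBall' ?_)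
    linarith [Metric.mem_ball.1 hz]
  have hd : HasFDerivAt (fun x => ∑ y ∈ hfin.toFinset, k y (x - y))
      (∑ y ∈ hfin.toFinset, fderiv ℝ (k y) (x - y)) x := by
    refine HasFDerivAt.fun_sum fun y _ => ?_
    have h1 : HasFDerivAt (k y) (fderiv ℝ (k y) (x - y)) (x - y) :=
      ((hs y).differentiable (by simp) _).hasFDerivAt
    have h2 : HasFDerivAt (fun x => k y (x - y))
        ((fderiv ℝ (k y) (x - y)).comp (ContinuousLinearMap.id ℝ (Euc d))) x :=
      h1.comp x ((hasFDerivAt_id x).sub_const y)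
    rwa [ContinuousLinearMap.comp_id] at h2
  rw [hev.fderiv_eq, hd.fderiv, kernelSum_eq_sum hk' hsub, sum_apply]
  rw [Finite.coe_toFinset]
  exact inter_subset_inter_right _ (Metric.closedBall_subset_closedBall (by linarith))

open Classical in
/-- The sum of the translates of `χ` to the points `y ∈ Λ` with `y + z ∈ Λ`. -/
noncomputable def pairSum (Λ : Set (Euc d)) (z : Euc d) (χ : Euc d → ℂ) : Euc d → ℂ :=
  kernelSum Λ (fun y s => if y + z ∈ Λ then χ s else 0)

lemma pairSum_eq_tsum (Λ : Set (Euc d)) (z : Euc d) (χ : Euc d → ℂ) (x : Euc d) :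
    pairSum Λ z χ x = ∑' y : {y : Euc d // y ∈ Λ ∧ y + z ∈ Λ}, χ (x - y) := by
  classical
  rw [pairSum, kernelSum, tsum_subtype Λ (fun y => if y + z ∈ Λ then χ (x - y) else 0)]
  refine Eq.trans ?_ (tsum_subtype {y : Euc d | y ∈ Λ ∧ y + z ∈ Λ} (fun y => χ (x - y))).symm
  congr 1
  funext y
  by_cases h1 : y ∈ Λ <;> by_cases h2 : y + z ∈ Λ <;> simp [indicator, h1, h2]

/-- With `w = y - x` as summation variable the sum involves `x` only through `translate Λ x`. Only
`w` with `‖w‖ ≤ R` contribute, so membership is tested at `w` and `w + z` within radius `R + ‖z‖ +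
1`. -/
lemma isEquivariant_pairSum {Λ : Set (Euc d)} (z : Euc d) {χ : Euc d → ℂ}
    (hχ : HasCompactSupport χ) : IsEquivariant Λ (pairSum Λ z χ) := by
  classical
  obtain ⟨R, hR, HR⟩ := HasCompactSupport.exists_bound_support hχ
  have e : ∀ x, pairSum Λ z χ x =
      ∑' w : Euc d, if w ∈ translate Λ x ∧ w + z ∈ translate Λ x then χ (-w) else 0 := by
    intro x
    rw [pairSum, kernelSum, tsum_subtype Λ (fun y => if y + z ∈ Λ then χ (x - y) else 0),
      ← (Equiv.addRight x).tsum_eq]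
    congr 1
    funext w
    have hz : w + z + x = w + x + z := by abel
    simp only [Equiv.coe_addRight, indicator, mem_translate, hz]
    rw [show x - (w + x) = -w by abel]
    by_cases h1 : w + x ∈ Λ <;> by_cases h2 : w + x + z ∈ Λ <;> simp [h1, h2]
  refine isEquivariant_of_agree (r := R + ‖z‖ + 1) fun x y h => ?_
  rw [e, e]
  congr 1
  funext w
  by_cases hw : R < ‖w‖
  · rw [HR (-w) (by rwa [norm_neg]), ite_self, ite_self]
  · have h1 := h w (by linarith [norm_nonneg z])
    have h2 := h (w + z) (by linarith [norm_add_le w z])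
    rw [h1, h2]

section

variable {Λ : Set (Euc d)} {z : Euc d} {χ : Euc d → ℂ}

lemma contDiff_pairSum (hΛ : IsDelone Λ) (hs : ContDiff ℝ ∞ χ) (hχ : HasCompactSupport χ) :
    ContDiff ℝ ∞ (pairSum Λ z χ) := by
  classical
  obtain ⟨R, hR, HR⟩ := HasCompactSupport.exists_bound_support hχ
  refine contDiff_kernelSum (R := R) hΛ (fun y s h => ?_) fun y => ?_
  · rw [HR s h, ite_self]
  · split_ifs
    exacts [hs, contDiff_const]

lemma fderiv_pairSum (hΛ : IsDelone Λ) (hs : ContDiff ℝ ∞ χ) (hχ : HasCompactSupport χ)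
    (x v : Euc d) :
    fderiv ℝ (pairSum Λ z χ) x v = pairSum Λ z (fun s => fderiv ℝ χ s v) x := by
  classical
  obtain ⟨R, hR, HR⟩ := HasCompactSupport.exists_bound_support hχ
  rw [pairSum, fderiv_kernelSum (R := R) hΛ (fun y s h => by rw [HR s h, ite_self])]
  · rw [pairSum]
    congr 1
    funext y s
    split_ifs
    · rfl
    · simp
  · intro y
    split_ifs
    exacts [hs, contDiff_const]

lemma pairSum_eq_sum (hΛ : IsDelone Λ) {R : ℝ} (hR : ∀ s, R < ‖s‖ → χ s = 0) (x : Euc d) :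
    pairSum Λ z χ x = ∑ y ∈ (hΛ.finite_inter (Metric.isBounded_closedBall
      (x := x) (r := R))).toFinset, open Classical in if y + z ∈ Λ then χ (x - y) else 0 := by
  classical
  exact kernelSum_eq_sum (fun y s h => by rw [hR s h, ite_self])
    (fun y hy => (by simpa using hy : y ∈ Λ ∧ _).1) (by simp)

/-- Regularised combs formed with two bump functions of integral one are cohomologous. -/
lemma ofStar_sub_mem_coboundaries (hΛ : IsDelone Λ) (hd : d ≠ 0) {χ ρ : Euc d → ℝ}
    (hχ : ContDiff ℝ ∞ χ) (hχc : HasCompactSupport χ)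
    (hχ1 : ∫ x, χ x = 1) (hρ : ContDiff ℝ ∞ ρ) (hρc : HasCompactSupport ρ) (hρ1 : ∫ x, ρ x = 1)
    {η θ : Forms Λ d} (hη : hodgeStar η = pairSum Λ z (fun x => χ x))
    (hθ : hodgeStar θ = pairSum Λ z (fun x => ρ x)) : η - θ ∈ coboundaries Λ d := by
  classical
  obtain ⟨V, hVs, hVc, hV⟩ := exists_div_eq_sub hχ hχc hχ1 hρ hρc hρ1
  refine ofStar_div_mem_coboundaries hd (fun i => pairSum Λ z (V i))
    (fun i => isEquivariant_pairSum z (hVc i)) (fun i => contDiff_pairSum hΛ (hVs i) (hVc i))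
    fun x => ?_
  have e : hodgeStar (η - θ) x = hodgeStar η x - hodgeStar θ x := rfl
  have hχc' : HasCompactSupport (fun x => (χ x : ℂ)) := hχc.comp_left Complex.ofReal_zero
  have hρc' : HasCompactSupport (fun x => (ρ x : ℂ)) := hρc.comp_left Complex.ofReal_zero
  obtain ⟨R1, hR1, H1⟩ := HasCompactSupport.exists_bound_support hχc'
  obtain ⟨R2, hR2, H2⟩ := HasCompactSupport.exists_bound_support hρc'
  have H3 : ∀ i, ∃ R : ℝ, 0 < R ∧ ∀ s, R < ‖s‖ → fderiv ℝ (V i) s = 0 := fun i =>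
    HasCompactSupport.exists_bound_support ((hVc i).fderiv ℝ)
  choose R3 hR3 H3 using H3
  -- A radius common to all supports makes all sums run over the same finite set of points, where
  -- the divergence identity can be applied term by term.
  set R := max R1 R2 + ∑ i, R3 i with hR
  have hsum : 0 ≤ ∑ i, R3 i := Finset.sum_nonneg fun i _ => (hR3 i).le
  have hle : ∀ i, R3 i ≤ R := fun i => by
    have := Finset.single_le_sum (fun i _ => (hR3 i).le) (Finset.mem_univ i)
    linarith [le_max_left R1 R2]
  simp only [fderiv_pairSum hΛ (hVs _) (hVc _)]
  rw [e, hη, hθ,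
    pairSum_eq_sum hΛ (R := R) (fun s hs => H1 s (by linarith [le_max_left R1 R2])),
    pairSum_eq_sum hΛ (R := R) (fun s hs => H2 s (by linarith [le_max_right R1 R2]))]
  have e2 : ∀ i, pairSum Λ z (fun s => fderiv ℝ (V i) s (frame d i)) x = _ := fun i =>
    pairSum_eq_sum hΛ (R := R) (fun s hs => by rw [H3 i s (by linarith [hle i])]; rfl) x
  simp only [e2]
  rw [Finset.sum_comm, ← Finset.sum_sub_distrib]
  refine Finset.sum_congr rfl fun y _ => ?_
  split_ifs
  · rw [hV]
  · simp

/-- The mean of a regularised comb. -/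
lemma hasMean_pairSum (hΛ : IsDelone Λ) (hc : Continuous χ) (hχ : HasCompactSupport χ) {a : ℂ}
    (ha : HasDensity (comb Λ (open Classical in fun y => if y + z ∈ Λ then 1 else 0)) a) :
    HasMean (pairSum Λ z χ) ((∫ x, χ x) * a) := by
  classical
  obtain ⟨R, hR, HR⟩ := HasCompactSupport.exists_bound_support hχ
  obtain ⟨B, hB⟩ := hχ.exists_bound_of_continuous hc
  have hk : IsKernel (fun y s => if y + z ∈ Λ then χ s else 0) R B := by
    refine ⟨fun y => ?_, fun y s h => by rw [HR s h, ite_self], fun y s => ?_⟩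
    · split_ifs
      exacts [hc.measurable, measurable_const]
    · split_ifs
      · exact hB s
      · rw [norm_zero]; exact (norm_nonneg _).trans (hB 0)
  refine HasDensity.congr_boundary ?_ (hk.boundaryClose hΛ hR.le)
  refine (ha.const_mul (∫ x, χ x)).congr fun A hA _ => ?_
  rw [← hΛ.comb_const_mul _ _ hA]
  refine comb_congr (fun y _ => ?_) A
  split_ifs <;> simp

end

/-! ### The autocorrelation -/

open Classical in
/-- The weight that marks the points `y` with `y + z ∈ Λ`. -/
noncomputable def pairWeight (Λ : Set (Euc d)) (z y : Euc d) : ℂ := if y + z ∈ Λ then 1 else 0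

lemma patchLocal_pairWeight (Λ : Set (Euc d)) (z : Euc d) : PatchLocal Λ (pairWeight Λ z) := by
  classical
  refine ⟨‖z‖ + 1, fun y _ y' _ h => ?_⟩
  have := h z (by linarith)
  rw [mem_translate, mem_translate, add_comm, add_comm z] at this
  exact if_congr this rfl rfl

lemma HasDensity.re_nonneg {m : Set (Euc d) → ℂ} {c : ℂ} (h : HasDensity m c)
    (hm : ∀ A, Bornology.IsBounded A → ∃ x : ℝ, 0 ≤ x ∧ m A = x) {F : ℕ → Set (Euc d)}
    (hF : IsVanHove F) : ∃ x : ℝ, 0 ≤ x ∧ c = x := by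
  have hcl : IsClosed (Complex.ofReal '' Ici 0) :=
    Complex.isometry_ofReal.isClosedEmbedding.isClosedMap _ isClosed_Ici
  have := hcl.mem_of_tendsto (h.tendsto hF) (Eventually.of_forall fun n => by
    obtain ⟨x, hx, e⟩ := hm _ (hF.bounded n)
    exact ⟨(volume.real (F n))⁻¹ * x, mul_nonneg (inv_nonneg.2 measureReal_nonneg) hx, by
      rw [e]; push_cast; rfl⟩)
  obtain ⟨x, hx, e⟩ := this
  exact ⟨x, hx, e.symm⟩

/-- The density of the pairs of points of `Λ` with difference `z`. -/
lemma IsDelone.exists_pairDensity {Λ : Set (Euc d)} (hΛ : IsDelone Λ)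
    (hFLC : FiniteLocalComplexity Λ) {F : ℕ → Set (Euc d)} (hF : IsVanHove F)
    (hUCF : UniformClusterFrequencies Λ F) :
    ∃ a : Euc d → ℝ, (∀ z, 0 ≤ a z) ∧ (∀ z, z ∉ Λ - Λ → a z = 0) ∧
      ∀ z, HasDensity (comb Λ (pairWeight Λ z)) (a z) := by
  have key : ∀ z, ∃ x : ℝ, 0 ≤ x ∧ HasDensity (comb Λ (pairWeight Λ z)) x := by
    intro z
    obtain ⟨c, hc⟩ := hΛ.exists_hasDensity_comb hFLC hF hUCF (patchLocal_pairWeight Λ z)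
    obtain ⟨x, hx, rfl⟩ := hc.re_nonneg (fun A hA => ⟨_, Nat.cast_nonneg _, by
      rw [Complex.ofReal_natCast]; exact hΛ.comb_boole _ hA⟩) hF
    exact ⟨x, hx, hc⟩
  choose a ha ha' using key
  refine ⟨a, ha, fun z hz => ?_, ha'⟩
  have h0 : HasDensity (comb Λ (pairWeight Λ z)) 0 := by
    refine HasDensity.zero.congr fun A _ _ => ?_
    refine (finsum_mem_congr rfl fun y hy => if_neg fun h => hz ?_).trans (finsum_mem_zero _)
    exact ⟨y + z, h, y, hy.1, add_sub_cancel_left y z⟩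
  exact_mod_cast (ha' z).unique h0 hF

/-- A difference `x - y` of length at most `R` is a point of the patch of radius `R + 1` around `y`.
There are finitely many such patches, each of them finite. -/
lemma IsDelone.finite_sub_inter {Λ : Set (Euc d)} (hΛ : IsDelone Λ)
    (hFLC : FiniteLocalComplexity Λ) (R : ℝ) :
    ((Λ - Λ) ∩ Metric.closedBall 0 R).Finite := by
  refine ((finite_patches hFLC (R + 1)).biUnion (t := fun P => P) ?_).subset ?_
  · rintro _ ⟨y, -, rfl⟩
    refine ((hΛ.finite_inter (Metric.isBounded_ball (x := y) (r := R + 1))).image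
      (fun q => q - y)).subset ?_
    rintro z ⟨hz, hz'⟩
    exact ⟨z + y, ⟨hz', by simpa [mem_ball_iff_norm] using hz⟩, by simp⟩
  · rintro _ ⟨⟨x, hx, y, hy, rfl⟩, hR⟩
    refine mem_biUnion (x := Metric.ball 0 (R + 1) ∩ translate Λ y) ⟨y, hy, rfl⟩ ⟨?_, ?_⟩
    · rw [mem_closedBall_zero_iff] at hR
      rw [mem_ball_zero_iff]
      linarith
    · simpa [mem_translate] using hx

/-- The measure `∑_{z ∈ Z} a z δ_z`. -/
noncomputable def weightedComb (Z : Set (Euc d)) (a : Euc d → ℝ) : Measure (Euc d) :=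
  Measure.sum (fun z : Z => ENNReal.ofReal (a z) • Measure.dirac (z : Euc d))

lemma weightedComb_apply (Z : Set (Euc d)) (a : Euc d → ℝ) {s : Set (Euc d)}
    (hs : MeasurableSet s) :
    weightedComb Z a s = ∑' z : Z, ENNReal.ofReal (a z) * s.indicator 1 (z : Euc d) := by
  rw [weightedComb, Measure.sum_apply _ hs]
  simp only [Measure.smul_apply, Measure.dirac_apply' _ hs, smul_eq_mul]

lemma weightedComb_real_singleton {Z : Set (Euc d)} {a : Euc d → ℝ} (ha : ∀ z, 0 ≤ a z)
    (ha' : ∀ z, z ∉ Z → a z = 0) (z : Euc d) : (weightedComb Z a).real {z} = a z := by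
  rw [measureReal_def, weightedComb_apply _ _ (measurableSet_singleton z),
    tsum_subtype Z (fun w => ENNReal.ofReal (a w) * ({z} : Set (Euc d)).indicator 1 w),
    tsum_eq_single z]
  · by_cases hz : z ∈ Z
    · rw [indicator_of_mem hz, indicator_of_mem (mem_singleton z), Pi.one_apply, mul_one,
        ENNReal.toReal_ofReal (ha z)]
    · rw [indicator_of_notMem hz, ENNReal.toReal_zero, ha' z hz]
  · intro w hw
    by_cases h : w ∈ Z
    · rw [indicator_of_mem h, indicator_of_notMem (by simpa using hw), mul_zero]
    · exact indicator_of_notMem h _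

lemma weightedComb_compl (Z : Set (Euc d)) (hZ : MeasurableSet Z) (a : Euc d → ℝ) :
    weightedComb Z a Zᶜ = 0 := by
  rw [weightedComb_apply _ _ hZ.compl]
  simp

lemma isFiniteMeasureOnCompacts_weightedComb {Z : Set (Euc d)} (a : Euc d → ℝ)
    (hZ : ∀ R : ℝ, (Z ∩ Metric.closedBall 0 R).Finite) :
    IsFiniteMeasureOnCompacts (weightedComb Z a) where
  lt_top_of_isCompact K hK := by
    obtain ⟨R, hR⟩ := hK.isBounded.subset_closedBall 0
    rw [weightedComb_apply _ _ hK.measurableSet,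
      tsum_subtype Z (fun w => ENNReal.ofReal (a w) * K.indicator 1 w),
      tsum_eq_sum (s := (hZ R).toFinset)]
    · refine ENNReal.sum_lt_top.2 fun z _ => ?_
      refine lt_of_le_of_lt (indicator_le_self _ _ _) ?_
      refine ENNReal.mul_lt_top ENNReal.ofReal_lt_top ?_
      exact lt_of_le_of_lt (indicator_le_self _ _ _) ENNReal.one_lt_top
    · intro z hz
      by_cases h : z ∈ Z
      · rw [indicator_of_mem h, indicator_of_notMem, mul_zero]
        exact fun h' => hz (by simpa using ⟨h, by simpa using hR h'⟩)
      · exact indicator_of_notMem h _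

lemma hasSum_integral_weightedComb {Z : Set (Euc d)} {a : Euc d → ℝ} (ha : ∀ z, 0 ≤ a z)
    {f : Euc d → ℂ} (hf : Integrable f (weightedComb Z a)) :
    HasSum (fun z : Z => (a z : ℂ) * f z) (∫ z, f z ∂weightedComb Z a) := by
  rw [weightedComb] at hf ⊢
  have := hasSum_integral_measure hf
  simpa only [integral_smul_measure, integral_dirac, ENNReal.toReal_ofReal (ha _),
    Complex.real_smul] using this

/-- The double sum `∑_{x, y ∈ Λ ∩ A} φ (x - y)`. -/
noncomputable def pairComb (Λ : Set (Euc d)) (φ : Euc d → ℂ) (A : Set (Euc d)) : ℂ :=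
  comb Λ (fun x => comb Λ (fun y => φ (x - y)) A) A

lemma IsDelone.pairComb_eq_sum {Λ : Set (Euc d)} (hΛ : IsDelone Λ) (φ : Euc d → ℂ)
    {A : Set (Euc d)} (hA : Bornology.IsBounded A) :
    pairComb Λ φ A = ∑ x ∈ (hΛ.finite_inter hA).toFinset,
      ∑ y ∈ (hΛ.finite_inter hA).toFinset, φ (x - y) := by
  simp only [pairComb, hΛ.comb_eq_sum _ hA]

open Classical in
/-- Restricting the second point of the pair to the window changes a boundary term only. -/
lemma IsDelone.boundaryClose_pairWeight {Λ : Set (Euc d)} (hΛ : IsDelone Λ) (z : Euc d) :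
    BoundaryClose (fun A => comb Λ (fun y => if y + z ∈ Λ ∩ A then 1 else 0) A)
      (comb Λ (pairWeight Λ z)) := by
  obtain ⟨C, hC, H⟩ := hΛ.exists_ncard_boundary_le (norm_nonneg z)
  refine ⟨C, 1 + ‖z‖, hC.le, by positivity, fun A hA hA' => ?_⟩
  refine le_trans ?_ (H A hA)
  beta_reduce
  rw [hΛ.comb_eq_sum _ hA, hΛ.comb_eq_sum _ hA, ← Finset.sum_sub_distrib,
    Set.ncard_eq_toFinset_card _ (hΛ.finite_inter (isBounded_boundary hA ‖z‖))]
  set B := (hΛ.finite_inter (isBounded_boundary hA ‖z‖)).toFinset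
  calc _ ≤ ∑ y ∈ (hΛ.finite_inter hA).toFinset, if y ∈ B then (1 : ℝ) else 0 := by
        refine norm_sum_le_of_le _ fun y hy => ?_
        have hy' : y ∈ Λ ∧ y ∈ A := by simpa using hy
        simp only [pairWeight, mem_inter_iff]
        by_cases h : y + z ∈ Λ
        · by_cases h' : y + z ∈ A
          · simp only [h, h', and_self, if_true, sub_self, norm_zero]
            split_ifs <;> simp
          · have hB : y ∈ B := by
              rw [Finite.mem_toFinset]
              refine ⟨hy'.1, mem_boundary (y := y + z) (fun e => h' (e.1 hy'.2)) ?_⟩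
              rw [dist_self_add_right]
            simp [h, h', hB]
        · simp only [h, false_and, if_false, sub_self, norm_zero]
          split_ifs <;> simp
    _ ≤ _ := by
        rw [Finset.sum_boole]
        exact_mod_cast Finset.card_le_card fun y hy => (Finset.mem_filter.1 hy).2

/-- The averages of the double sums over the pairs of points of `Λ`. -/
lemma IsDelone.hasDensity_pairComb {Λ : Set (Euc d)} (hΛ : IsDelone Λ) {a : Euc d → ℝ}
    (ha : ∀ z, HasDensity (comb Λ (pairWeight Λ z)) (a z)) {φ : Euc d → ℂ} {R : ℝ}
    (hφ : ∀ z, R < ‖z‖ → φ z = 0) (hfin : ((Λ - Λ) ∩ Metric.closedBall 0 R).Finite) :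
    HasDensity (pairComb Λ φ) (∑ z ∈ hfin.toFinset, φ z * a z) := by
  classical
  refine (HasDensity.sum fun z _ => ((ha z).congr_boundary
    (hΛ.boundaryClose_pairWeight z)).const_mul (φ z)).congr fun A hA _ => ?_
  beta_reduce
  rw [hΛ.pairComb_eq_sum _ hA]
  simp only [hΛ.comb_eq_sum _ hA, Finset.mul_sum]
  rw [Finset.sum_comm, Finset.sum_comm (s := hfin.toFinset)]
  refine Finset.sum_congr rfl fun y hy => ?_
  have hy' : y ∈ Λ ∧ y ∈ A := by simpa using hy
  simp only [mul_ite, mul_one, mul_zero]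
  rw [← Finset.sum_filter]
  symm
  -- For fixed `y` the pairs are sorted by `z = x - y`. Only terms with `φ z ≠ 0` are matched,
  -- because only those differences are known to lie in the ball of radius `R`.
  refine Finset.sum_bij_ne_zero (fun z _ _ => y + z) ?_ ?_ ?_ ?_
  · intro z hz _
    simpa using (Finset.mem_filter.1 hz).2
  · intro z _ _ w _ _ h
    exact add_left_cancel h
  · intro x hx h0
    have hx' : x ∈ Λ ∧ x ∈ A := by simpa using hx
    refine ⟨x - y, ?_, h0, by abel⟩
    rw [Finset.mem_filter, Finite.mem_toFinset]
    refine ⟨⟨⟨x, hx'.1, y, hy'.1, rfl⟩, ?_⟩, by simpa using hx'⟩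
    rw [mem_closedBall_zero_iff]
    by_contra! h
    exact h0 (hφ _ h)
  · intro z _ _
    rw [add_sub_cancel_left]

lemma IsDelone.diracComb_restrict {Λ : Set (Euc d)} (hΛ : IsDelone Λ) {A : Set (Euc d)}
    (hA : Bornology.IsBounded A) (hA' : MeasurableSet A) :
    (diracComb Λ).restrict A = ∑ x ∈ (hΛ.finite_inter hA).toFinset, Measure.dirac x := by
  ext s hs
  rw [Measure.restrict_apply hs, diracComb, Measure.sum_apply _ (hs.inter hA'),
    Measure.finsetSum_apply]
  simp only [Measure.dirac_apply' _ (hs.inter hA'), Measure.dirac_apply' _ hs]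
  rw [tsum_subtype Λ (fun x => (s ∩ A).indicator 1 x),
    tsum_eq_sum (s := (hΛ.finite_inter hA).toFinset)]
  · refine Finset.sum_congr rfl fun x hx => ?_
    have hx' : x ∈ Λ ∧ x ∈ A := by simpa using hx
    rw [indicator_of_mem hx'.1]
    by_cases h : x ∈ s <;> simp [h, hx'.2]
  · intro x hx
    by_cases h : x ∈ Λ
    · rw [indicator_of_mem h, indicator_of_notMem]
      exact fun h' => hx (by simpa using ⟨h, h'.2⟩)
    · exact indicator_of_notMem h _

/-- The autocorrelation of a finite window, without normalisation. -/
noncomputable def windowCorrelation (Λ A : Set (Euc d)) : Measure (Euc d) :=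
  ((diracComb Λ).restrict A) ∗ (((diracComb Λ).restrict A).map (fun x => -x))

lemma IsDelone.isFiniteMeasure_restrict {Λ : Set (Euc d)} (hΛ : IsDelone Λ) {A : Set (Euc d)}
    (hA : Bornology.IsBounded A) (hA' : MeasurableSet A) :
    IsFiniteMeasure ((diracComb Λ).restrict A) := by
  rw [hΛ.diracComb_restrict hA hA']
  infer_instance

lemma IsDelone.isFiniteMeasure_windowCorrelation {Λ : Set (Euc d)} (hΛ : IsDelone Λ)
    {A : Set (Euc d)} (hA : Bornology.IsBounded A) (hA' : MeasurableSet A) :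
    IsFiniteMeasure (windowCorrelation Λ A) := by
  have := hΛ.isFiniteMeasure_restrict hA hA'
  unfold windowCorrelation
  infer_instance

lemma IsDelone.integral_windowCorrelation {Λ : Set (Euc d)} (hΛ : IsDelone Λ)
    {A : Set (Euc d)} (hA : Bornology.IsBounded A) (hA' : MeasurableSet A) {f : Euc d → ℂ}
    (hf : Continuous f) {M : ℝ} (hM : ∀ x, ‖f x‖ ≤ M) :
    ∫ z, f z ∂windowCorrelation Λ A = pairComb Λ f A := by
  have := hΛ.isFiniteMeasure_restrict hA hA'
  have := hΛ.isFiniteMeasure_windowCorrelation hA hA'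
  have hi : Integrable f (windowCorrelation Λ A) :=
    Integrable.of_bound hf.aestronglyMeasurable M (Eventually.of_forall hM)
  have hd : ∀ (g : Euc d → ℂ) (x : Euc d), Integrable g (Measure.dirac x) := fun g x =>
    integrable_dirac (by simp)
  rw [windowCorrelation] at hi ⊢
  rw [integral_conv hi, hΛ.pairComb_eq_sum _ hA, hΛ.diracComb_restrict hA hA',
    integral_finsetSum_measure fun x _ => hd _ x]
  refine Finset.sum_congr rfl fun x _ => ?_
  rw [integral_dirac, integral_map measurable_neg.aemeasurable
    (by fun_prop), integral_finsetSum_measure fun x _ => hd _ x]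
  simp only [integral_dirac, sub_eq_add_neg]

/-- Against a compactly supported `φ` only finitely many differences count, so the limit measure
gives a finite sum of `φ z * a z`, which is the density of the double sums over pairs of points. -/
lemma IsDelone.isAutocorrelation_weightedComb {Λ : Set (Euc d)} (hΛ : IsDelone Λ)
    (hFLC : FiniteLocalComplexity Λ) {a : Euc d → ℝ} (ha0 : ∀ z, 0 ≤ a z)
    (ha : ∀ z, HasDensity (comb Λ (pairWeight Λ z)) (a z)) {G : ℕ → Set (Euc d)}
    (hG : IsVanHove G) : IsAutocorrelation Λ G (weightedComb (Λ - Λ) a) := by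
  have hfin := isFiniteMeasureOnCompacts_weightedComb a (hΛ.finite_sub_inter hFLC)
  refine ⟨hfin, fun φ hφ hφc => ?_⟩
  obtain ⟨R, hR⟩ := hφc.isCompact.isBounded.subset_closedBall 0
  have hs : ∀ z, R < ‖z‖ → (φ z : ℂ) = 0 := fun z hz => by
    rw [image_eq_zero_of_notMem_tsupport (f := φ) fun h => hz.not_ge (by simpa using hR h),
      Complex.ofReal_zero]
  obtain ⟨M, hM⟩ := hφc.exists_bound_of_continuous hφ
  have hcφ : Continuous fun z => (φ z : ℂ) := Complex.continuous_ofReal.comp hφ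
  have hint : Integrable (fun z => (φ z : ℂ)) (weightedComb (Λ - Λ) a) :=
    hcφ.integrable_of_hasCompactSupport (hφc.comp_left Complex.ofReal_zero)
  have key := (hΛ.hasDensity_pairComb ha hs (hΛ.finite_sub_inter hFLC R)).tendsto hG
  have e : ∑ z ∈ (hΛ.finite_sub_inter hFLC R).toFinset, (φ z : ℂ) * a z =
      ((∫ z, φ z ∂weightedComb (Λ - Λ) a : ℝ) : ℂ) := by
    rw [← integral_complex_ofReal]
    refine HasSum.unique (L := .unconditional _) ?_ (hasSum_integral_weightedComb ha0 hint)
    rw [← Function.comp_def (fun z : Euc d => (a z : ℂ) * (φ z : ℂ)) Subtype.val,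
      hasSum_subtype_iff_indicator]
    have := hasSum_sum_of_ne_finset_zero (L := .unconditional _) (s := (hΛ.finite_sub_inter hFLC R).toFinset)
      (f := (Λ - Λ).indicator (fun z => (a z : ℂ) * (φ z : ℂ))) fun z hz => by
        by_cases h : z ∈ Λ - Λ
        · rw [indicator_of_mem h, hs z, mul_zero]
          by_contra! h'
          exact hz (by simpa using ⟨h, h'⟩)
        · exact indicator_of_notMem h _
    convert this using 1
    refine Finset.sum_congr rfl fun z hz => ?_
    rw [indicator_of_mem (by simpa using hz : z ∈ Λ - Λ ∧ _).1, mul_comm]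
  rw [e] at key
  refine (Complex.continuous_re.tendsto _).comp key |>.congr fun n => ?_
  have e2 := hΛ.integral_windowCorrelation (hG.bounded n) (hG.measurable n) hcφ (M := M)
    fun x => by rw [Complex.norm_real]; exact hM x
  rw [integral_complex_ofReal] at e2
  simp only [Function.comp_apply]
  rw [← e2, ← Complex.ofReal_inv, ← Complex.ofReal_mul, Complex.ofReal_re]
  rfl

/-- The cluster with marked point `y` sits at `w ∈ Λ` exactly when `w + (x - y) ∈ Λ`. This includes
`x = y`, where the cluster is a single point. -/
lemma IsDelone.hasUniformFrequency_pair {Λ : Set (Euc d)} (hΛ : IsDelone Λ)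
    {F : ℕ → Set (Euc d)} (hF : IsVanHove F) (x y : Euc d) {c : ℝ}
    (hc : HasDensity (comb Λ (pairWeight Λ (x - y))) c) : HasUniformFrequency Λ F {x, y} c := by
  classical
  rw [hΛ.hasUniformFrequency_iff hF (y₀ := y) (by simp) (by simp)]
  refine hc.congr fun A _ _ => comb_congr (fun w hw => ?_) A
  unfold clusterWeight pairWeight
  refine if_congr ?_ rfl rfl
  simp [hw, add_comm w]

/-! ### Translation bounded measures -/

/-- A smooth bump function that is `1` on the unit ball. -/
noncomputable def bump : ContDiffBump (0 : Euc d) := ⟨1, 2, one_pos, one_lt_two⟩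

/-- A measure is translation bounded (with constant `B`) if it integrates all translates of a fixed
bump function to at most `B`. -/
def TranslationBounded (B : ℝ) (μ : Measure (Euc d)) : Prop := ∀ x, ∫ y, bump (y - x) ∂μ ≤ B

lemma continuous_bump_sub (x : Euc d) : Continuous fun y => bump (y - x) :=
  bump.continuous.comp (continuous_id.sub continuous_const)

lemma hasCompactSupport_bump_sub (x : Euc d) : HasCompactSupport fun y => bump (y - x) := by
  have := bump.hasCompactSupport.comp_homeomorph (Homeomorph.addRight (-x))
  simp only [sub_eq_add_neg]
  exact this

/-- The weight `(1 + ‖x‖)^{-(d+1)}`. -/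
noncomputable def decay (x : Euc d) : ℝ := ((1 + ‖x‖) ^ (d + 1))⁻¹

lemma decay_pos (x : Euc d) : 0 < decay x := by unfold decay; positivity

lemma continuous_decay : Continuous (decay : Euc d → ℝ) :=
  Continuous.inv₀ (by fun_prop) fun x => by positivity

lemma integrable_decay : Integrable (decay : Euc d → ℝ) := by
  have := integrable_one_add_norm (E := Euc d) (μ := volume) (r := ((d + 1 : ℕ) : ℝ)) (by simp)
  refine this.congr (Eventually.of_forall fun x => ?_)
  simp only [decay]
  rw [Real.rpow_neg (by positivity), Real.rpow_natCast]

lemma decay_le {x q : Euc d} (h : ‖q - x‖ ≤ 1) : decay x ≤ 2 ^ (d + 1) * decay q := by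
  have h1 : 1 + ‖q‖ ≤ 2 * (1 + ‖x‖) := by
    have : ‖q‖ ≤ ‖x‖ + ‖q - x‖ := by simpa using norm_add_le x (q - x)
    linarith [norm_nonneg x]
  have h2 : (1 + ‖q‖) ^ (d + 1) ≤ 2 ^ (d + 1) * (1 + ‖x‖) ^ (d + 1) := by
    rw [← mul_pow]
    exact pow_le_pow_left₀ (by positivity) h1 _
  unfold decay
  rw [inv_le_comm₀ (by positivity) (by positivity), mul_inv, inv_inv, inv_mul_le_iff₀ (by positivity)]
  exact h2

lemma TranslationBounded.measure_ball_le {B : ℝ} {μ : Measure (Euc d)}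
    [IsFiniteMeasureOnCompacts μ] (hμ : TranslationBounded B μ) (x : Euc d) :
    μ (Metric.ball x 1) ≤ ENNReal.ofReal B := by
  have hi : Integrable (fun y => bump (y - x)) μ :=
    (continuous_bump_sub x).integrable_of_hasCompactSupport (hasCompactSupport_bump_sub x)
  refine le_trans ?_ (ENNReal.ofReal_le_ofReal (hμ x))
  rw [ofReal_integral_eq_lintegral_ofReal hi (Eventually.of_forall fun y => bump.nonneg),
    ← lintegral_indicator_one measurableSet_ball]
  refine lintegral_mono fun y => ?_
  by_cases hy : y ∈ Metric.ball x 1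
  · rw [indicator_of_mem hy, bump.one_of_mem_closedBall]
    · simp
    · simpa [bump, mem_ball_iff_norm] using (mem_ball_iff_norm.1 hy).le
  · rw [indicator_of_notMem hy]
    exact zero_le

/-- Integrating `decay x` over pairs `(x, q)` at distance less than one gives the volume of the unit
ball times the integral against `μ`. For such pairs `decay x` is at most `2 ^ (d + 1) * decay q`;
exchanging the integrals and bounding the mass of unit balls by `B` leaves a Lebesgue integral. The
constant depends on `d` alone, which makes the tail estimates uniform over families of measures. -/
lemma exists_integral_decay_le (d : ℕ) : ∃ K : ℝ, 0 ≤ K ∧ ∀ (B : ℝ) (μ : Measure (Euc d))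
    [IsFiniteMeasureOnCompacts μ], 0 ≤ B → TranslationBounded B μ →
      Integrable decay μ ∧ ∫ x, decay x ∂μ ≤ K * B := by
  set V := volume.real (Metric.ball (0 : Euc d) 1) with hV
  have hVpos : 0 < V := ENNReal.toReal_pos (Metric.measure_ball_pos _ _ one_pos).ne'
    measure_ball_lt_top.ne
  have hVe : ∀ x : Euc d, volume (Metric.ball x 1) = ENNReal.ofReal V := by
    intro x
    rw [hV, measureReal_def, ENNReal.ofReal_toReal measure_ball_lt_top.ne,
      Measure.addHaar_ball_center]
  set I := ∫ x : Euc d, decay x with hI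
  have hI0 : 0 ≤ I := integral_nonneg fun x => (decay_pos x).le
  refine ⟨V⁻¹ * (2 ^ (d + 1) * I), by positivity, fun B μ _ hB hμ => ?_⟩
  have hm : Measurable fun x : Euc d => ENNReal.ofReal (decay x) :=
    continuous_decay.measurable.ennreal_ofReal
  have key : ENNReal.ofReal V * ∫⁻ x, ENNReal.ofReal (decay x) ∂μ ≤
      ENNReal.ofReal (2 ^ (d + 1) * I * B) := by
    have hset : MeasurableSet {p : Euc d × Euc d | dist p.2 p.1 < 1} :=
      measurableSet_lt (measurable_snd.dist measurable_fst) measurable_const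
    calc _ = ∫⁻ x, ∫⁻ q, (Metric.ball x 1).indicator
            (fun _ => ENNReal.ofReal (decay x)) q ∂volume ∂μ := by
          rw [← lintegral_const_mul _ hm]
          refine lintegral_congr fun x => ?_
          rw [lintegral_indicator_const measurableSet_ball, hVe, mul_comm]
      _ ≤ ∫⁻ x, ∫⁻ q, {p : Euc d × Euc d | dist p.2 p.1 < 1}.indicator
            (fun p => ENNReal.ofReal (2 ^ (d + 1) * decay p.2)) (x, q) ∂volume ∂μ := by
          refine lintegral_mono fun x => lintegral_mono fun q => ?_
          by_cases hq : q ∈ Metric.ball x 1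
          · rw [indicator_of_mem hq, indicator_of_mem (by simpa using hq)]
            exact ENNReal.ofReal_le_ofReal (decay_le (mem_ball_iff_norm.1 hq).le)
          · rw [indicator_of_notMem hq]
            exact zero_le
      _ = ∫⁻ q, ∫⁻ x, {p : Euc d × Euc d | dist p.2 p.1 < 1}.indicator
            (fun p => ENNReal.ofReal (2 ^ (d + 1) * decay p.2)) (x, q) ∂μ ∂volume := by
          refine lintegral_lintegral_swap ?_
          refine (Measurable.indicator ?_ hset).aemeasurable
          exact ((continuous_decay.measurable.comp measurable_snd).const_mul _).ennreal_ofReal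
      _ ≤ ∫⁻ q, ENNReal.ofReal (2 ^ (d + 1) * B * decay q) := by
          refine lintegral_mono fun q => ?_
          have e : (fun x => {p : Euc d × Euc d | dist p.2 p.1 < 1}.indicator
              (fun p => ENNReal.ofReal (2 ^ (d + 1) * decay p.2)) (x, q)) =
              (Metric.ball q 1).indicator
                (fun _ => ENNReal.ofReal (2 ^ (d + 1) * decay q)) := by
            funext x
            simp only [indicator, mem_ofPred_eq, Metric.mem_ball, dist_comm x q]
          rw [e, lintegral_indicator_const measurableSet_ball]
          refine (mul_le_mul_right (hμ.measure_ball_le q) _).trans ?_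
          rw [← ENNReal.ofReal_mul (mul_nonneg (by positivity) (decay_pos q).le)]
          refine ENNReal.ofReal_le_ofReal (le_of_eq (by ring))
      _ = _ := by
          rw [← ofReal_integral_eq_lintegral_ofReal (integrable_decay.const_mul _)
            (Eventually.of_forall fun q => mul_nonneg (by positivity) (decay_pos q).le),
            integral_const_mul]
          congr 1
          ring
  have hlt : ∫⁻ x, ENNReal.ofReal (decay x) ∂μ < ⊤ := by
    refine lt_top_iff_ne_top.2 fun h => ?_
    rw [h, ENNReal.mul_top (by simpa using hVpos)] at key
    exact ENNReal.ofReal_ne_top (top_le_iff.1 key)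
  have hint : Integrable decay μ := by
    refine ⟨continuous_decay.aestronglyMeasurable, ?_⟩
    rwa [hasFiniteIntegral_iff_ofReal (Eventually.of_forall fun x => (decay_pos x).le)]
  refine ⟨hint, ?_⟩
  rw [← ofReal_integral_eq_lintegral_ofReal hint (Eventually.of_forall fun x => (decay_pos x).le),
    ← ENNReal.ofReal_mul hVpos.le, ENNReal.ofReal_le_ofReal_iff (by positivity)] at key
  rw [mul_assoc, inv_mul_eq_div, le_div_iff₀ hVpos]
  linarith

lemma TranslationBounded.integrable_decay {B : ℝ} (hB : 0 ≤ B) {μ : Measure (Euc d)}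
    [IsFiniteMeasureOnCompacts μ] (hμ : TranslationBounded B μ) : Integrable decay μ := by
  obtain ⟨K, -, hK⟩ := exists_integral_decay_le d
  exact (hK B μ hB hμ).1

lemma TranslationBounded.hasTemperateGrowth {B : ℝ} (hB : 0 ≤ B) {μ : Measure (Euc d)}
    [IsFiniteMeasureOnCompacts μ] (hμ : TranslationBounded B μ) : μ.HasTemperateGrowth := by
  refine ⟨d + 1, (hμ.integrable_decay hB).congr (Eventually.of_forall fun x => ?_)⟩
  simp only [decay]
  rw [Real.rpow_neg (by positivity), Real.rpow_natCast]

/-- Schwartz functions decay faster than the weight `decay`. -/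
lemma exists_norm_schwartz_le (ψ : 𝓢(Euc d, ℂ)) :
    ∃ A : ℝ, 0 ≤ A ∧ ∀ x, ‖ψ x‖ ≤ A * decay x * (1 + ‖x‖)⁻¹ := by
  -- The exponent `d + 2` is one more than in `decay`; the spare factor `(1 + ‖x‖)⁻¹` controls the
  -- tails later on.
  refine ⟨2 ^ (d + 2) * ((Finset.Iic (d + 2, 0)).sup
    fun m => SchwartzMap.seminorm ℝ m.1 m.2) ψ, by positivity, fun x => ?_⟩
  have := SchwartzMap.one_add_le_sup_seminorm_apply (𝕜 := ℝ) (m := (d + 2, 0)) (k := d + 2)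
    (n := 0) le_rfl le_rfl ψ x
  rw [norm_iteratedFDeriv_zero] at this
  rw [decay, mul_assoc, ← mul_inv, ← pow_succ, ← div_eq_mul_inv, le_div_iff₀ (by positivity),
    mul_comm]
  exact this

lemma exists_norm_schwartz_le_decay (ψ : 𝓢(Euc d, ℂ)) :
    ∃ A : ℝ, 0 ≤ A ∧ ∀ x, ‖ψ x‖ ≤ A * decay x := by
  obtain ⟨A, hA, h⟩ := exists_norm_schwartz_le ψ
  refine ⟨A, hA, fun x => (h x).trans ?_⟩
  refine mul_le_of_le_one_right (mul_nonneg hA (decay_pos x).le) (inv_le_one_of_one_le₀ ?_)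
  linarith [norm_nonneg x]

/-! ### Vague convergence of translation bounded measures -/

/-- Vague convergence along a filter. -/
def VagueTendsto {ι : Type*} (l : Filter ι) (μ : ι → Measure (Euc d)) (ν : Measure (Euc d)) :
    Prop := ∀ φ : Euc d → ℝ, Continuous φ → HasCompactSupport φ →
      Tendsto (fun i => ∫ x, φ x ∂μ i) l (𝓝 (∫ x, φ x ∂ν))

lemma VagueTendsto.translationBounded {ι : Type*} {l : Filter ι} [l.NeBot]
    {μ : ι → Measure (Euc d)} {ν : Measure (Euc d)} (h : VagueTendsto l μ ν) {B : ℝ}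
    (hμ : ∀ i, TranslationBounded B (μ i)) : TranslationBounded B ν := fun x =>
  le_of_tendsto (h _ (continuous_bump_sub x) (hasCompactSupport_bump_sub x))
    (Eventually.of_forall fun i => hμ i x)

lemma VagueTendsto.tendsto_complex {ι : Type*} {l : Filter ι}
    {μ : ι → Measure (Euc d)} {ν : Measure (Euc d)} [∀ i, IsFiniteMeasureOnCompacts (μ i)]
    [IsFiniteMeasureOnCompacts ν] (h : VagueTendsto l μ ν) {f : Euc d → ℂ} (hf : Continuous f)
    (hc : HasCompactSupport f) : Tendsto (fun i => ∫ x, f x ∂μ i) l (𝓝 (∫ x, f x ∂ν)) := by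
  have key : ∀ (ρ : Measure (Euc d)) [IsFiniteMeasureOnCompacts ρ], ∫ x, f x ∂ρ =
      ((∫ x, (f x).re ∂ρ : ℝ) : ℂ) + ((∫ x, (f x).im ∂ρ : ℝ) : ℂ) * Complex.I := fun ρ _ =>
    (integral_re_add_im (𝕜 := ℂ) (hf.integrable_of_hasCompactSupport hc)).symm
  have hre := h (fun x => (f x).re) (Complex.continuous_re.comp hf) (hc.comp_left Complex.zero_re)
  have him := h (fun x => (f x).im) (Complex.continuous_im.comp hf) (hc.comp_left Complex.zero_im)
  rw [key ν]
  simp only [key]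
  exact ((Complex.continuous_ofReal.tendsto _).comp hre).add
    (((Complex.continuous_ofReal.tendsto _).comp him).mul_const _)

/-- Under uniform translation boundedness, vague convergence implies convergence of the integrals
of Schwartz functions. -/
lemma VagueTendsto.tendsto_schwartz {ι : Type*} {l : Filter ι}
    {μ : ι → Measure (Euc d)} {ν : Measure (Euc d)} [∀ i, IsFiniteMeasureOnCompacts (μ i)]
    [IsFiniteMeasureOnCompacts ν] (h : VagueTendsto l μ ν) {B : ℝ} (hB : 0 ≤ B)
    (hμ : ∀ i, TranslationBounded B (μ i)) (hν : TranslationBounded B ν) (ψ : 𝓢(Euc d, ℂ)) :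
    Tendsto (fun i => ∫ x, ψ x ∂μ i) l (𝓝 (∫ x, ψ x ∂ν)) := by
  obtain ⟨K, hK0, hK⟩ := exists_integral_decay_le d
  obtain ⟨A, hA, hψ⟩ := exists_norm_schwartz_le ψ
  rw [Metric.tendsto_nhds]
  intro ε hε
  -- Cutting off outside the ball of radius `R` costs at most `A * (K * B) / R`; the summand `1`
  -- makes this strictly smaller than `ε / 3`.
  obtain ⟨R, hR⟩ := exists_nat_ge (3 * (A * (K * B) + 1) / ε)
  have hRpos : (0 : ℝ) < R := lt_of_lt_of_le (by positivity) hR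
  let χ : ContDiffBump (0 : Euc d) := ⟨R, R + 1, hRpos, by linarith⟩
  set g : Euc d → ℂ := fun x => (χ x : ℂ) * ψ x with hg
  have hgc : Continuous g := (Complex.continuous_ofReal.comp χ.continuous).mul ψ.continuous
  have hgs : HasCompactSupport g :=
    (χ.hasCompactSupport.comp_left Complex.ofReal_zero).mul_right
  have hclose : ∀ (ρ : Measure (Euc d)) [IsFiniteMeasureOnCompacts ρ], TranslationBounded B ρ →
      dist (∫ x, ψ x ∂ρ) (∫ x, g x ∂ρ) < ε / 3 := by
    intro ρ _ hρ
    obtain ⟨hi, hle⟩ := hK B ρ hB hρ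
    have hψi : Integrable ψ ρ := by
      obtain ⟨A', hA', h'⟩ := exists_norm_schwartz_le_decay ψ
      exact (hi.const_mul A').mono' ψ.continuous.aestronglyMeasurable (Eventually.of_forall h')
    rw [dist_eq_norm, ← integral_sub hψi (hgc.integrable_of_hasCompactSupport hgs)]
    have hb : ∀ x, ‖ψ x - g x‖ ≤ A * (R : ℝ)⁻¹ * decay x := by
      intro x
      have hd := (decay_pos x).le
      have e : ψ x - g x = ((1 - χ x : ℝ) : ℂ) * ψ x := by
        simp only [hg]; push_cast; ring
      have h01 : 0 ≤ 1 - χ x := sub_nonneg.2 χ.le_one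
      rw [e, norm_mul, Complex.norm_real, Real.norm_of_nonneg h01]
      by_cases hx : ‖x‖ ≤ R
      · rw [χ.one_of_mem_closedBall (by simpa using hx), sub_self, zero_mul]
        positivity
      · have h1 : (1 + ‖x‖)⁻¹ ≤ (R : ℝ)⁻¹ := inv_anti₀ hRpos (by linarith [not_le.1 hx])
        calc _ ≤ 1 * (A * decay x * (1 + ‖x‖)⁻¹) :=
              mul_le_mul (by linarith [χ.nonneg (x := x)]) (hψ x) (norm_nonneg _) zero_le_one
          _ ≤ A * decay x * (R : ℝ)⁻¹ := by
              rw [one_mul]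
              exact mul_le_mul_of_nonneg_left h1 (mul_nonneg hA hd)
          _ = _ := by ring
    refine (norm_integral_le_of_norm_le (hi.const_mul _) (Eventually.of_forall hb)).trans_lt ?_
    rw [integral_const_mul]
    have h3 : A * (R : ℝ)⁻¹ * ∫ x, decay x ∂ρ ≤ A * (R : ℝ)⁻¹ * (K * B) :=
      mul_le_mul_of_nonneg_left hle (by positivity)
    refine h3.trans_lt ?_
    rw [div_le_iff₀ hε] at hR
    rw [show A * (R : ℝ)⁻¹ * (K * B) = A * (K * B) / R by ring, div_lt_iff₀ hRpos]
    linarith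
  filter_upwards [Metric.tendsto_nhds.1 (h.tendsto_complex hgc hgs) (ε / 3) (by positivity)] with i hi
  have h1 := hclose (μ i) (hμ i)
  have h2 := hclose ν hν
  rw [dist_comm] at h2
  linarith [dist_triangle4 (∫ x, ψ x ∂μ i) (∫ x, g x ∂μ i) (∫ x, g x ∂ν) (∫ x, ψ x ∂ν)]

/-- Uniformly translation bounded sequences of measures converge vaguely along ultrafilters. -/
lemma exists_vagueTendsto {ι : Type*} (l : Ultrafilter ι) {μ : ι → Measure (Euc d)}
    [∀ i, IsFiniteMeasureOnCompacts (μ i)] {B : ℝ} (hB : 0 ≤ B)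
    (hμ : ∀ i, TranslationBounded B (μ i)) :
    ∃ ν : Measure (Euc d), IsFiniteMeasureOnCompacts ν ∧ VagueTendsto l μ ν := by
  obtain ⟨K, hK0, hK⟩ := exists_integral_decay_le d
  have hint : ∀ (i) (φ : CompactlySupportedContinuousMap (Euc d) ℝ), Integrable φ (μ i) :=
    fun i φ => φ.continuous.integrable_of_hasCompactSupport φ.hasCompactSupport
  have hlim : ∀ φ : CompactlySupportedContinuousMap (Euc d) ℝ, ∃ c : ℝ,
      Tendsto (fun i => ∫ x, φ x ∂μ i) l (𝓝 c) := by
    intro φ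
    -- Since `φ / decay` is bounded, the integrals of `φ` stay in a compact ball that does not
    -- depend on `i`, and the ultrafilter picks a limit. These limits form a positive linear
    -- functional.
    have hq : Continuous fun x => φ x * (decay x)⁻¹ :=
      φ.continuous.mul (continuous_decay.inv₀ fun x => (decay_pos x).ne')
    obtain ⟨A, hA⟩ := (φ.hasCompactSupport.mul_right (f' := fun x => (decay x)⁻¹)).exists_bound_of_continuous hq
    have hA0 : 0 ≤ A := (norm_nonneg _).trans (hA 0)
    have hb : ∀ i, ∫ x, φ x ∂μ i ∈ Metric.closedBall (0 : ℝ) (A * (K * B)) := by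
      intro i
      obtain ⟨hi, hle⟩ := hK B (μ i) hB (hμ i)
      rw [mem_closedBall_zero_iff]
      refine (norm_integral_le_of_norm_le (hi.const_mul A) (Eventually.of_forall fun x => ?_)).trans ?_
      · have : ‖φ x * (decay x)⁻¹‖ ≤ A := hA x
        rwa [norm_mul, norm_inv, Real.norm_of_nonneg (decay_pos x).le, ← div_eq_mul_inv,
          div_le_iff₀ (decay_pos x)] at this
      · rw [integral_const_mul]
        exact mul_le_mul_of_nonneg_left hle hA0
    obtain ⟨c, -, hc⟩ := (isCompact_closedBall (0 : ℝ) (A * (K * B))).ultrafilter_le_nhds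
      (l.map fun i => ∫ x, φ x ∂μ i) (by
        rw [Ultrafilter.coe_map, le_principal_iff]
        exact Filter.mem_map.2 (univ_mem' hb))
    exact ⟨c, hc⟩
  choose m hm using hlim
  let L : CompactlySupportedContinuousMap (Euc d) ℝ →ₚ[ℝ] ℝ := PositiveLinearMap.mk₀
    { toFun := m
      map_add' := fun f g => tendsto_nhds_unique (hm (f + g)) (by
        refine ((hm f).add (hm g)).congr fun i => ?_
        rw [← integral_add (hint i f) (hint i g)]
        rfl)
      map_smul' := fun a f => tendsto_nhds_unique (hm (a • f)) (by
        refine ((hm f).const_mul a).congr fun i => ?_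
        rw [← integral_const_mul]
        rfl) }
    (fun f hf => ge_of_tendsto (hm f) (Eventually.of_forall fun i =>
      integral_nonneg fun x => hf x))
  refine ⟨RealRMK.rieszMeasure L, inferInstance, fun φ hφ hc => ?_⟩
  have := RealRMK.integral_rieszMeasure L ⟨⟨φ, hφ⟩, hc⟩
  have h2 := hm ⟨⟨φ, hφ⟩, hc⟩
  have h3 : ∫ x, φ x ∂(RealRMK.rieszMeasure L) = m ⟨⟨φ, hφ⟩, hc⟩ := this
  rw [h3]
  exact h2

/-! ### Diffraction -/

/-- The normalised autocorrelation of a finite window. -/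
noncomputable def windowAutocorrelation (Λ A : Set (Euc d)) : Measure (Euc d) :=
  ENNReal.ofReal (volume.real A)⁻¹ • windowCorrelation Λ A

lemma IsDelone.isFiniteMeasure_windowAutocorrelation {Λ : Set (Euc d)} (hΛ : IsDelone Λ)
    {A : Set (Euc d)} (hA : Bornology.IsBounded A) (hA' : MeasurableSet A) :
    IsFiniteMeasure (windowAutocorrelation Λ A) := by
  have := hΛ.isFiniteMeasure_windowCorrelation hA hA'
  exact Measure.smul_finite _ ENNReal.ofReal_ne_top

lemma IsDelone.integral_windowAutocorrelation {Λ : Set (Euc d)} (hΛ : IsDelone Λ)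
    {A : Set (Euc d)} (hA : Bornology.IsBounded A) (hA' : MeasurableSet A) {f : Euc d → ℂ}
    (hf : Continuous f) {M : ℝ} (hM : ∀ x, ‖f x‖ ≤ M) :
    ∫ z, f z ∂windowAutocorrelation Λ A = ((volume.real A : ℝ) : ℂ)⁻¹ * pairComb Λ f A := by
  rw [windowAutocorrelation, integral_smul_measure, hΛ.integral_windowCorrelation hA hA' hf hM,
    ENNReal.toReal_ofReal (inv_nonneg.2 measureReal_nonneg), Complex.real_smul, Complex.ofReal_inv]

lemma IsAutocorrelation.vagueTendsto {Λ : Set (Euc d)} {F : ℕ → Set (Euc d)}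
    {γ : Measure (Euc d)} (h : IsAutocorrelation Λ F γ) :
    VagueTendsto atTop (fun n => windowAutocorrelation Λ (F n)) γ := by
  intro φ hφ hc
  refine (h.2 φ hφ hc).congr fun n => ?_
  beta_reduce
  rw [windowAutocorrelation, integral_smul_measure,
    ENNReal.toReal_ofReal (inv_nonneg.2 measureReal_nonneg)]
  rfl

/-- For fixed `x` only the points `y` within `R` of `x - c` contribute, and their number is bounded
by `N`. The independence of `N` from `c` is what yields translation boundedness. -/
lemma IsDelone.exists_norm_pairComb_le {Λ : Set (Euc d)} (hΛ : IsDelone Λ) (R : ℝ) :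
    ∃ N : ℝ, 0 ≤ N ∧ ∀ (φ : Euc d → ℂ) (c : Euc d), (∀ z, ‖φ z‖ ≤ 1) →
      (∀ z, z ∉ Metric.closedBall c R → φ z = 0) → ∀ A, Bornology.IsBounded A →
        ‖pairComb Λ φ A‖ ≤ N * (Λ ∩ A).ncard := by
  classical
  obtain ⟨N, hN, H⟩ := hΛ.exists_ncard_ball_le R
  refine ⟨N, hN.le, fun φ c h1 h0 A hA => hΛ.norm_comb_le (fun p _ => ?_) hA⟩
  rw [hΛ.comb_eq_sum _ hA]
  set B := (hΛ.finite_inter (Metric.isBounded_closedBall (x := p - c) (r := R))).toFinset with hB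
  calc _ ≤ ∑ y ∈ (hΛ.finite_inter hA).toFinset, if y ∈ B then (1 : ℝ) else 0 := by
        refine norm_sum_le_of_le _ fun y hy => ?_
        have hy' : y ∈ Λ ∧ y ∈ A := by simpa using hy
        split_ifs with h
        · exact h1 _
        · rw [h0, norm_zero]
          intro hz
          refine h ((Finite.mem_toFinset _).2 ⟨hy'.1, ?_⟩)
          rw [mem_closedBall_iff_norm] at hz ⊢
          rwa [norm_sub_rev, show p - c - y = p - y - c by abel]
    _ ≤ B.card := by
        rw [Finset.sum_boole]
        exact_mod_cast Finset.card_le_card fun y hy => (Finset.mem_filter.1 hy).2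
    _ ≤ N := by
        rw [hB, ← Set.ncard_eq_toFinset_card _
          (hΛ.finite_inter (Metric.isBounded_closedBall (x := p - c) (r := R)))]
        exact H _

/-- With difference zero every point of `Λ` is marked, so these numbers form a convergent sequence.
-/
lemma IsDelone.exists_ncard_le {Λ : Set (Euc d)} (hΛ : IsDelone Λ) {F : ℕ → Set (Euc d)}
    (hF : IsVanHove F) {c : ℂ} (hc : HasDensity (comb Λ (pairWeight Λ 0)) c) :
    ∃ C : ℝ, 0 ≤ C ∧ ∀ n, (volume.real (F n))⁻¹ * (Λ ∩ F n).ncard ≤ C := by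
  obtain ⟨C, hC⟩ := (hc.tendsto hF).norm.bddAbove_range
  have h : ∀ n, (volume.real (F n))⁻¹ * (Λ ∩ F n).ncard ≤ C := by
    intro n
    have := hC ⟨n, rfl⟩
    have e : comb Λ (pairWeight Λ 0) (F n) = ((Λ ∩ F n).ncard : ℂ) := by
      refine (hΛ.comb_boole _ (hF.bounded n)).trans ?_
      congr 2
      ext y
      simp +contextual
    beta_reduce at this
    rwa [e, norm_mul, norm_inv, Complex.norm_real, Real.norm_of_nonneg measureReal_nonneg,
      Complex.norm_natCast] at this
  exact ⟨C, (mul_nonneg (inv_nonneg.2 measureReal_nonneg) (Nat.cast_nonneg _)).trans (h 0), h⟩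

lemma norm_bump_sub_le (c x : Euc d) : ‖(bump (x - c) : ℂ)‖ ≤ 1 := by
  rw [Complex.norm_real, Real.norm_of_nonneg bump.nonneg]
  exact bump.le_one

lemma IsDelone.exists_translationBounded_windowAutocorrelation {Λ : Set (Euc d)}
    (hΛ : IsDelone Λ) {F : ℕ → Set (Euc d)} (hF : IsVanHove F) {c : ℂ}
    (hc : HasDensity (comb Λ (pairWeight Λ 0)) c) :
    ∃ B : ℝ, 0 ≤ B ∧ ∀ n, TranslationBounded B (windowAutocorrelation Λ (F n)) := by
  obtain ⟨C, hC0, hC⟩ := hΛ.exists_ncard_le hF hc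
  -- `2` is the outer radius of `bump`.
  obtain ⟨N, hN, H⟩ := hΛ.exists_norm_pairComb_le 2
  refine ⟨N * C, by positivity, fun n c => ?_⟩
  have e := hΛ.integral_windowAutocorrelation (hF.bounded n) (hF.measurable n)
    (Complex.continuous_ofReal.comp (continuous_bump_sub c)) (norm_bump_sub_le c)
  simp only [Function.comp_apply] at e
  rw [integral_complex_ofReal] at e
  refine (le_abs_self _).trans ?_
  rw [← Real.norm_eq_abs, ← Complex.norm_real, e, norm_mul, norm_inv, Complex.norm_real,
    Real.norm_of_nonneg measureReal_nonneg]
  have := H (fun x => (bump (x - c) : ℂ)) c (norm_bump_sub_le c) (fun z hz => ?_) _ (hF.bounded n)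
  · calc _ ≤ (volume.real (F n))⁻¹ * (N * (Λ ∩ F n).ncard) :=
          mul_le_mul_of_nonneg_left this (inv_nonneg.2 measureReal_nonneg)
      _ = N * ((volume.real (F n))⁻¹ * (Λ ∩ F n).ncard) := by ring
      _ ≤ _ := mul_le_mul_of_nonneg_left (hC n) hN
  · rw [bump.zero_of_le_dist, Complex.ofReal_zero]
    have := not_le.1 (fun h => hz (mem_closedBall_iff_norm.2 h))
    simpa [bump] using this.le

/-- The exponential sum `∑_{x ∈ Λ ∩ A} e^{-2πi⟨x, k⟩}`. -/
noncomputable def expSum (Λ A : Set (Euc d)) (k : Euc d) : ℂ :=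
  comb Λ (fun x => Complex.exp (((-2 * Real.pi * inner ℝ k x : ℝ) : ℂ) * Complex.I)) A

/-- The normalised diffraction intensity of a finite window. -/
noncomputable def windowIntensity (Λ A : Set (Euc d)) : Measure (Euc d) :=
  volume.withDensity fun k => ENNReal.ofReal ((volume.real A)⁻¹ * ‖expSum Λ A k‖ ^ 2)

lemma IsDelone.continuous_expSum {Λ : Set (Euc d)} (hΛ : IsDelone Λ) {A : Set (Euc d)}
    (hA : Bornology.IsBounded A) : Continuous (expSum Λ A) := by
  unfold expSum
  simp only [hΛ.comb_eq_sum _ hA]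
  fun_prop

lemma IsDelone.isLocallyFiniteMeasure_windowIntensity {Λ : Set (Euc d)} (hΛ : IsDelone Λ)
    {A : Set (Euc d)} (hA : Bornology.IsBounded A) :
    IsLocallyFiniteMeasure (windowIntensity Λ A) :=
  IsLocallyFiniteMeasure.withDensity_ofReal
    (continuous_const.mul ((hΛ.continuous_expSum hA).norm.pow 2))

lemma IsDelone.norm_sq_expSum {Λ : Set (Euc d)} (hΛ : IsDelone Λ) {A : Set (Euc d)}
    (hA : Bornology.IsBounded A) (k : Euc d) :
    ((‖expSum Λ A k‖ ^ 2 : ℝ) : ℂ) = ∑ x ∈ (hΛ.finite_inter hA).toFinset,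
      ∑ y ∈ (hΛ.finite_inter hA).toFinset,
        Complex.exp (((-2 * Real.pi * inner ℝ k (x - y) : ℝ) : ℂ) * Complex.I) := by
  rw [Complex.ofReal_pow, ← Complex.mul_conj', expSum, hΛ.comb_eq_sum _ hA, map_sum,
    Finset.sum_mul_sum]
  refine Finset.sum_congr rfl fun x _ => Finset.sum_congr rfl fun y _ => ?_
  rw [← Complex.exp_conj, ← Complex.exp_add, inner_sub_right]
  congr 1
  simp only [map_mul, Complex.conj_ofReal, Complex.conj_I]
  push_cast
  ring

/-- The intensity of a window is the Fourier transform of its autocorrelation. -/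
lemma IsDelone.integral_windowIntensity {Λ : Set (Euc d)} (hΛ : IsDelone Λ) {A : Set (Euc d)}
    (hA : Bornology.IsBounded A) (ψ : 𝓢(Euc d, ℂ)) :
    ∫ k, ψ k ∂windowIntensity Λ A =
      ((volume.real A : ℝ) : ℂ)⁻¹ * pairComb Λ (fun z => (𝓕 ψ) z) A := by
  have hm : Measurable fun k => ENNReal.ofReal ((volume.real A)⁻¹ * ‖expSum Λ A k‖ ^ 2) :=
    (continuous_const.mul ((hΛ.continuous_expSum hA).norm.pow 2)).measurable.ennreal_ofReal
  have hi : ∀ z : Euc d, Integrable fun k =>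
      Complex.exp (((-2 * Real.pi * inner ℝ k z : ℝ) : ℂ) * Complex.I) * ψ k := by
    intro z
    refine (ψ.integrable (μ := volume)).norm.mono' ?_ (Eventually.of_forall fun k => ?_)
    · have := ψ.continuous
      exact Continuous.aestronglyMeasurable (by fun_prop)
    · rw [norm_mul, Complex.norm_exp_ofReal_mul_I, one_mul]
  rw [windowIntensity, integral_withDensity_eq_integral_toReal_smul hm
    (Eventually.of_forall fun _ => ENNReal.ofReal_lt_top), hΛ.pairComb_eq_sum _ hA,
    SchwartzMap.fourier_coe]
  simp only [Real.fourier_eq', smul_eq_mul]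
  calc _ = ∫ k, ((volume.real A : ℝ) : ℂ)⁻¹ * ∑ x ∈ (hΛ.finite_inter hA).toFinset,
        ∑ y ∈ (hΛ.finite_inter hA).toFinset,
          Complex.exp (((-2 * Real.pi * inner ℝ k (x - y) : ℝ) : ℂ) * Complex.I) * ψ k := by
        refine integral_congr_ae (Eventually.of_forall fun k => ?_)
        beta_reduce
        rw [ENNReal.toReal_ofReal (mul_nonneg (inv_nonneg.2 measureReal_nonneg) (by positivity)),
          Complex.real_smul, Complex.ofReal_mul, hΛ.norm_sq_expSum hA, Complex.ofReal_inv,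
          mul_assoc, Finset.sum_mul]
        simp only [Finset.sum_mul]
    _ = _ := by
        rw [integral_const_mul, integral_finsetSum _ fun x _ =>
          integrable_finsetSum _ fun y _ => hi _]
        congr 1
        refine Finset.sum_congr rfl fun x _ => ?_
        rw [integral_finsetSum _ fun y _ => hi _]

lemma norm_fourier_comp_sub (f : Euc d → ℂ) (c ξ : Euc d) :
    ‖𝓕 (fun x => f (x - c)) ξ‖ = ‖𝓕 f ξ‖ := by
  have := congrFun (VectorFourier.fourierIntegral_comp_add_right Real.fourierChar volume
    (innerₗ (Euc d)) f (-c)) ξ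
  have h2 : 𝓕 (fun x => f (x - c)) ξ =
      Real.fourierChar (innerₗ (Euc d) (-c) ξ) • 𝓕 f ξ := by
    simp only [sub_eq_add_neg]
    exact this
  rw [h2, Circle.norm_smul]

/-- The Schwartz function given by a translate of `bump`. -/
noncomputable def bumpSchwartz (c : Euc d) : 𝓢(Euc d, ℂ) :=
  ((hasCompactSupport_bump_sub c).comp_left Complex.ofReal_zero :
    HasCompactSupport (Complex.ofReal ∘ fun x => bump (x - c))).toSchwartzMap
    (Complex.ofRealCLM.contDiff.comp (bump.contDiff.comp (contDiff_id.sub contDiff_const)))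

lemma bumpSchwartz_apply (c x : Euc d) : bumpSchwartz c x = (bump (x - c) : ℂ) := rfl

/-- A translation changes the Fourier transform by a phase only, so the estimate for `c = 0` holds
for all `c`. -/
lemma exists_norm_fourier_bumpSchwartz_le (d : ℕ) :
    ∃ A : ℝ, 0 ≤ A ∧ ∀ c ξ : Euc d, ‖(𝓕 (bumpSchwartz c)) ξ‖ ≤ A * decay ξ := by
  obtain ⟨A, hA, h⟩ := exists_norm_schwartz_le_decay (𝓕 (bumpSchwartz (0 : Euc d)))
  refine ⟨A, hA, fun c ξ => le_trans (le_of_eq ?_) (h ξ)⟩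
  rw [SchwartzMap.fourier_coe, SchwartzMap.fourier_coe]
  refine Eq.trans ?_ (norm_fourier_comp_sub (bumpSchwartz 0) c ξ)
  have e : (bumpSchwartz c : Euc d → ℂ) = fun x => bumpSchwartz 0 (x - c) := by
    funext x
    simp only [bumpSchwartz_apply, sub_zero]
  rw [e]

lemma exists_norm_le_schwartz (ψ : 𝓢(Euc d, ℂ)) : ∃ M, ∀ x, ‖ψ x‖ ≤ M := by
  obtain ⟨A, hA, h⟩ := exists_norm_schwartz_le_decay ψ
  refine ⟨A, fun x => (h x).trans (mul_le_of_le_one_right hA (inv_le_one_of_one_le₀ ?_))⟩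
  exact one_le_pow₀ (by linarith [norm_nonneg x])

lemma IsDelone.integral_windowIntensity_eq {Λ : Set (Euc d)} (hΛ : IsDelone Λ) {A : Set (Euc d)}
    (hA : Bornology.IsBounded A) (hA' : MeasurableSet A) (ψ : 𝓢(Euc d, ℂ)) :
    ∫ k, ψ k ∂windowIntensity Λ A = ∫ z, (𝓕 ψ) z ∂windowAutocorrelation Λ A := by
  obtain ⟨M, hM⟩ := exists_norm_le_schwartz (𝓕 ψ)
  rw [hΛ.integral_windowIntensity hA,
    hΛ.integral_windowAutocorrelation hA hA' (𝓕 ψ).continuous hM]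

/-- The intensity integrates the bump at `c` to the integral of its Fourier transform against the
window autocorrelation. This is at most `A` times the integral of `decay`, which is bounded
uniformly in the window. -/
lemma IsDelone.exists_translationBounded_windowIntensity {Λ : Set (Euc d)} (hΛ : IsDelone Λ)
    {F : ℕ → Set (Euc d)} (hF : IsVanHove F) {B : ℝ} (hB : 0 ≤ B)
    (hγ : ∀ n, TranslationBounded B (windowAutocorrelation Λ (F n))) :
    ∃ B' : ℝ, 0 ≤ B' ∧ ∀ n, TranslationBounded B' (windowIntensity Λ (F n)) := by
  obtain ⟨K, hK0, hK⟩ := exists_integral_decay_le d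
  obtain ⟨A, hA, H⟩ := exists_norm_fourier_bumpSchwartz_le d
  refine ⟨A * (K * B), by positivity, fun n c => ?_⟩
  have := hΛ.isFiniteMeasure_windowAutocorrelation (hF.bounded n) (hF.measurable n)
  obtain ⟨hi, hle⟩ := hK B _ hB (hγ n)
  have e := hΛ.integral_windowIntensity_eq (hF.bounded n) (hF.measurable n) (bumpSchwartz c)
  simp only [bumpSchwartz_apply] at e
  rw [integral_complex_ofReal] at e
  refine (le_abs_self _).trans ?_
  rw [← Real.norm_eq_abs, ← Complex.norm_real, e]
  refine (norm_integral_le_of_norm_le (hi.const_mul A) (Eventually.of_forall (H c))).trans ?_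
  rw [integral_const_mul]
  exact mul_le_mul_of_nonneg_left hle hA

/-- The autocorrelation has a Fourier transform which is a positive measure. -/
lemma IsDelone.exists_isFourierTransform {Λ : Set (Euc d)} (hΛ : IsDelone Λ)
    {F : ℕ → Set (Euc d)} (hF : IsVanHove F) {c : ℂ}
    (hc : HasDensity (comb Λ (pairWeight Λ 0)) c) {γ : Measure (Euc d)}
    (hγ : IsAutocorrelation Λ F γ) :
    ∃ σ : Measure (Euc d), IsFourierTransform γ σ ∧ ∀ ψ : 𝓢(Euc d, ℂ),
      Integrable (fun z => (𝓕 ψ) z) γ ∧ ∫ k, ψ k ∂σ = ∫ z, (𝓕 ψ) z ∂γ := by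
  have hγfin := hγ.1
  obtain ⟨B, hB, hγB⟩ := hΛ.exists_translationBounded_windowAutocorrelation hF hc
  obtain ⟨B', hB', hσB⟩ := hΛ.exists_translationBounded_windowIntensity hF hB hγB
  have i1 := fun n => hΛ.isFiniteMeasure_windowAutocorrelation (hF.bounded n) (hF.measurable n)
  have i2 := fun n => hΛ.isLocallyFiniteMeasure_windowIntensity (hF.bounded n)
  -- A limit along one ultrafilter finer than `atTop` is enough: the autocorrelations converge
  -- anyway, and passing to the limit in the identity for finite windows determines the integrals of
  -- all Schwartz functions against `σ`.
  obtain ⟨σ, hσfin, hσ⟩ := exists_vagueTendsto (hyperfilter ℕ) hB' hσB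
  have hle : (hyperfilter ℕ : Filter ℕ) ≤ atTop := by
    rw [← Nat.cofinite_eq_atTop]
    exact hyperfilter_le_cofinite
  have hγ' := hγ.vagueTendsto
  have tγ := hγ'.translationBounded hγB
  have tσ := hσ.translationBounded hσB
  have gγ := tγ.hasTemperateGrowth hB
  have gσ := tσ.hasTemperateGrowth hB'
  have key : ∀ ψ : 𝓢(Euc d, ℂ), ∫ k, ψ k ∂σ = ∫ z, (𝓕 ψ) z ∂γ := by
    intro ψ
    refine tendsto_nhds_unique (hσ.tendsto_schwartz hB' hσB tσ ψ) ?_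
    simp only [hΛ.integral_windowIntensity_eq (hF.bounded _) (hF.measurable _)]
    exact (hγ'.tendsto_schwartz hB hγB tγ (𝓕 ψ)).mono_left hle
  refine ⟨σ, ⟨gγ, gσ, ?_⟩, fun ψ => ⟨(𝓕 ψ).integrable, key ψ⟩⟩
  ext ψ
  rw [TemperedDistribution.fourier_apply]
  exact (Measure.toTemperedDistribution_apply γ (𝓕 ψ)).trans
    ((key ψ).symm.trans (Measure.toTemperedDistribution_apply σ ψ).symm)

/-! ### The asymptotic cycle -/

lemma weaklyEquivariant_hodgeStar {Λ : Set (Euc d)} (hΛ : IsDelone Λ)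
    (hFLC : FiniteLocalComplexity Λ) (η : Forms Λ d) : WeaklyEquivariant Λ (hodgeStar η) :=
  (isEquivariant_hodgeStar η).weaklyEquivariant hΛ hFLC (contDiff_hodgeStar η)

/-- The mean of the Hodge star is a linear functional. -/
lemma IsDelone.exists_current {Λ : Set (Euc d)} (hΛ : IsDelone Λ)
    (hFLC : FiniteLocalComplexity Λ) {F : ℕ → Set (Euc d)} (hF : IsVanHove F)
    (hUCF : UniformClusterFrequencies Λ F) :
    ∃ C : Current Λ d, ∀ η, HasMean (hodgeStar η) (C η) := by
  have hw := weaklyEquivariant_hodgeStar hΛ hFLC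
  choose c hc using fun η => hΛ.exists_hasMean hFLC hF hUCF (hw η)
  have hi : ∀ (η : Forms Λ d) A, Bornology.IsBounded A → IntegrableOn (hodgeStar η) A := by
    intro η A hA
    obtain ⟨M, hM⟩ := (hw η).bounded
    exact integrableOn_of_bound (hw η).measurable hM hA
  exact ⟨{ toFun := c
           map_add' := fun η θ =>
             HasDensity.unique (hc (η + θ)) ((hc η).add (hc θ) (hi η) (hi θ)) hF
           map_smul' := fun a η => HasDensity.unique (hc (a • η)) ((hc η).const_mul a) hF }, hc⟩

/-- Whichever invariant measure and extension are used, the integral is the mean of the Hodge star.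
-/
lemma isAsymptoticCycle_iff {Λ : Set (Euc d)} (hΛ : IsDelone Λ)
    (hFLC : FiniteLocalComplexity Λ) {F : ℕ → Set (Euc d)} (hF : IsVanHove F)
    {μ : Measure (PatternSpace Λ)} (hμ : PatternSpace.IsInvariantProbability μ)
    {C : Current Λ d} (hC : ∀ η, HasMean (hodgeStar η) (C η)) (C' : Current Λ d) :
    IsAsymptoticCycle Λ C' ↔ C' = C := by
  have key : ∀ {ν : Measure (PatternSpace Λ)}, PatternSpace.IsInvariantProbability ν →
      ∀ {η : Forms Λ d} {f : PatternSpace Λ → ℂ}, PatternSpace.IsExtension (hodgeStar η) f →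
        ∫ S, f S ∂ν = C η := fun hν η f hf =>
    PatternSpace.integral_eq_mean hΛ hFLC hF hν hf.continuous (by
      simpa only [hf.apply_orbit] using hC η)
  constructor
  · rintro ⟨ν, hν, H⟩
    ext η
    obtain ⟨f, hf, e⟩ := H η
    rw [e, key hν hf]
  · rintro rfl
    refine ⟨μ, hμ, fun η => ?_⟩
    obtain ⟨f, hf⟩ := (isEquivariant_hodgeStar η).exists_isExtension (contDiff_hodgeStar η)
    exact ⟨f, hf, (key hμ hf).symm⟩

/-- The cohomology class of a top-degree form. -/
noncomputable def topClass {Λ : Set (Euc d)} (η : Forms Λ d) : Cohomology Λ d :=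
  cohomologyClass ⟨η, by rw [cocycles_eq_top]; trivial⟩

lemma homologyClass_topClass {Λ : Set (Euc d)} (C : Current Λ d) (hC : C.IsClosed)
    (η : Forms Λ d) : C.homologyClass hC (topClass η) = C η := rfl

lemma topClass_eq {Λ : Set (Euc d)} {η θ : Forms Λ d} (h : η - θ ∈ coboundaries Λ d) :
    topClass η = topClass θ :=
  (Submodule.Quotient.eq _).2 h

/-- The primitives in the Poincaré argument have degree `d - 1`, so dimension zero has to be
excluded. -/
lemma IsDelone.dim_ne_zero {Λ : Set (Euc d)} (hΛ : IsDelone Λ) : d ≠ 0 := by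
  rintro rfl
  exact hΛ.infinite (Set.toFinite Λ)

/-- The form `⋆ ∑_{y, y + z ∈ Λ} χ(· - y)`. -/
noncomputable def pairForm {Λ : Set (Euc d)} (hΛ : IsDelone Λ) (z : Euc d) {χ : Euc d → ℝ}
    (hs : ContDiff ℝ ∞ χ) (hc : HasCompactSupport χ) : Forms Λ d :=
  ofStar (pairSum Λ z fun x => (χ x : ℂ))
    (isEquivariant_pairSum z (hc.comp_left Complex.ofReal_zero))
    (contDiff_pairSum hΛ (Complex.ofRealCLM.contDiff.comp hs) (hc.comp_left Complex.ofReal_zero))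

lemma hodgeStar_pairForm {Λ : Set (Euc d)} (hΛ : IsDelone Λ) (z : Euc d) {χ : Euc d → ℝ}
    (hs : ContDiff ℝ ∞ χ) (hc : HasCompactSupport χ) :
    hodgeStar (pairForm hΛ z hs hc) = pairSum Λ z fun x => (χ x : ℂ) :=
  hodgeStar_ofStar _ _ _

/-- The class of the pairs of points of `Λ` with difference `z`. -/
noncomputable def pairClass {Λ : Set (Euc d)} (hΛ : IsDelone Λ) (z : Euc d) : Cohomology Λ d :=
  topClass (pairForm hΛ z (χ := bump.normed volume) bump.contDiff_normed
    bump.hasCompactSupport_normed)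

lemma topClass_pairForm {Λ : Set (Euc d)} (hΛ : IsDelone Λ) (z : Euc d) {χ : Euc d → ℝ}
    (hs : ContDiff ℝ ∞ χ) (hc : HasCompactSupport χ) (h1 : ∫ x, χ x = 1) :
    topClass (pairForm hΛ z hs hc) = pairClass hΛ z :=
  topClass_eq (ofStar_sub_mem_coboundaries hΛ hΛ.dim_ne_zero hs hc h1 bump.contDiff_normed
    bump.hasCompactSupport_normed (bump.integral_normed) (hodgeStar_pairForm hΛ z hs hc)
    (hodgeStar_pairForm hΛ z _ _))

lemma pairClass_eq_zero {Λ : Set (Euc d)} (hΛ : IsDelone Λ) {z : Euc d} (hz : z ∉ Λ - Λ) :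
    pairClass hΛ z = 0 := by
  have e : pairForm hΛ z (χ := bump.normed volume) bump.contDiff_normed
      bump.hasCompactSupport_normed = 0 := by
    refine forms_ext ((hodgeStar_pairForm hΛ z _ _).trans (funext fun x => ?_))
    rw [pairSum_eq_tsum]
    have : IsEmpty {y : Euc d // y ∈ Λ ∧ y + z ∈ Λ} :=
      ⟨fun ⟨y, hy, hyz⟩ => hz ⟨y + z, hyz, y, hy, add_sub_cancel_left y z⟩⟩
    rw [tsum_empty]
    rfl
  rw [pairClass, e]
  rfl

/-- The chosen bump has integral one, so the regularised comb has the same mean as the density of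
the marked points. -/
lemma homologyClass_pairClass {Λ : Set (Euc d)} (hΛ : IsDelone Λ) {F : ℕ → Set (Euc d)}
    (hF : IsVanHove F) {C : Current Λ d} (hC : ∀ η, HasMean (hodgeStar η) (C η))
    (hC' : C.IsClosed) {z : Euc d} {a : ℂ} (ha : HasDensity (comb Λ (pairWeight Λ z)) a) :
    C.homologyClass hC' (pairClass hΛ z) = a := by
  rw [pairClass, homologyClass_topClass]
  refine HasDensity.unique (hC _) ?_ hF
  have hc : HasCompactSupport (bump.normed (volume : Measure (Euc d))) :=
    bump.hasCompactSupport_normed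
  have := hasMean_pairSum hΛ (z := z) (Complex.continuous_ofReal.comp bump.continuous_normed)
    (hc.comp_left Complex.ofReal_zero) ha
  simp only [Function.comp_apply] at this
  rw [integral_complex_ofReal, bump.integral_normed, Complex.ofReal_one, one_mul] at this
  rw [hodgeStar_pairForm]
  exact this

/-- The volume form is the witness: its Hodge star is the constant one, which has mean one. -/
lemma homologyClass_ne_zero {Λ : Set (Euc d)} {F : ℕ → Set (Euc d)}
    (hF : IsVanHove F) {C : Current Λ d} (hC : ∀ η, HasMean (hodgeStar η) (C η))
    (hC' : C.IsClosed) : C.homologyClass hC' ≠ 0 := by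
  intro h
  set η : Forms Λ d := ofStar (fun _ => 1) ⟨1, one_pos, fun _ _ _ => rfl⟩ contDiff_const
  have h0 : C η = 0 := by rw [← homologyClass_topClass C hC', h]; rfl
  have h1 : C η = 1 := by
    have e : hodgeStar η = fun _ => 1 := hodgeStar_ofStar _ _ _
    refine HasDensity.unique (hC η) ?_ hF
    rw [e]
    exact HasMean.const 1
  rw [h0] at h1
  exact zero_ne_one h1

end Delone

theorem theorem1p2 {d : ℕ} (Λ : Set (Euc d)) (hΛ : IsDelone Λ) (hFLC : FiniteLocalComplexity Λ)
    (F : ℕ → Set (Euc d)) (hF : IsVanHove F) (hUCF : UniformClusterFrequencies Λ F) :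
    -- the translation action on the pattern space is uniquely ergodic
    (∃! μ : Measure (PatternSpace Λ), PatternSpace.IsInvariantProbability μ) ∧
    -- there is a unique asymptotic cycle, it is closed, and its homology class is nontrivial
    ∃ (C : Current Λ d) (hC : C.IsClosed),
      IsAsymptoticCycle Λ C ∧
      (∀ C' : Current Λ d, IsAsymptoticCycle Λ C' → C' = C) ∧
      (∀ G : ℕ → Set (Euc d), IsVanHove G → ∀ η : Forms Λ d,
        Tendsto (fun n => ((volume.real (G n))⁻¹ : ℂ) * ∫ t in G n, hodgeStar η t)
          atTop (𝓝 (C η))) ∧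
      C.homologyClass hC ≠ 0 ∧
      -- the autocorrelation `γ`, the diffraction measure `σ` and the dual family of classes
      ∃ (γ σ : Measure (Euc d)) (lam : Euc d → Cohomology Λ d),
        (∀ G : ℕ → Set (Euc d), IsVanHove G → IsAutocorrelation Λ G γ) ∧
        γ (Λ - Λ)ᶜ = 0 ∧
        (∀ x ∈ Λ, ∀ y ∈ Λ, HasUniformFrequency Λ F {x, y} (γ.real {x - y})) ∧
        IsFourierTransform γ σ ∧
        (∀ x, x ∉ Λ - Λ → lam x = 0) ∧
        -- `lam x` is the class of the product of the Dirac combs of `Λ - x` and `Λ`,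
        -- regularised by any bump function of integral one
        (∀ χ : Euc d → ℝ, ContDiff ℝ ∞ χ → HasCompactSupport χ → (∫ t, χ t) = 1 →
          ∀ x, ∃ η : cocycles Λ d, cohomologyClass η = lam x ∧
            ∀ t, hodgeStar η.1 t = ∑' y : {y : Euc d // y ∈ Λ ∧ y + x ∈ Λ}, (χ (t - y) : ℂ)) ∧
        -- duality with the asymptotic cycle
        (∀ x, C.homologyClass hC (lam x) = (γ.real {x} : ℂ)) ∧
        (∀ φ : 𝓢(Euc d, ℂ),
          HasSum (fun x : ↥(Λ - Λ) => C.homologyClass hC (lam x) * 𝓕 φ (x : Euc d))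
            (∫ k, φ k ∂σ)) := by
  obtain ⟨C, hC⟩ := hΛ.exists_current hFLC hF hUCF
  have hCcl : C.IsClosed := fun η hη =>
    HasDensity.unique (hC η) (hasMean_hodgeStar_exact hΛ hFLC hη) hF
  have hμ := PatternSpace.existsUnique_isInvariantProbability hΛ hFLC hF
    fun _ hg => hΛ.exists_hasMean hFLC hF hUCF hg
  obtain ⟨μ, hμ', -⟩ := id hμ
  obtain ⟨a, ha0, ha1, ha⟩ := hΛ.exists_pairDensity hFLC hF hUCF
  have hγ := fun G hG => hΛ.isAutocorrelation_weightedComb hFLC ha0 ha (G := G) hG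
  have hγz := weightedComb_real_singleton ha0 ha1
  obtain ⟨σ, hσ, hσint⟩ := hΛ.exists_isFourierTransform hF (ha 0) (hγ F hF)
  refine ⟨hμ, C, hCcl, (isAsymptoticCycle_iff hΛ hFLC hF hμ' hC C).2 rfl,
    fun C' => (isAsymptoticCycle_iff hΛ hFLC hF hμ' hC C').1,
    fun G hG η => HasDensity.tendsto (hC η) hG, homologyClass_ne_zero hF hC hCcl,
    weightedComb (Λ - Λ) a, σ, pairClass hΛ, hγ, ?_, fun x _ y _ => ?_, hσ,
    fun x hx => pairClass_eq_zero hΛ hx, fun χ hχ hχc hχ1 x => ?_, fun x => ?_, fun φ => ?_⟩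
  · exact weightedComb_compl _ (hΛ.countable.image2 hΛ.countable _).measurableSet a
  · rw [hγz]
    exact hΛ.hasUniformFrequency_pair hF x y (ha _)
  · refine ⟨⟨pairForm hΛ x hχ hχc, by rw [cocycles_eq_top]; trivial⟩,
      topClass_pairForm hΛ x hχ hχc hχ1, fun t => ?_⟩
    rw [hodgeStar_pairForm, pairSum_eq_tsum]
  · rw [hγz]
    exact homologyClass_pairClass hΛ hF hC hCcl (ha x)
  · obtain ⟨hi, e⟩ := hσint φ
    rw [e]
    simp only [homologyClass_pairClass hΛ hF hC hCcl (ha _)]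
    exact hasSum_integral_weightedComb ha0 hi
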